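/- Let $\lambda<\mu\le\infty$ with $\lambda$ an infinite cardinal, and let $\mathfrak s=(K_{\mathfrak s},\le_{\mathfrak s},\mathcal S^{\rm bs}_{\mathfrak s},\text{non-forking})$ be a good $\lambda$-frame, or more generally a good ess-$[\lambda,\mu)$-frame: the axioms of a good frame hold for all models of cardinality in $[\lambda,\mu)$, and the underlying class satisfies the axioms of an abstract elementary class restricted to these cardinalities, where symbols may have infinite arity $\le\lambda$ and the union of an increasing chain (if of cardinality $<\mu$) carries exactly one structure in $K_{\mathfrak s}$ that extends all members of the chain. Definitions. For $M\in K_{\mathfrak s}$ let ${\rm seq}(M)=\{\bar a\in{}^\lambda M: M\restriction{\rm Rang}(\bar a)\le_{\mathfrak s}M\}$. A smooth equivalence relation $\mathbb E$ assigns to each $M\in K_{\mathfrak s}$ an equivalence relation $\mathbb E_M$ on a subset ${\rm dom}(\mathbb E_M)$ of ${\rm seq}(M)$ such that $\mathbb E_N\restriction{\rm seq}(M)=\mathbb E_M$ if $M\le_{\mathfrak s}N$, isomorphisms $M\to N$ map $\mathbb E_M$ onto $\mathbb E_N$, and if $\langle M_\alpha:\alpha\le\delta\rangle$ is increasing continuous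 ($\delta$ a limit ordinal) then each class of $\mathbb E_{M_\delta}$ has a member in $\bigcup_{\alpha<\delta}{\rm seq}(M_\alpha)$. It is small if $\mathbb E_M$ has at most $\|M\|$ classes for every $M$. For such $\mathbb E$, a member $M^*$ of the class of $\mathfrak s\langle\mathbb E\rangle$ with witness $M\in K_{\mathfrak s}$ is the disjoint union of $M$ (named by a new predicate), a new constant $c_*$, and a set of new elements in bijection with ${\rm dom}(\mathbb E_M)/\mathbb E_M$; a new $\lambda$-place function $F_*$ maps $\bar a\in{\rm dom}(\mathbb E_M)$ to the element of its class, and $F_*$ and the old functions have the value $c_*$ on all other tuples that are not, respectively, in ${\rm dom}(\mathbb E_M)$ or from $M$. Put $M^*\le N^*$ iff $M^*$ is a submodel of $N^*$ and the witnesses satisfy $M\le_{\mathfrak s}N$; basic triples and non-forking in $\mathfrak s\langle\mathbb E\rangle$ are those of the witnesses. Two basic types are parallel if they have a common non-forking extension. A basic type $p$ over $M$ does not split over $A\subseteq M$ if there is a class $\mathbf P$ of basic types over models in the place of $(M,A)$ (the models reached from $M$ by finitely many steps up or down along $\le$ through models including $A$) that is invariant under isomorphisms over $A$, is closed under non-forking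 extensions and under restrictions of which the type is a non-forking extension, has $p$ as its only member over $M$, and whose members over any $N\ge M$ do not fork over $M$. (1) Let $M_*\in K_{\mathfrak s}$ and $p^*\in\mathcal S^{\rm bs}_{\mathfrak s}(M_*)$. Let $S$ be the minimal class of triples $(N,\bar a,p)$ such that: (i) $(M_*,\bar a,p^*)\in S$ if $\bar a\in{\rm seq}(M_*)$ and $p^*$ does not fork over $M_*\restriction{\rm Rang}(\bar a)$; (ii) $S$ is closed under isomorphisms; (iii) if $N_1\le_{\mathfrak s}N_2$, $\bar a\in{\rm seq}(N_1)$ and $p_2\in\mathcal S^{\rm bs}_{\mathfrak s}(N_2)$ does not fork over $N_1\restriction{\rm Rang}(\bar a)$, then $(N_2,\bar a,p_2)\in S\Leftrightarrow(N_1,\bar a,p_2\restriction N_1)\in S$; (iv) if $\bar a_1,\bar a_2\in{\rm seq}(N)$ and $p\in\mathcal S^{\rm bs}_{\mathfrak s}(N)$ does not fork over $N\restriction{\rm Rang}(\bar a_\ell)$ for $\ell=1,2$, then $(N,\bar a_1,p)\in S\Leftrightarrow(N,\bar a_2,p)\in S$. Then there are a small smooth $\mathbb E$ and a partial function $\mathbf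 F$ such that: $\mathbf F(N,\bar a)$ is defined iff $N\in K_{\mathfrak s}$ and $\bar a\in{\rm dom}(\mathbb E_N)$, iff $(N,\bar a,p)\in S$ for some $p$; when defined it is a $p\in\mathcal S^{\rm bs}_{\mathfrak s}(N)$ with $(N,\bar a,p)\in S$; for each $(N,\bar a,p)\in S$ there is $\bar b$ with ${\rm Rang}(\bar b)={\rm Rang}(\bar a)$ and $\mathbf F(N,\bar b)=p$; for $\bar a,\bar b\in{\rm dom}(\mathbb E_N)$, $\bar a\,\mathbb E_N\,\bar b$ iff $\mathbf F(N,\bar a)=\mathbf F(N,\bar b)$; $\mathbf F$ commutes with isomorphisms; and if $M\le_{\mathfrak s}N$ and $\bar a\in{\rm dom}(\mathbb E_M)$ then $\mathbf F(N,\bar a)$ is the non-forking extension of $\mathbf F(M,\bar a)$. (2) There are a small smooth $\mathbb E$ and a function $\mathbf F$ such that: $(\alpha)$ $\mathbf F(N,\bar a)$ is defined iff $N\in K_{\mathfrak s}$ and $\bar a\in{\rm seq}(N)$; $(\beta)$ then $\mathbf F(N,\bar a)\in\mathcal S^{\rm bs}_{\mathfrak s}(N)$; $(\gamma)$ if $N\in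 K_{\mathfrak s}$ and $p\in\mathcal S^{\rm bs}_{\mathfrak s}(N)$ then $\mathbf F(N,\bar a)=p$ for some $\bar a\in{\rm seq}(N)$, with ${\rm Rang}(\bar a)=N$ if $\|N\|=\lambda$; $(\delta)$ if $M\le_{\mathfrak s}N$ and $\bar a\in{\rm seq}(M)$ then $\mathbf F(N,\bar a)$ is the non-forking extension of $\mathbf F(M,\bar a)$; $(\varepsilon)$ for $\bar a_1,\bar a_2\in{\rm seq}(N)$, $\bar a_1\,\mathbb E_N\,\bar a_2\Leftrightarrow\mathbf F(N,\bar a_1)=\mathbf F(N,\bar a_2)$; $(\zeta)$ $\mathbf F$ commutes with isomorphisms. Here $\mathbb E$ is determined by $\mathbf F$, and the pair is unique in the following sense: if $(\mathbb E,\mathbf F)$ and $(\mathbb E',\mathbf F')$ are as above, there is exactly one family of bijections $h_N:{\rm seq}(N)/\mathbb E_N\to{\rm seq}(N)/\mathbb E'_N$ ($N\in K_{\mathfrak s}$) that is compatible with $\le_{\mathfrak s}$-extensions and with isomorphisms and satisfies $\mathbf F(N,\bar a)=\mathbf F'(N,\bar b)$ whenever $h_N(\bar a/\mathbb E_N)=\bar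 b/\mathbb E'_N$. (3) Let $(\mathbb E,\mathbf F)$ be as in (2) and $\mathfrak t=\mathfrak s\langle\mathbb E\rangle$. $(\alpha)$ If $M_\ell$ witnesses $M^*_\ell\in K_{\mathfrak t}$ for $\ell=1,2$ and $(M_1^*,M_2^*,a)$ is a basic triple of $\mathfrak t$, then $(M_1,M_2,a)$ is a basic triple of $\mathfrak s$; and each $p^*\in\mathcal S^{\rm bs}_{\mathfrak t}(M^*)$, with $M$ the witness for $M^*$, has a unique projection $p\in\mathcal S^{\rm bs}_{\mathfrak s}(M)$, meaning that whenever $p^*$ is the type of $a$ over $M^*$ in $N^*$ and $N$ is the witness for $N^*$, $p$ is the type of $a$ over $M$ in $N$. Moreover there is a function ${\rm bas}$ such that, for $p^*$ and $p$ as above, ${\rm bas}(p^*)\in M^*$, there is $\bar a\in{\rm seq}(M)$ with $\mathbf F(M,\bar a)=p$, and ${\rm bas}(p^*)=F_*^{M^*}(\bar a)$ (the element $\bar a/\mathbb E_M$) for every such $\bar a$; and: $(\beta)$ if $M^*_\ell\le_{\mathfrak t}M^*$ and $p^*_\ell\in\mathcal S^{\rm bs}_{\mathfrak t}(M^*_\ell)$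 for $\ell=1,2$, then $p_1^*$ and $p_2^*$ are parallel iff ${\rm bas}(p^*_1)={\rm bas}(p^*_2)$; $(\gamma)$ every $p^*\in\mathcal S^{\rm bs}_{\mathfrak t}(M^*)$ does not split over $\{{\rm bas}(p^*)\}$; in particular every automorphism of $M^*$ that fixes ${\rm bas}(p^*)$ maps $p^*$ to itself. -/

import Mathlib

universe u

open Cardinal Ordinal

/-! ## Vocabularies and models

Models have universes that are sets of elements of the set-theoretic universe `ZFSet`, so that
inclusion, unions of chains and proper classes of models are literally available. -/

/-- A vocabulary: predicates and function symbols; an arity is an arbitrary (possibly infinite)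
index set. -/
structure Vocab where
  Rel : Type u
  Fun : Type u
  relArity : Rel → Type u
  funArity : Fun → Type u

/-- A `τ`-model. Predicates hold only of tuples from the universe; outside the universe the
functions take the value `∅`, so that two models are equal iff they have the same universe and
the same interpretations. -/
@[ext] structure Model (τ : Vocab.{u}) where
  carrier : Set ZFSet.{u}
  rel : ∀ R : τ.Rel, Set (τ.relArity R → ZFSet.{u})
  fn : ∀ G : τ.Fun, (τ.funArity G → ZFSet.{u}) → ZFSet.{u}
  rel_sub : ∀ R, ∀ x ∈ rel R, ∀ i, x i ∈ carrier
  fn_mem : ∀ G x, (∀ i, x i ∈ carrier) → fn G x ∈ carrier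
  fn_junk : ∀ G x, ¬ (∀ i, x i ∈ carrier) → fn G x = ∅

namespace Model

variable {τ : Vocab.{u}}

/-- `M` is a submodel of `N`. -/
structure IsSub (M N : Model τ) : Prop where
  carrier : M.carrier ⊆ N.carrier
  rel : ∀ R x, (∀ i, x i ∈ M.carrier) → (x ∈ M.rel R ↔ x ∈ N.rel R)
  fn : ∀ G x, (∀ i, x i ∈ M.carrier) → M.fn G x = N.fn G x

/-- `f` (restricted to the universe of `M`) is an isomorphism from `M` onto `N`. -/
structure IsIso (f : ZFSet.{u} → ZFSet.{u}) (M N : Model τ) : Prop where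
  bij : Set.BijOn f M.carrier N.carrier
  rel : ∀ R x, (∀ i, x i ∈ M.carrier) → (x ∈ M.rel R ↔ f ∘ x ∈ N.rel R)
  fn : ∀ G x, (∀ i, x i ∈ M.carrier) → f (M.fn G x) = N.fn G (f ∘ x)

/-- `M` and `N` are isomorphic. -/
def Isomorphic (M N : Model τ) : Prop := ∃ f, IsIso f M N

/-- The cardinality of the universe of `M`. -/
noncomputable def card (M : Model τ) : Cardinal.{u + 1} := #M.carrier

end Model

/-! ## Essentially abstract elementary classes -/

/-- The data of a class of models with a two-place relation on it. -/
structure AECData where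
  voc : Vocab.{u}
  K : Model voc → Prop
  le : Model voc → Model voc → Prop

/-- `lam`-sequences. -/
abbrev LSeq (lam : Cardinal.{u}) : Type (u + 1) := lam.ord.ToType → ZFSet.{u}

namespace AECData

variable (k : AECData.{u})

/-- `⟨M i : i < δ⟩` is increasing. -/
def Increasing (δ : Ordinal.{u}) (M : Ordinal.{u} → Model k.voc) : Prop :=
  (∀ i, i < δ → k.K (M i)) ∧ ∀ i j, i ≤ j → j < δ → k.le (M i) (M j)

/-- `⟨M i : i ≤ δ⟩` is increasing continuous. -/
def IncreasingCont (δ : Ordinal.{u}) (M : Ordinal.{u} → Model k.voc) : Prop :=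
  (∀ i, i ≤ δ → k.K (M i)) ∧ (∀ i j, i ≤ j → j ≤ δ → k.le (M i) (M j)) ∧
  ∀ i, i ≤ δ → Order.IsSuccLimit i → (M i).carrier = ⋃ j ∈ Set.Iio i, (M j).carrier

/-- `f` is a `k`-embedding of `M` into `N`. -/
def IsEmb (f : ZFSet.{u} → ZFSet.{u}) (M N : Model k.voc) : Prop :=
  ∃ N', k.le N' N ∧ Model.IsIso f M N'

/-- `k` is an essentially `[lam, mu)`-AEC. The value `mu = Cardinal.univ` is the case `mu = ∞`:
a class of elements of `ZFSet` is a set iff its cardinality is below `Cardinal.univ`. -/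
structure IsEssAEC (lam : Cardinal.{u}) (mu : Cardinal.{u + 1}) : Prop where
  aleph0_le : ℵ₀ ≤ lam
  lt_mu : Cardinal.lift.{u + 1} lam < mu
  mu_le : mu ≤ Cardinal.univ.{u, u + 1}
  rel_arity : ∀ R, #(k.voc.relArity R) ≤ lam
  fun_arity : ∀ G, #(k.voc.funArity G) ≤ lam
  le_mem : ∀ M N, k.le M N → k.K M ∧ k.K N
  le_sub : ∀ M N, k.le M N → M.IsSub N
  iso_mem : ∀ f M₁ M₂, Model.IsIso f M₁ M₂ → k.K M₁ → k.K M₂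
  iso_le : ∀ f M₁ M₂ N₁ N₂, Model.IsIso f N₁ N₂ → Model.IsIso f M₁ M₂ → k.le M₁ N₁ → k.le M₂ N₂
  card_mem : ∀ M, k.K M → Cardinal.lift.{u + 1} lam ≤ M.card ∧ M.card < mu
  le_refl : ∀ M, k.K M → k.le M M
  le_trans : ∀ M₁ M₂ M₃, k.le M₁ M₂ → k.le M₂ M₃ → k.le M₁ M₃
  union : ∀ δ M, Order.IsSuccLimit δ → k.Increasing δ M →
    #(⋃ i ∈ Set.Iio δ, (M i).carrier : Set ZFSet.{u}) < mu →
    ∃! N, k.K N ∧ N.carrier = ⋃ i ∈ Set.Iio δ, (M i).carrier ∧ ∀ i, i < δ → k.le (M i) N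
  union_le : ∀ δ M N N', Order.IsSuccLimit δ → k.Increasing δ M →
    k.K N → N.carrier = ⋃ i ∈ Set.Iio δ, (M i).carrier → (∀ i, i < δ → k.le (M i) N) →
    (∀ i, i < δ → k.le (M i) N') → k.le N N'
  coherence : ∀ M₁ M₂ N, M₁.IsSub M₂ → k.le M₁ N → k.le M₂ N → k.le M₁ M₂
  lowenheim : ∀ N (A : Set ZFSet.{u}), k.K N → A ⊆ N.carrier →
    ∃ M, A ⊆ M.carrier ∧ k.le M N ∧ M.card ≤ Cardinal.lift.{u + 1} lam + #A

/-- `M` is a superlimit model in the cardinal `χ`. -/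
structure IsSuperlimit (χ : Cardinal.{u + 1}) (M : Model k.voc) : Prop where
  mem : k.K M
  card : M.card = χ
  universal : ∀ N, k.K N → N.card = χ → ∃ f, k.IsEmb f N M
  proper : ∃ N, k.le M N ∧ N ≠ M ∧ M.Isomorphic N
  union : ∀ δ Ms N, Order.IsSuccLimit δ → Cardinal.lift.{u + 1} δ.card ≤ χ → k.Increasing δ Ms →
    (∀ i, i < δ → M.Isomorphic (Ms i)) → k.K N →
    N.carrier = ⋃ i ∈ Set.Iio δ, (Ms i).carrier → (∀ i, i < δ → k.le (Ms i) N) → M.Isomorphic N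

/-! ### Orbital types -/

/-- A pair `(N, a)` with `M ≤ N` and `a ∈ N`. -/
structure TypeRep (M : Model k.voc) where
  N : Model k.voc
  a : ZFSet.{u}
  le : k.le M N
  mem : a ∈ N.carrier

/-- The two pairs can be amalgamated over `M` with the two elements identified. -/
def AtRel (M : Model k.voc) (x y : k.TypeRep M) : Prop :=
  ∃ N f g, k.IsEmb f x.N N ∧ k.IsEmb g y.N N ∧
    Set.EqOn f id M.carrier ∧ Set.EqOn g id M.carrier ∧ f x.a = g y.a

/-- Orbital types over `M`: classes of pairs `(N, a)` under the equivalence relation generated by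
`AtRel`. -/
def OrbType (M : Model k.voc) : Type (u + 1) := Quot (k.AtRel M)

variable {k}

/-- `p = ortp(a, M, N)` (in particular `M ≤ N` and `a ∈ N`). -/
def IsOrtp (a : ZFSet.{u}) (M N : Model k.voc) (p : k.OrbType M) : Prop :=
  ∃ (h : k.le M N) (ha : a ∈ N.carrier), p = Quot.mk _ ⟨N, a, h, ha⟩

/-- `p₀ = p ↾ M₀`, where `M₀ ≤ M`. -/
def IsRestr {M₀ M : Model k.voc} (p₀ : k.OrbType M₀) (p : k.OrbType M) : Prop :=
  k.le M₀ M ∧ ∃ a N, IsOrtp a M N p ∧ IsOrtp a M₀ N p₀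

/-- `f(p₁) = p₂`, where `f` is an isomorphism from `M₁` onto `M₂`. -/
def Transports (f : ZFSet.{u} → ZFSet.{u}) {M₁ M₂ : Model k.voc}
    (p₁ : k.OrbType M₁) (p₂ : k.OrbType M₂) : Prop :=
  Model.IsIso f M₁ M₂ ∧ ∃ a N₁ N₂ g, IsOrtp a M₁ N₁ p₁ ∧ IsOrtp (g a) M₂ N₂ p₂ ∧
    Model.IsIso g N₁ N₂ ∧ Set.EqOn g f M₁.carrier

variable (k)

/-! ### Smooth equivalence relations -/

/-- The `lam`-sequences that list (possibly with repetitions) some `M₀ ≤ M`. -/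
def seq (lam : Cardinal.{u}) (M : Model k.voc) : Set (LSeq lam) :=
  {a | ∃ M₀, k.le M₀ M ∧ M₀.carrier = Set.range a}

/-- A family of two-place relations on `lam`-sequences, indexed by models; only its values at
members of `K` matter. -/
abbrev RelFam (lam : Cardinal.{u}) : Type (u + 1) := Model k.voc → LSeq lam → LSeq lam → Prop

variable {k}

/-- The equivalence classes of `E M` (its domain is the set of `a` with `E M a a`). -/
def classes {lam : Cardinal.{u}} (E : k.RelFam lam) (M : Model k.voc) : Set (Set (LSeq lam)) :=
  {c | ∃ a, E M a a ∧ c = {b | E M a b}}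

/-- `E` is a smooth equivalence relation: each `E M` is an equivalence relation on a subset of
`seq M`, compatible with extensions and with isomorphisms, and over the union of a continuous chain
every class is represented in some member of the chain. -/
structure IsSmooth {lam : Cardinal.{u}} (E : k.RelFam lam) : Prop where
  dom : ∀ M a b, k.K M → E M a b → a ∈ k.seq lam M ∧ b ∈ k.seq lam M
  symm : ∀ M a b, k.K M → E M a b → E M b a
  trans : ∀ M a b c, k.K M → E M a b → E M b c → E M a c
  ext : ∀ M₁ M₂ a b, k.le M₁ M₂ → a ∈ k.seq lam M₁ → b ∈ k.seq lam M₁ → (E M₂ a b ↔ E M₁ a b)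
  iso : ∀ f M₁ M₂ a b, k.K M₁ → Model.IsIso f M₁ M₂ → a ∈ k.seq lam M₁ → b ∈ k.seq lam M₁ →
    (E M₁ a b ↔ E M₂ (f ∘ a) (f ∘ b))
  cont : ∀ δ M, Order.IsSuccLimit δ → k.IncreasingCont δ M → ∀ a, E (M δ) a a →
    ∃ i, i < δ ∧ ∃ b ∈ k.seq lam (M i), E (M δ) a b

/-- `E` is small: `E M` has at most `‖M‖` classes. -/
def IsSmall {lam : Cardinal.{u}} (E : k.RelFam lam) : Prop :=
  ∀ M, k.K M → #(classes E M) ≤ M.card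

end AECData

/-! ## Frames -/

/-- The data of a frame: a class of models with `≤`, the basic types and the non-forking relation.
`nf M₀ M₁ a M₃` says that `ortp(a, M₁, M₃)` does not fork over `M₀`. -/
structure FrameData extends AECData.{u} where
  bs : ∀ M : Model voc, Set (toAECData.OrbType M)
  nf : Model voc → Model voc → ZFSet.{u} → Model voc → Prop

namespace FrameData

open AECData

variable {s : FrameData.{u}}

/-- `p ∈ S(M)` does not fork over `M₀`. -/
def Dnf (M₀ : Model s.voc) {M : Model s.voc} (p : s.OrbType M) : Prop :=
  ∃ a N, IsOrtp a M N p ∧ s.nf M₀ M a N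

/-- `q` is a non-forking extension of `p`. -/
def IsNfExt {M N : Model s.voc} (p : s.OrbType M) (q : s.OrbType N) : Prop :=
  q ∈ s.bs N ∧ IsRestr p q ∧ Dnf M q

/-- `(M, N, a)` is a basic triple: `M ≤ N`, a in N but not in M and `ortp(a, M, N)` is basic. -/
def IsBasicTriple (s : FrameData.{u}) (M N : Model s.voc) (a : ZFSet.{u}) : Prop :=
  a ∉ M.carrier ∧ ∃ p ∈ s.bs M, IsOrtp a M N p

/-- `s` is a good essentially `[lam, mu)`-frame. No bound on the number of models in `lam` up to
isomorphism is imposed; a good `lam`-frame is the case in which `mu` is the successor of `lam` and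
all arities are finite. -/
structure IsGood (s : FrameData.{u}) (lam : Cardinal.{u}) (mu : Cardinal.{u + 1}) : Prop where
  aec : s.IsEssAEC lam mu
  superlimit : ∀ χ, Cardinal.lift.{u + 1} lam ≤ χ → χ < mu → ∃ M, s.IsSuperlimit χ M
  amalgamation : ∀ M₀ M₁ M₂, s.le M₀ M₁ → s.le M₀ M₂ → ∃ N f₁ f₂,
    s.IsEmb f₁ M₁ N ∧ s.IsEmb f₂ M₂ N ∧ Set.EqOn f₁ id M₀.carrier ∧ Set.EqOn f₂ id M₀.carrier
  joint_embedding : ∀ M₁ M₂, s.K M₁ → s.K M₂ → ∃ N f₁ f₂, s.IsEmb f₁ M₁ N ∧ s.IsEmb f₂ M₂ N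
  no_maximal : ∀ M, s.K M → ∃ N, s.le M N ∧ N ≠ M
  bs_iso : ∀ f M₁ M₂ (p₁ : s.OrbType M₁) (p₂ : s.OrbType M₂),
    Transports f p₁ p₂ → p₁ ∈ s.bs M₁ → p₂ ∈ s.bs M₂
  bs_nonalg : ∀ M p, p ∈ s.bs M → ∀ a N, IsOrtp a M N p → a ∉ M.carrier
  density : ∀ M N, s.le M N → N ≠ M → ∃ a, s.IsBasicTriple M N a
  stability : ∀ M, s.K M → #(s.bs M) ≤ M.card
  nf_dom : ∀ M₀ M₁ a M₃, s.nf M₀ M₁ a M₃ → s.le M₀ M₁ ∧ s.le M₁ M₃ ∧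
    s.IsBasicTriple M₀ M₃ a ∧ s.IsBasicTriple M₁ M₃ a
  nf_iso : ∀ f M₀ M₁ a M₃ M₀' M₁' M₃', Model.IsIso f M₃ M₃' → Model.IsIso f M₀ M₀' →
    Model.IsIso f M₁ M₁' → s.nf M₀ M₁ a M₃ → s.nf M₀' M₁' (f a) M₃'
  nf_refl : ∀ M₀ a M₃, s.nf M₀ M₀ a M₃ ↔ s.IsBasicTriple M₀ M₃ a
  monotonicity : ∀ M₀ M₀' M₁' M₁ M₃ M₃' M₃'' a, s.le M₀ M₀' → s.le M₀' M₁' → s.le M₁' M₁ →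
    s.le M₁ M₃ → s.le M₃ M₃' → s.le M₃'' M₃' → M₁.carrier ⊆ M₃''.carrier → a ∈ M₃''.carrier →
    s.nf M₀ M₁ a M₃ → s.nf M₀' M₁' a M₃' ∧ s.nf M₀' M₁' a M₃''
  local_character : ∀ δ M N a, Order.IsSuccLimit δ → s.IncreasingCont δ M →
    s.IsBasicTriple (M δ) N a → ∃ i, i < δ ∧ s.nf (M i) (M δ) a N
  transitivity : ∀ M₀ M₁ M₂ M₃ a, s.nf M₀ M₁ a M₃ → s.nf M₁ M₂ a M₃ → s.nf M₀ M₂ a M₃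
  uniqueness : ∀ M₀ M₁ (p q : s.OrbType M₁) (r : s.OrbType M₀), p ∈ s.bs M₁ → q ∈ s.bs M₁ →
    Dnf M₀ p → Dnf M₀ q → IsRestr r p → IsRestr r q → p = q
  symmetry : ∀ M₀ M₃ a₁ a₂, s.IsBasicTriple M₀ M₃ a₁ → s.IsBasicTriple M₀ M₃ a₂ →
    (∃ M₁ M₃', s.le M₀ M₁ ∧ s.le M₁ M₃' ∧ s.le M₃ M₃' ∧ a₁ ∈ M₁.carrier ∧ s.nf M₀ M₁ a₂ M₃') →
    ∃ M₂ M₃', s.le M₀ M₂ ∧ s.le M₂ M₃' ∧ s.le M₃ M₃' ∧ a₂ ∈ M₂.carrier ∧ s.nf M₀ M₂ a₁ M₃'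
  extension : ∀ M N, s.le M N → ∀ p ∈ s.bs M, ∃ q : s.OrbType N, IsNfExt p q
  continuity : ∀ δ M (p : s.OrbType (M δ)), Order.IsSuccLimit δ → s.IncreasingCont δ M →
    (∀ i, i < δ → ∃ r ∈ s.bs (M i), IsRestr r p ∧ Dnf (M 0) r) → p ∈ s.bs (M δ) ∧ Dnf (M 0) p
  nf_amalgamation : ∀ M₀ M₁ M₂ a₁ a₂, s.IsBasicTriple M₀ M₁ a₁ → s.IsBasicTriple M₀ M₂ a₂ →
    ∃ M₃ N₁ N₂ f₁ f₂, s.le M₀ M₃ ∧ s.le N₁ M₃ ∧ s.le N₂ M₃ ∧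
      Model.IsIso f₁ M₁ N₁ ∧ Model.IsIso f₂ M₂ N₂ ∧
      Set.EqOn f₁ id M₀.carrier ∧ Set.EqOn f₂ id M₀.carrier ∧
      s.nf M₀ N₂ (f₁ a₁) M₃ ∧ s.nf M₀ N₁ (f₂ a₂) M₃

/-- Two types are parallel: they have a common basic non-forking extension. -/
def Parallel {M₁ M₂ : Model s.voc} (p₁ : s.OrbType M₁) (p₂ : s.OrbType M₂) : Prop :=
  ∃ (N : Model s.voc) (q : s.OrbType N), IsNfExt p₁ q ∧ IsNfExt p₂ q

/-! ### Places and non-splitting -/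

/-- `N` belongs to the place of `(M, A)`: `N` is reached from `M` by finitely many steps up or down
along `≤` through models that include `A`. -/
def InPlace (s : FrameData.{u}) (M : Model s.voc) (A : Set ZFSet.{u}) (N : Model s.voc) : Prop :=
  A ⊆ M.carrier ∧
    Relation.EqvGen (fun N₁ N₂ => A ⊆ N₁.carrier ∧ A ⊆ N₂.carrier ∧ s.le N₁ N₂) M N

/-- `P` is an invariant class of types in the place of `(M, A)`. -/
structure IsInvariant (M : Model s.voc) (A : Set ZFSet.{u})
    (P : ∀ N : Model s.voc, Set (s.OrbType N)) : Prop where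
  sub : ∀ N, ∀ p ∈ P N, s.InPlace M A N ∧ p ∈ s.bs N
  iso : ∀ f N₁ N₂ (p₁ : s.OrbType N₁) (p₂ : s.OrbType N₂), s.InPlace M A N₁ → s.InPlace M A N₂ →
    Set.EqOn f id A → Transports f p₁ p₂ → (p₁ ∈ P N₁ ↔ p₂ ∈ P N₂)
  nf : ∀ N₁ N₂ (p₁ : s.OrbType N₁) (p₂ : s.OrbType N₂), s.InPlace M A N₁ → s.InPlace M A N₂ →
    IsNfExt p₁ p₂ → (p₂ ∈ P N₂ ↔ p₁ ∈ P N₁)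

/-- `p ∈ S^bs(M)` does not split over `A`: there is an invariant class of types in the place of
`(M, A)` whose only member over `M` is `p` and whose members over extensions of `M` do not fork
over `M`. -/
def DoesNotSplit {M : Model s.voc} (p : s.OrbType M) (A : Set ZFSet.{u}) : Prop :=
  p ∈ s.bs M ∧ A ⊆ M.carrier ∧ ∃ P : ∀ N : Model s.voc, Set (s.OrbType N),
    IsInvariant M A P ∧ P M = {p} ∧ ∀ N, s.le M N → ∀ q ∈ P N, Dnf M q

end FrameData

/-! ## The expansion by names for equivalence classes -/

/-- The predicates of the expanded vocabulary: the old ones and a new `P`. -/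
inductive ExpRel (R : Type u) : Type u
  | old (r : R)
  | P

/-- The function symbols of the expanded vocabulary: the old ones, a `lam`-place function symbol
`F` and an individual constant `c`. -/
inductive ExpFun (G : Type u) : Type u
  | old (g : G)
  | F
  | c

/-- The expanded vocabulary. -/
def Vocab.expand (τ : Vocab.{u}) (lam : Cardinal.{u}) : Vocab.{u} where
  Rel := ExpRel τ.Rel
  Fun := ExpFun τ.Fun
  relArity
    | .old r => τ.relArity r
    | .P => PUnit
  funArity
    | .old g => τ.funArity g
    | .F => lam.ord.ToType
    | .c => PEmpty

namespace Model

variable {τ : Vocab.{u}} {lam : Cardinal.{u}}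

/-- The interpretation of the constant `c`. -/
def cstar (Ms : Model (τ.expand lam)) : ZFSet.{u} := Ms.fn .c PEmpty.elim

/-- The interpretation of `F`. -/
def Fstar (Ms : Model (τ.expand lam)) (a : LSeq lam) : ZFSet.{u} := Ms.fn .F a

end Model

namespace AECData

variable {k : AECData.{u}} {lam : Cardinal.{u}}

/-- `M ∈ K` is a witness for `Ms`: `Ms` is the disjoint union of `M` (named by `P`), the constant
`c` and one element for each `E M`-class, to which `F` maps the members of the class. -/
structure IsWitness (E : k.RelFam lam) (M : Model k.voc) (Ms : Model (k.voc.expand lam)) :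
    Prop where
  mem : k.K M
  P : Ms.rel .P = {x | x PUnit.unit ∈ M.carrier}
  rel : ∀ R, Ms.rel (.old R) = M.rel R
  fn_in : ∀ (G : k.voc.Fun) (x : k.voc.funArity G → ZFSet.{u}), (∀ i, x i ∈ M.carrier) →
    Ms.fn (.old G) x = M.fn G x
  fn_out : ∀ (G : k.voc.Fun) (x : k.voc.funArity G → ZFSet.{u}), (∀ i, x i ∈ Ms.carrier) →
    ¬ (∀ i, x i ∈ M.carrier) → Ms.fn (.old G) x = Ms.cstar
  F_mem : ∀ a, E M a a → Ms.Fstar a ∈ Ms.carrier ∧ Ms.Fstar a ∉ M.carrier ∧ Ms.Fstar a ≠ Ms.cstar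
  F_eq : ∀ a b, E M a a → E M b b → (Ms.Fstar a = Ms.Fstar b ↔ E M a b)
  F_out : ∀ a, (∀ i, a i ∈ Ms.carrier) → ¬ E M a a → Ms.Fstar a = Ms.cstar
  c_notMem : Ms.cstar ∉ M.carrier
  F_surj : ∀ b ∈ Ms.carrier, b ∉ M.carrier → b ≠ Ms.cstar → ∃ a, E M a a ∧ Ms.Fstar a = b

/-- The class `k⟨E⟩`. -/
def expand (k : AECData.{u}) (E : k.RelFam lam) : AECData.{u} where
  voc := k.voc.expand lam
  K Ms := ∃ M, IsWitness E M Ms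
  le Ms Ns := Ms.IsSub Ns ∧ ∃ M N, IsWitness E M Ms ∧ IsWitness E N Ns ∧ k.le M N

end AECData

namespace FrameData

open AECData

variable {s : FrameData.{u}} {lam : Cardinal.{u}}

/-- The frame `s⟨E⟩`: basic types and non-forking are those of the witnesses. -/
def expand (s : FrameData.{u}) (E : s.RelFam lam) : FrameData.{u} where
  toAECData := s.toAECData.expand E
  bs Ms := {p | ∃ Ns a M N, IsOrtp a Ms Ns p ∧ IsWitness E M Ms ∧ IsWitness E N Ns ∧
    s.IsBasicTriple M N a}
  nf Ms₀ Ms₁ a Ms₃ := (s.toAECData.expand E).le Ms₀ Ms₁ ∧ (s.toAECData.expand E).le Ms₁ Ms₃ ∧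
    ∃ M₀ M₁ M₃, IsWitness E M₀ Ms₀ ∧ IsWitness E M₁ Ms₁ ∧ IsWitness E M₃ Ms₃ ∧ s.nf M₀ M₁ a M₃

/-- A basic type `ps` of `s⟨E⟩` over `Ms`, where `M` is the witness for `Ms`, is projected to the
basic type `p` over `M`: if `ps` is the type of `a` in `Ns` then `p` is the type of `a` in the
witness for `Ns`. -/
def ProjectsTo (E : s.RelFam lam) (M : Model s.voc) {Ms : Model (s.expand E).voc}
    (ps : (s.expand E).OrbType Ms) (p : s.OrbType M) : Prop :=
  ps ∈ (s.expand E).bs Ms ∧ p ∈ s.bs M ∧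
    ∀ a N Ns, IsWitness E N Ns → IsOrtp a Ms Ns ps → IsOrtp a M N p

/-! ## Functions from sequences to basic types -/

/-- A partial function of `N` and `a` with values in `S(N)`. -/
abbrev TypeFun (s : FrameData.{u}) (lam : Cardinal.{u}) : Type (u + 1) :=
  ∀ N : Model s.voc, LSeq lam → Option (s.OrbType N)

/-- `F` is compatible with non-forking extensions: the value over `N` is the non-forking extension
of the value over `M`. -/
def TypeFun.NfCompatible (F : s.TypeFun lam) : Prop :=
  ∀ M N a p, s.le M N → a ∈ s.seq lam M → F M a = some p → ∃ q, F N a = some q ∧ IsNfExt p q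

/-- `F` commutes with isomorphisms. -/
def TypeFun.IsoCompatible (F : s.TypeFun lam) : Prop :=
  ∀ f N₁ N₂ a p, Model.IsIso f N₁ N₂ → F N₁ a = some p →
    ∃ q, F N₂ (f ∘ a) = some q ∧ Transports f p q

/-- `E` is a small smooth equivalence relation, and `F` assigns to every `a ∈ seq N` a basic type
over `N` in such a way that `E` is equality of the values. -/
structure IsImaginarySystem (E : s.RelFam lam) (F : s.TypeFun lam) : Prop where
  smooth : IsSmooth E
  small : IsSmall E
  dom : ∀ N a, (F N a).isSome ↔ s.K N ∧ a ∈ s.seq lam N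
  bs : ∀ N a p, F N a = some p → p ∈ s.bs N
  surj : ∀ N, s.K N → ∀ p ∈ s.bs N, ∃ a ∈ s.seq lam N, F N a = some p ∧
    (N.card = Cardinal.lift.{u + 1} lam → Set.range a = N.carrier)
  nfCompatible : F.NfCompatible
  eq_iff : ∀ N a₁ a₂ p₁ p₂, a₁ ∈ s.seq lam N → a₂ ∈ s.seq lam N →
    F N a₁ = some p₁ → F N a₂ = some p₂ → (E N a₁ a₂ ↔ p₁ = p₂)
  isoCompatible : F.IsoCompatible

/-- `p` does not fork over the submodel of `N` listed by `a`. -/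
def DnfSeq {N : Model s.voc} (p : s.OrbType N) (a : LSeq lam) : Prop :=
  ∃ M₀, s.le M₀ N ∧ M₀.carrier = Set.range a ∧ Dnf M₀ p

/-- The minimal class of triples `(N, a, p)` that contains `(Mst, a, pst)` whenever `pst` does not
fork over `a ∈ seq Mst` and is closed under isomorphisms, under non-forking extensions and
restrictions, and under replacing `a` by another sequence over which `p` does not fork. -/
inductive CopyClass (s : FrameData.{u}) (lam : Cardinal.{u}) (Mst : Model s.voc)
    (pst : s.OrbType Mst) : (N : Model s.voc) → LSeq lam → s.OrbType N → Prop
  | base (a : LSeq lam) : a ∈ s.seq lam Mst → DnfSeq pst a → CopyClass s lam Mst pst Mst a pst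
  | iso (f : ZFSet.{u} → ZFSet.{u}) (N₁ N₂ : Model s.voc) (a : LSeq lam) (p₁ : s.OrbType N₁)
      (p₂ : s.OrbType N₂) : Transports f p₁ p₂ → CopyClass s lam Mst pst N₁ a p₁ →
      CopyClass s lam Mst pst N₂ (f ∘ a) p₂
  | up (N₁ N₂ : Model s.voc) (a : LSeq lam) (p₁ : s.OrbType N₁) (p₂ : s.OrbType N₂) :
      a ∈ s.seq lam N₁ → p₂ ∈ s.bs N₂ → DnfSeq p₂ a → IsRestr p₁ p₂ →
      CopyClass s lam Mst pst N₁ a p₁ → CopyClass s lam Mst pst N₂ a p₂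
  | down (N₁ N₂ : Model s.voc) (a : LSeq lam) (p₁ : s.OrbType N₁) (p₂ : s.OrbType N₂) :
      a ∈ s.seq lam N₁ → p₂ ∈ s.bs N₂ → DnfSeq p₂ a → IsRestr p₁ p₂ →
      CopyClass s lam Mst pst N₂ a p₂ → CopyClass s lam Mst pst N₁ a p₁
  | swap (N : Model s.voc) (a₁ a₂ : LSeq lam) (p : s.OrbType N) :
      a₁ ∈ s.seq lam N → a₂ ∈ s.seq lam N → p ∈ s.bs N → DnfSeq p a₁ → DnfSeq p a₂ →
      CopyClass s lam Mst pst N a₁ p → CopyClass s lam Mst pst N a₂ p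

/-- `E` and `F` name the copies of the basic type `pst` over `Mst`. -/
structure IsLocalImaginarySystem (Mst : Model s.voc) (pst : s.OrbType Mst) (E : s.RelFam lam)
    (F : s.TypeFun lam) : Prop where
  smooth : IsSmooth E
  small : IsSmall E
  dom : ∀ N a, (F N a).isSome ↔ s.K N ∧ E N a a
  bs : ∀ N a p, F N a = some p → p ∈ s.bs N
  dom_iff : ∀ N a, (F N a).isSome ↔ ∃ p, CopyClass s lam Mst pst N a p
  copy : ∀ N a p, F N a = some p → CopyClass s lam Mst pst N a p
  surj : ∀ N a p, CopyClass s lam Mst pst N a p → ∃ b, Set.range b = Set.range a ∧ F N b = some p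
  eq_iff : ∀ N a₁ a₂ p₁ p₂, F N a₁ = some p₁ → F N a₂ = some p₂ → (E N a₁ a₂ ↔ p₁ = p₂)
  nfCompatible : F.NfCompatible
  isoCompatible : F.IsoCompatible

/-- `h` is a family of bijections between the sets of classes of `E` and of `E'` that matches the
types given by `F` and `F'` and is compatible with extensions and isomorphisms. -/
structure IsCanonicalIso (E : s.RelFam lam) (F : s.TypeFun lam) (E' : s.RelFam lam)
    (F' : s.TypeFun lam) (h : ∀ N : {N : Model s.voc // s.K N}, classes E N.1 ≃ classes E' N.1) :
    Prop where
  types : ∀ N (c : classes E N.1), ∀ a ∈ c.1, ∀ b ∈ (h N c).1, F N.1 a = F' N.1 b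
  ext : ∀ M N, s.le M.1 N.1 → ∀ (c : classes E M.1) (d : classes E N.1),
    c.1 ⊆ d.1 → (h M c).1 ⊆ (h N d).1
  iso : ∀ f M N, Model.IsIso f M.1 N.1 → ∀ (c : classes E M.1) (d : classes E N.1),
    (f ∘ ·) '' c.1 = d.1 → (f ∘ ·) '' (h M c).1 = (h N d).1

end FrameData

/-! ## Models -/

/-! A basic type over `N` does not fork over some submodel of cardinality `lam`
(`exists_dnf_card_eq`) and is determined by its restriction to that submodel. It therefore suffices
to name types over models `M` of cardinality `lam` by the sequences listing `M`, and to pass to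
larger models by non-forking extension. By stability there are at most `lam` basic types over such
an `M`, so there are enough listings. The difficulty is to choose the names invariantly under
isomorphisms.

This is achieved in `exists_listing_types`. In each isomorphism type a representative is fixed,
together with an arbitrary enumeration of its types by indices below `lam`. A listing `a` of `M`
determines an isomorphism from the representative onto `M`, because it leaves no element of `M`
free, and it also determines an index, namely the position of its only value that is not repeated.
The type with that index is carried to `M`. Both data depend only on the isomorphism type of `(M,
a)`, and every index occurs.

The construction works for any family of basic types invariant under isomorphisms and parallelism:
all basic types give (2), the copies of `pst` give (1). The equivalence relation is equality of
named types (`Ker`). Stability makes it small, and local character makes it smooth along chains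
(`Names.isSmooth`). In (2) the classes over `N` are in bijection with the basic types over `N`,
which gives the canonical isomorphism and its uniqueness.

For (3), embeddings of witnesses lift to the expanded models, and an embedding between extensions of
`Ms` that fixes the witness `M` fixes all of `Ms`. Hence basic types over `Ms` correspond exactly to
basic types over `M` (`isOrtp_of_isOrtp`, `eq_of_isOrtp`). The base of a type is the element naming
the class of its projection. Names are kept by non-forking extensions and moved along by
isomorphisms. So equality of bases is parallelism, and the types with a given base form the
invariant class required for non-splitting. -/

/-- For a small set `A` there is a `z` such that no ordered pair `(z, x)` is in `A`. -/
theorem ZFSet.exists_pair_notMem (A : Set ZFSet.{u}) [Small.{u} A] :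
    ∃ z : ZFSet.{u}, ∀ x, ZFSet.pair z x ∉ A := by
  -- With `z` the set of members of `A`, every member of `A` has rank below that of `z`, while a
  -- pair with first coordinate `z` has larger rank than `z`.
  refine ⟨ZFSet.range (Subtype.val : A → ZFSet.{u}), fun x hx => ?_⟩
  have h1 := ZFSet.rank_lt_of_mem (ZFSet.mem_range.2 ⟨⟨_, hx⟩, rfl⟩ :
    ZFSet.pair _ x ∈ ZFSet.range (Subtype.val : A → ZFSet.{u}))
  refine absurd h1 (not_lt.2 ?_)
  unfold ZFSet.pair
  rw [ZFSet.rank_pair, ZFSet.rank_singleton]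
  exact ((Order.le_succ _).trans (Order.le_succ _)).trans (le_max_left _ _)

namespace Model

variable {τ : Vocab.{u}} {M M' N N' M₁ M₂ N₁ N₂ : Model τ} {f g : ZFSet.{u} → ZFSet.{u}}

theorem IsSub.refl (M : Model τ) : M.IsSub M :=
  ⟨subset_rfl, fun _ _ _ => Iff.rfl, fun _ _ _ => rfl⟩

theorem IsSub.trans (h : M.IsSub M') (h' : M'.IsSub N) : M.IsSub N :=
  ⟨h.carrier.trans h'.carrier,
    fun R x hx => (h.rel R x hx).trans (h'.rel R x fun i => h.carrier (hx i)),
    fun G x hx => (h.fn G x hx).trans (h'.fn G x fun i => h.carrier (hx i))⟩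

theorem IsSub.of_subset (h : M.IsSub N) (h' : M'.IsSub N) (hc : M.carrier ⊆ M'.carrier) :
    M.IsSub M' :=
  ⟨hc, fun R x hx => (h.rel R x hx).trans (h'.rel R x fun i => hc (hx i)).symm,
    fun G x hx => (h.fn G x hx).trans (h'.fn G x fun i => hc (hx i)).symm⟩

theorem IsSub.antisymm (h : M.IsSub M') (h' : M'.IsSub M) : M = M' := by
  have hc := h.carrier.antisymm h'.carrier
  refine Model.ext hc (funext fun R => Set.ext fun x => ⟨fun hx => ?_, fun hx => ?_⟩)
    (funext fun G => funext fun x => ?_)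
  · exact (h.rel R x (M.rel_sub R x hx)).1 hx
  · exact (h'.rel R x (M'.rel_sub R x hx)).1 hx
  · by_cases hx : ∀ i, x i ∈ M.carrier
    · exact h.fn G x hx
    · rw [M.fn_junk G x hx, M'.fn_junk G x (hc ▸ hx)]

theorem IsSub.eq_of_carrier (h : M.IsSub N) (h' : M'.IsSub N) (hc : M.carrier = M'.carrier) :
    M = M' :=
  (h.of_subset h' hc.subset).antisymm (h'.of_subset h hc.symm.subset)

theorem IsIso.mem (h : IsIso f M N) {x : ZFSet.{u}} (hx : x ∈ M.carrier) : f x ∈ N.carrier :=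
  h.bij.mapsTo hx

theorem IsIso.image_eq (h : IsIso f M N) : f '' M.carrier = N.carrier := h.bij.image_eq

theorem comp_eq_of_eqOn {A : Set ZFSet.{u}} (h : Set.EqOn f g A) {ι : Type*}
    {x : ι → ZFSet.{u}} (hx : ∀ i, x i ∈ A) : f ∘ x = g ∘ x :=
  funext fun i => h (hx i)

theorem IsIso.congr (h : IsIso f M N) (hfg : Set.EqOn f g M.carrier) : IsIso g M N :=
  ⟨h.bij.congr hfg,
    fun R x hx => by rw [← comp_eq_of_eqOn hfg hx]; exact h.rel R x hx,
    fun G x hx => by rw [← comp_eq_of_eqOn hfg hx, ← hfg (M.fn_mem G x hx)]; exact h.fn G x hx⟩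

theorem IsIso.refl (M : Model τ) : IsIso id M M :=
  ⟨Set.bijOn_id _, fun _ _ _ => Iff.rfl, fun _ _ _ => rfl⟩

theorem IsIso.of_eqOn_id (h : Set.EqOn f id M.carrier) : IsIso f M M :=
  (IsIso.refl M).congr h.symm

theorem IsIso.comp (h' : IsIso g M' N) (h : IsIso f M M') : IsIso (g ∘ f) M N :=
  ⟨h'.bij.comp h.bij,
    fun R x hx => (h.rel R x hx).trans (h'.rel R _ fun i => h.mem (hx i)),
    fun G x hx => by
      rw [Function.comp_apply, h.fn G x hx, h'.fn G (f ∘ x) fun i => h.mem (hx i)]; rfl⟩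

theorem IsIso.exists_inv (h : IsIso f M N) : ∃ g, IsIso g N M ∧ Set.LeftInvOn g f M.carrier ∧
    Set.LeftInvOn f g N.carrier := by
  have hi := h.bij.invOn_invFunOn
  have hb : Set.BijOn (Function.invFunOn f M.carrier) N.carrier M.carrier :=
    (Set.bijOn_comm hi.symm).1 h.bij
  have hx : ∀ {ι : Type u} {x : ι → ZFSet.{u}}, (∀ i, x i ∈ N.carrier) →
      f ∘ Function.invFunOn f M.carrier ∘ x = x := fun hx => funext fun i => hi.2 (hx i)
  refine ⟨_, ⟨hb, fun R x hxN => ?_, fun G x hxN => ?_⟩, hi.1, hi.2⟩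
  · rw [h.rel R (Function.invFunOn f M.carrier ∘ x) fun i => hb.mapsTo (hxN i), hx hxN]
  · have hm : ∀ i, (Function.invFunOn f M.carrier ∘ x) i ∈ M.carrier := fun i => hb.mapsTo (hxN i)
    rw [← hi.1 (M.fn_mem G _ hm), h.fn G _ hm, hx hxN]

theorem IsIso.exists_preimage (h : IsIso f M N) {ι : Type*} {y : ι → ZFSet.{u}}
    (hy : ∀ i, y i ∈ N.carrier) : ∃ x : ι → ZFSet.{u}, (∀ i, x i ∈ M.carrier) ∧ f ∘ x = y := by
  choose x hx using fun i => h.bij.surjOn (hy i)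
  exact ⟨x, fun i => (hx i).1, funext fun i => (hx i).2⟩

theorem IsIso.isSub (hN : IsIso f N₁ N₂) (hM : IsIso f M₁ M₂) (h : M₁.IsSub N₁) :
    M₂.IsSub N₂ := by
  refine ⟨?_, fun R y hy => ?_, fun G y hy => ?_⟩
  · rw [← hM.image_eq, ← hN.image_eq]
    exact Set.image_mono h.carrier
  · obtain ⟨x, hx, rfl⟩ := hM.exists_preimage hy
    rw [← hM.rel R x hx, ← hN.rel R x fun i => h.carrier (hx i), h.rel R x hx]
  · obtain ⟨x, hx, rfl⟩ := hM.exists_preimage hy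
    rw [← hM.fn G x hx, ← hN.fn G x fun i => h.carrier (hx i), h.fn G x hx]

open Classical in
/-- The image of the model `M` under `f`. -/
noncomputable def map (f : ZFSet.{u} → ZFSet.{u}) (M : Model τ) : Model τ where
  carrier := f '' M.carrier
  rel R := {y | ∃ x ∈ M.rel R, f ∘ x = y}
  fn G y := if ∀ i, y i ∈ f '' M.carrier then
    f (M.fn G (Function.invFunOn f M.carrier ∘ y)) else ∅
  rel_sub := by
    rintro R _ ⟨x, hx, rfl⟩ i
    exact Set.mem_image_of_mem f (M.rel_sub R x hx i)
  fn_mem G y hy := by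
    rw [if_pos hy]
    exact Set.mem_image_of_mem f (M.fn_mem G _ fun i => Function.invFunOn_mem (hy i))
  fn_junk G y hy := if_neg hy

theorem isIso_map (hf : Set.InjOn f M.carrier) : IsIso f M (M.map f) := by
  refine ⟨hf.bijOn_image, fun R x hx => ⟨fun h => ⟨x, h, rfl⟩, ?_⟩, fun G x hx => ?_⟩
  · rintro ⟨y, hy, he⟩
    have : y = x := funext fun i => hf (M.rel_sub R y hy i) (hx i) (congrFun he i)
    exact this ▸ hy
  · have h1 : ∀ i, (f ∘ x) i ∈ f '' M.carrier := fun i => Set.mem_image_of_mem f (hx i)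
    have h2 : Function.invFunOn f M.carrier ∘ f ∘ x = x :=
      funext fun i => hf.leftInvOn_invFunOn (hx i)
    simp only [map, if_pos h1, h2]

theorem IsIso.isIso_map (hN : IsIso f N₁ N₂) (h : M₁.IsSub N₁) : IsIso f M₁ (M₁.map f) :=
  Model.isIso_map (hN.bij.injOn.mono h.carrier)

theorem IsIso.card_eq (h : IsIso f M N) : M.card = N.card := by
  rw [card, card, ← h.image_eq, Cardinal.mk_image_eq_of_injOn _ _ h.bij.injOn]

theorem IsIso.comp_right_injective {ι : Type*} (h : IsIso f M N) {x y : ι → ZFSet.{u}}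
    (hx : ∀ i, x i ∈ M.carrier) (hy : ∀ i, y i ∈ M.carrier) (he : f ∘ x = f ∘ y) : x = y :=
  funext fun i => h.bij.injOn (hx i) (hy i) (congrFun he i)

end Model

/-! ## Classes of models closed under isomorphisms -/

namespace AECData

open Model

variable {k : AECData.{u}} {f g : ZFSet.{u} → ZFSet.{u}}

/-- The part of the axioms of an abstract elementary class that does not mention chains,
coherence or Löwenheim numbers. -/
structure IsIsoClosed (k : AECData.{u}) : Prop where
  le_mem : ∀ M N, k.le M N → k.K M ∧ k.K N
  le_sub : ∀ M N, k.le M N → M.IsSub N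
  iso_mem : ∀ f M₁ M₂, Model.IsIso f M₁ M₂ → k.K M₁ → k.K M₂
  iso_le : ∀ f M₁ M₂ N₁ N₂, Model.IsIso f N₁ N₂ → Model.IsIso f M₁ M₂ → k.le M₁ N₁ → k.le M₂ N₂
  le_refl : ∀ M, k.K M → k.le M M
  le_trans : ∀ M₁ M₂ M₃, k.le M₁ M₂ → k.le M₂ M₃ → k.le M₁ M₃
  small : ∀ M, k.K M → Small.{u} M.carrier

theorem IsEssAEC.isIsoClosed {lam : Cardinal.{u}} {mu : Cardinal.{u + 1}}
    (hk : k.IsEssAEC lam mu) : k.IsIsoClosed where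
  le_mem := hk.le_mem
  le_sub := hk.le_sub
  iso_mem := hk.iso_mem
  iso_le := hk.iso_le
  le_refl := hk.le_refl
  le_trans := hk.le_trans
  small M hM := by
    rw [Cardinal.small_iff_lift_mk_lt_univ, Cardinal.lift_id]
    exact (hk.card_mem M hM).2.trans_le hk.mu_le

open Classical in
/-- An isomorphism of models extends to extensions of the models, with new elements avoiding a
given small set. -/
theorem IsIsoClosed.exists_extension (hk : k.IsIsoClosed) {M₁ M₂ N₁ : Model k.voc}
    (hf : IsIso f M₁ M₂) (hle : k.le M₁ N₁) (A : Set ZFSet.{u}) [Small.{u} A] :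
    ∃ N₂ g, k.le M₂ N₂ ∧ IsIso g N₁ N₂ ∧ Set.EqOn g f M₁.carrier ∧
      ∀ x ∈ N₁.carrier, x ∉ M₁.carrier → g x ∉ A := by
  have hs : Small.{u} M₂.carrier := hk.small _ (hk.iso_mem _ _ _ hf (hk.le_mem _ _ hle).1)
  -- Elements outside `M₁` go to pairs with first coordinate `z`; these are distinct from one
  -- another and lie neither in `M₂` nor in `A`.
  obtain ⟨z, hz⟩ := ZFSet.exists_pair_notMem (A ∪ M₂.carrier)
  set g : ZFSet.{u} → ZFSet.{u} := fun x => if x ∈ M₁.carrier then f x else ZFSet.pair z x with hg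
  have hgf : Set.EqOn g f M₁.carrier := fun x hx => if_pos hx
  have hgp : ∀ x, x ∉ M₁.carrier → g x = ZFSet.pair z x := fun x hx => if_neg hx
  have hinj : Set.InjOn g N₁.carrier := by
    intro x _ y _ hxy
    by_cases hx : x ∈ M₁.carrier <;> by_cases hy : y ∈ M₁.carrier
    · rw [hgf hx, hgf hy] at hxy
      exact hf.bij.injOn hx hy hxy
    · rw [hgf hx, hgp y hy] at hxy
      exact absurd (Or.inr (hxy ▸ hf.mem hx)) (hz y)
    · rw [hgf hy, hgp x hx] at hxy
      exact absurd (Or.inr (hxy ▸ hf.mem hy)) (hz x)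
    · rw [hgp x hx, hgp y hy] at hxy
      exact (ZFSet.pair_injective hxy).2
  refine ⟨N₁.map g, g, ?_, isIso_map hinj, hgf, fun x _ hx h => hz x (Or.inl ?_)⟩
  · exact hk.iso_le g _ _ _ _ (isIso_map hinj) (hf.congr hgf.symm) hle
  · rwa [← hgp x hx]

theorem IsEmb.mem (hk : k.IsIsoClosed) {M N : Model k.voc} (h : k.IsEmb f M N) {x : ZFSet.{u}}
    (hx : x ∈ M.carrier) : f x ∈ N.carrier := by
  obtain ⟨N', hN, hf⟩ := h
  exact (hk.le_sub _ _ hN).carrier (hf.mem hx)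

theorem IsEmb.of_isIso (hk : k.IsIsoClosed) {M N : Model k.voc} (h : IsIso f M N) (hM : k.K M) :
    k.IsEmb f M N :=
  ⟨N, hk.le_refl _ (hk.iso_mem _ _ _ h hM), h⟩

theorem IsEmb.of_le {M N : Model k.voc} (h : k.le M N) : k.IsEmb id M N :=
  ⟨M, h, IsIso.refl M⟩

theorem IsEmb.comp (hk : k.IsIsoClosed) {M N N' : Model k.voc} (hg : k.IsEmb g N N')
    (hf : k.IsEmb f M N) : k.IsEmb (g ∘ f) M N' := by
  obtain ⟨M₁, hM₁, hf⟩ := hf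
  obtain ⟨N₁, hN₁, hg⟩ := hg
  have h := hg.isIso_map (hk.le_sub _ _ hM₁)
  exact ⟨M₁.map g, hk.le_trans _ _ _ (hk.iso_le _ _ _ _ _ hg h hM₁) hN₁, h.comp hf⟩

theorem IsEmb.le (hk : k.IsIsoClosed) {M N N' : Model k.voc} (hf : k.IsEmb f N N')
    (hM : k.le M N) (hid : Set.EqOn f id M.carrier) : k.le M N' := by
  obtain ⟨N₁, hN₁, hf⟩ := hf
  exact hk.le_trans _ _ _ (hk.iso_le f _ _ _ _ hf (IsIso.of_eqOn_id hid) hM) hN₁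

/-! ### Amalgamation and equality of orbital types -/

/-- The amalgamation property. -/
def HasAmalgamation (k : AECData.{u}) : Prop :=
  ∀ M₀ M₁ M₂, k.le M₀ M₁ → k.le M₀ M₂ → ∃ N f₁ f₂,
    k.IsEmb f₁ M₁ N ∧ k.IsEmb f₂ M₂ N ∧ Set.EqOn f₁ id M₀.carrier ∧ Set.EqOn f₂ id M₀.carrier

/-- Amalgamation over inclusions suffices: the isomorphism between the two images of `M₀` extends to
a copy of `M₁` above the image in `M₂`, and one amalgamates over that image. -/
theorem HasAmalgamation.exists_of_isEmb (ham : k.HasAmalgamation) (hk : k.IsIsoClosed)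
    {M₀ M₁ M₂ : Model k.voc} (hf : k.IsEmb f M₀ M₁) (hg : k.IsEmb g M₀ M₂) :
    ∃ N e₁ e₂, k.IsEmb e₁ M₁ N ∧ k.IsEmb e₂ M₂ N ∧ ∀ x ∈ M₀.carrier, e₁ (f x) = e₂ (g x) := by
  obtain ⟨A, hA, hf⟩ := hf
  obtain ⟨B, hB, hg⟩ := hg
  obtain ⟨f', hf', hl, -⟩ := hf.exists_inv
  obtain ⟨N₁, h, hle, hh, hhe, -⟩ := hk.exists_extension (hg.comp hf') hA ∅
  obtain ⟨N, e₁, e₂, he₁, he₂, hi₁, hi₂⟩ := ham _ _ _ hle hB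
  refine ⟨N, e₁ ∘ h, e₂, he₁.comp hk (.of_isIso hk hh (hk.le_mem _ _ hA).2), he₂, fun x hx => ?_⟩
  have h1 : h (f x) = g x := by
    rw [hhe (hf.mem hx), Function.comp_apply, hl hx]
  rw [Function.comp_apply, h1, hi₁ (hg.mem hx), hi₂ (hg.mem hx)]

theorem AtRel.symm {M : Model k.voc} {x y : k.TypeRep M} (h : k.AtRel M x y) : k.AtRel M y x := by
  obtain ⟨N, f, g, hf, hg, hfi, hgi, he⟩ := h
  exact ⟨N, g, f, hg, hf, hgi, hfi, he.symm⟩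

theorem AtRel.of_isEmb (hk : k.IsIsoClosed) {M : Model k.voc} {x y : k.TypeRep M}
    (hf : k.IsEmb f x.N y.N) (hid : Set.EqOn f id M.carrier) (ha : f x.a = y.a) :
    k.AtRel M x y :=
  ⟨y.N, f, id, hf, .of_le (hk.le_refl _ (hk.le_mem _ _ y.le).2), hid, fun _ _ => rfl, ha⟩

theorem AtRel.refl (hk : k.IsIsoClosed) {M : Model k.voc} (x : k.TypeRep M) : k.AtRel M x x :=
  .of_isEmb hk (.of_le (hk.le_refl _ (hk.le_mem _ _ x.le).2)) (fun _ _ => rfl) rfl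

/-- The two given amalgams are amalgamated over `y.N`. The resulting embeddings agree on `M` but may
move it, so the result is replaced by a copy, along `l`, in which `M` is back in place. -/
theorem AtRel.trans (ham : k.HasAmalgamation) (hk : k.IsIsoClosed) {M : Model k.voc}
    {x y z : k.TypeRep M} (h : k.AtRel M x y) (h' : k.AtRel M y z) : k.AtRel M x z := by
  obtain ⟨N, f, g, hf, hg, hfi, hgi, he⟩ := h
  obtain ⟨N', f', g', hf', hg', hfi', hgi', he'⟩ := h'
  obtain ⟨N'', e₁, e₂, he₁, he₂, hee⟩ := ham.exists_of_isEmb hk hg hf'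
  have hM := (hk.le_sub _ _ y.le).carrier
  have h0 : ∀ m ∈ M.carrier, e₁ m = e₂ m := fun m hm => by
    have := hee m (hM hm)
    rwa [hgi hm, hfi' hm] at this
  obtain ⟨P, hP, he₁'⟩ := he₁
  have hMN : k.le M N := hf.le hk x.le hfi
  have he₁M := he₁'.isIso_map (hk.le_sub _ _ hMN)
  obtain ⟨j, hj, hjl, -⟩ := he₁M.exists_inv
  obtain ⟨Q, l, hQ, hl, hle, -⟩ := hk.exists_extension hj
    (hk.le_trans _ _ _ (hk.iso_le _ _ _ _ _ he₁' he₁M hMN) hP) ∅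
  have hlM : ∀ m ∈ M.carrier, l (e₁ m) = m := fun m hm => by
    rw [hle (he₁M.mem hm), hjl hm]
  have hlE := IsEmb.of_isIso hk hl (hk.le_mem _ _ hP).2
  refine ⟨Q, l ∘ e₁ ∘ f, l ∘ e₂ ∘ g', hlE.comp hk (IsEmb.comp hk ⟨P, hP, he₁'⟩ hf),
    hlE.comp hk (he₂.comp hk hg'), fun m hm => ?_, fun m hm => ?_, ?_⟩
  · simp only [Function.comp_apply, hfi hm, id, hlM m hm]
  · simp only [Function.comp_apply, hgi' hm, id, ← h0 m hm, hlM m hm]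
  · simp only [Function.comp_apply]
    rw [he, hee _ y.mem, he']

/-- Under amalgamation `AtRel` is already an equivalence relation, so equality of two types is
witnessed by a single amalgam. -/
theorem quot_mk_eq_iff (ham : k.HasAmalgamation) (hk : k.IsIsoClosed) {M : Model k.voc}
    {x y : k.TypeRep M} : Quot.mk (k.AtRel M) x = Quot.mk (k.AtRel M) y ↔ k.AtRel M x y := by
  refine ⟨fun h => ?_, Quot.sound⟩
  have he : Equivalence (k.AtRel M) := ⟨.refl hk, .symm, .trans ham hk⟩
  exact he.eqvGen_iff.1 (Quot.eqvGen_exact h)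

/-! ### Restrictions -/

theorem IsOrtp.le {M N : Model k.voc} {a : ZFSet.{u}} {p : k.OrbType M} (h : IsOrtp a M N p) :
    k.le M N := h.1

theorem IsOrtp.mem {M N : Model k.voc} {a : ZFSet.{u}} {p : k.OrbType M} (h : IsOrtp a M N p) :
    a ∈ N.carrier := h.2.1

theorem IsOrtp.unique {M N : Model k.voc} {a : ZFSet.{u}} {p q : k.OrbType M}
    (h : IsOrtp a M N p) (h' : IsOrtp a M N q) : p = q := by
  obtain ⟨_, _, rfl⟩ := h
  obtain ⟨_, _, rfl⟩ := h'
  rfl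

theorem isOrtp_mk {M N : Model k.voc} {a : ZFSet.{u}} (h : k.le M N) (ha : a ∈ N.carrier) :
    IsOrtp a M N (Quot.mk _ ⟨N, a, h, ha⟩ : k.OrbType M) := ⟨h, ha, rfl⟩

theorem exists_isOrtp {M : Model k.voc} (p : k.OrbType M) : ∃ a N, IsOrtp a M N p := by
  obtain ⟨⟨N, a, h, ha⟩, rfl⟩ := Quot.exists_rep p
  exact ⟨a, N, h, ha, rfl⟩

theorem IsOrtp.of_isEmb (hk : k.IsIsoClosed) {M N N' : Model k.voc} {a : ZFSet.{u}}
    {p : k.OrbType M} (h : IsOrtp a M N p) (hf : k.IsEmb f N N')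
    (hid : Set.EqOn f id M.carrier) : IsOrtp (f a) M N' p := by
  obtain ⟨hle, ha, rfl⟩ := h
  exact ⟨hf.le hk hle hid, hf.mem hk ha, Quot.sound (.of_isEmb hk hf hid rfl)⟩

theorem IsOrtp.mono (hk : k.IsIsoClosed) {M N N' : Model k.voc} {a : ZFSet.{u}}
    {p : k.OrbType M} (h : IsOrtp a M N p) (hN : k.le N N') : IsOrtp a M N' p :=
  h.of_isEmb hk (.of_le hN) fun _ _ => rfl

/-- The restriction of an orbital type to a smaller model. -/
def restr (hk : k.IsIsoClosed) {M₀ M : Model k.voc} (h : k.le M₀ M) :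
    k.OrbType M → k.OrbType M₀ :=
  Quot.map (fun x => ⟨x.N, x.a, hk.le_trans _ _ _ h x.le, x.mem⟩) fun _ _ =>
    fun ⟨N, f, g, hf, hg, hfi, hgi, he⟩ =>
      ⟨N, f, g, hf, hg, hfi.mono (hk.le_sub _ _ h).carrier, hgi.mono (hk.le_sub _ _ h).carrier, he⟩

theorem IsOrtp.restr (hk : k.IsIsoClosed) {M₀ M N : Model k.voc} {a : ZFSet.{u}}
    {p : k.OrbType M} (hp : IsOrtp a M N p) (h : k.le M₀ M) : IsOrtp a M₀ N (AECData.restr hk h p) := by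
  obtain ⟨hle, ha, rfl⟩ := hp
  exact ⟨hk.le_trans _ _ _ h hle, ha, rfl⟩

theorem isRestr_iff (hk : k.IsIsoClosed) {M₀ M : Model k.voc} (h : k.le M₀ M)
    {r : k.OrbType M₀} {p : k.OrbType M} : IsRestr r p ↔ r = restr hk h p := by
  constructor
  · rintro ⟨_, a, N, hp, hr⟩
    exact hr.unique (hp.restr hk h)
  · rintro rfl
    obtain ⟨a, N, hp⟩ := exists_isOrtp p
    exact ⟨h, a, N, hp, hp.restr hk h⟩

/-! ### Transport of orbital types along isomorphisms -/

theorem exists_transports (hk : k.IsIsoClosed) {M₁ M₂ : Model k.voc} (hf : IsIso f M₁ M₂)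
    (p : k.OrbType M₁) : ∃ q : k.OrbType M₂, Transports f p q := by
  obtain ⟨a, N₁, hp⟩ := exists_isOrtp p
  obtain ⟨N₂, g, hle, hg, hgf, -⟩ := hk.exists_extension hf hp.le ∅
  exact ⟨_, hf, a, N₁, N₂, g, hp, isOrtp_mk hle (hg.mem hp.mem), hg, hgf⟩

/-- Independence of the realization. An amalgam over `M₁` of the realization in the definition, `(b,
P₁)`, and of the given one, `(a, N₁)`, is copied along `h` to a model `Q` above `P₂`. Then `N₂`
embeds in `Q` over `M₂`, and `g a` goes to `h b`. -/
theorem Transports.isOrtp (ham : k.HasAmalgamation) (hk : k.IsIsoClosed)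
    {M₁ M₂ N₁ N₂ : Model k.voc} {p : k.OrbType M₁} {q : k.OrbType M₂} {a : ZFSet.{u}}
    (h : Transports f p q) (hp : IsOrtp a M₁ N₁ p) (hg : IsIso g N₁ N₂)
    (hgf : Set.EqOn g f M₁.carrier) : IsOrtp (g a) M₂ N₂ q := by
  obtain ⟨hf, b, P₁, P₂, h, hb, hhb, hh, hhf⟩ := h
  obtain ⟨hbP, hbm, hb'⟩ := hb
  obtain ⟨haN, ham', hp'⟩ := hp
  obtain ⟨N, e₁, e₂, ⟨P, hP, he₁⟩, he₂, hi₁, hi₂, he⟩ :=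
    (quot_mk_eq_iff ham hk).1 (hb'.symm.trans hp')
  dsimp only at he₁ he₂ he
  obtain ⟨j, hj, hjl, -⟩ := he₁.exists_inv
  obtain ⟨Q, l, hQ, hl, hle, -⟩ := hk.exists_extension (hh.comp hj) hP ∅
  have hlh : ∀ x ∈ P₁.carrier, l (e₁ x) = h x := fun x hx => by
    rw [hle (he₁.mem hx), Function.comp_apply, hjl hx]
  obtain ⟨g', hg', hgl, hgr⟩ := hg.exists_inv
  have hN₂ : k.le M₂ N₂ := hk.iso_le g _ _ _ _ hg (hf.congr hgf.symm) haN
  have hr := isOrtp_mk hN₂ (hg.mem ham')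
  have hE : k.IsEmb (l ∘ e₂ ∘ g') N₂ Q :=
    (IsEmb.of_isIso hk hl (hk.le_mem _ _ hP).2).comp hk
      (he₂.comp hk (.of_isIso hk hg' (hk.le_mem _ _ hN₂).2))
  have hid : Set.EqOn (l ∘ e₂ ∘ g') id M₂.carrier := by
    intro m hm
    obtain ⟨n, hn, rfl⟩ := hf.bij.surjOn hm
    have hnN := (hk.le_sub _ _ haN).carrier hn
    have hnP := (hk.le_sub _ _ hbP).carrier hn
    simp only [Function.comp_apply, id]
    rw [← hgf hn, hgl hnN, hi₂ hn, ← hi₁ hn, hlh n hnP, hhf hn, hgf hn]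
  have h1 := hr.of_isEmb hk hE hid
  have h2 := hhb.mono hk hQ
  have h3 : (l ∘ e₂ ∘ g') (g a) = h b := by
    simp only [Function.comp_apply]
    rw [hgl ham', ← he, hlh b hbm]
  rw [h3] at h1
  exact h1.unique h2 ▸ hr

theorem Transports.unique (ham : k.HasAmalgamation) (hk : k.IsIsoClosed)
    {M₁ M₂ : Model k.voc} {p : k.OrbType M₁} {q q' : k.OrbType M₂}
    (h : Transports f p q) (h' : Transports f p q') : q = q' := by
  obtain ⟨-, a, N₁, N₂, g, hp, hq, hg, hgf⟩ := h
  exact hq.unique (h'.isOrtp ham hk hp hg hgf)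

theorem Transports.congr {M₁ M₂ : Model k.voc} {p : k.OrbType M₁} {q : k.OrbType M₂}
    (h : Transports f p q) (hfg : Set.EqOn f g M₁.carrier) : Transports g p q := by
  obtain ⟨hf, a, N₁, N₂, g, hp, hq, hg, hgf⟩ := h
  exact ⟨hf.congr hfg, a, N₁, N₂, g, hp, hq, hg, hgf.trans hfg⟩

theorem Transports.comp (ham : k.HasAmalgamation) (hk : k.IsIsoClosed)
    {M₁ M₂ M₃ : Model k.voc} {p : k.OrbType M₁} {q : k.OrbType M₂} {r : k.OrbType M₃}
    (h : Transports f p q) (h' : Transports g q r) : Transports (g ∘ f) p r := by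
  obtain ⟨hf, a, N₁, N₂, f', hp, hq, hf', hff⟩ := h
  obtain ⟨N₃, g', hle, hg', hgg, -⟩ := hk.exists_extension h'.1 hq.le ∅
  have hr := h'.isOrtp ham hk hq hg' hgg
  refine ⟨h'.1.comp hf, a, N₁, N₃, g' ∘ f', hp, hr, hg'.comp hf', ?_⟩
  intro x hx
  rw [Function.comp_apply, hff hx, hgg (hf.mem hx), Function.comp_apply]

theorem Transports.inv (hk : k.IsIsoClosed) {M₁ M₂ : Model k.voc} {p : k.OrbType M₁}
    {q : k.OrbType M₂} (h : Transports f p q) (hg : Set.LeftInvOn g f M₁.carrier) :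
    Transports g q p := by
  obtain ⟨hf, a, N₁, N₂, f', hp, hq, hf', hff⟩ := h
  obtain ⟨i, hi, hil, hir⟩ := hf.exists_inv
  obtain ⟨j, hj, hjl, hjr⟩ := hf'.exists_inv
  have hig : Set.EqOn i g M₂.carrier := by
    intro y hy
    obtain ⟨x, hx, rfl⟩ := hf.bij.surjOn hy
    rw [hil hx, hg hx]
  refine ⟨hi.congr hig, f' a, N₂, N₁, j, hq, ?_, hj, ?_⟩
  · rwa [hjl hp.mem]
  · intro y hy
    obtain ⟨x, hx, rfl⟩ := hf.bij.surjOn hy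
    rw [← hff hx, hjl ((hk.le_sub _ _ hp.le).carrier hx), hff hx, hg hx]

theorem Transports.restr (hk : k.IsIsoClosed) {M₁ M₂ N₁ N₂ : Model k.voc} {p : k.OrbType N₁}
    {q : k.OrbType N₂} (h : Transports f p q) (hM : IsIso f M₁ M₂) (h₁ : k.le M₁ N₁)
    (h₂ : k.le M₂ N₂) : Transports f (AECData.restr hk h₁ p) (AECData.restr hk h₂ q) := by
  obtain ⟨hf, a, P₁, P₂, g, hp, hq, hg, hgf⟩ := h
  exact ⟨hM, a, P₁, P₂, g, hp.restr hk h₁, hq.restr hk h₂, hg,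
    hgf.mono (hk.le_sub _ _ h₁).carrier⟩

end AECData

/-! ## Non-forking extensions in a good frame -/

namespace FrameData

open AECData Model

variable {s : FrameData.{u}} {lam : Cardinal.{u}} {mu : Cardinal.{u + 1}}
  {f g : ZFSet.{u} → ZFSet.{u}}

theorem IsGood.isoClosed (hs : s.IsGood lam mu) : s.IsIsoClosed := hs.aec.isIsoClosed

theorem IsGood.hasAmalgamation (hs : s.IsGood lam mu) : s.HasAmalgamation := hs.amalgamation

theorem IsBasicTriple.bs {M N : Model s.voc} {a : ZFSet.{u}} {p : s.OrbType M}
    (h : s.IsBasicTriple M N a) (hp : IsOrtp a M N p) : p ∈ s.bs M := by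
  obtain ⟨-, q, hq, hq'⟩ := h
  exact hp.unique hq' ▸ hq

theorem IsGood.isBasicTriple (hs : s.IsGood lam mu) {M N : Model s.voc} {a : ZFSet.{u}}
    {p : s.OrbType M} (hp : p ∈ s.bs M) (h : IsOrtp a M N p) : s.IsBasicTriple M N a :=
  ⟨hs.bs_nonalg M p hp a N h, p, hp, h⟩

/-- Non-forking is a property of the type alone: it moves to the image of `x.N` in the amalgam,
passes by monotonicity to the image of `y.N`, and is pulled back. -/
theorem IsGood.nf_of_atRel (hs : s.IsGood lam mu) {M₀ M : Model s.voc} {x y : s.TypeRep M}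
    (h : s.AtRel M x y) (hx : s.nf M₀ M x.a x.N) : s.nf M₀ M y.a y.N := by
  have hk := hs.isoClosed
  obtain ⟨N, f, g, ⟨N₁, hN₁, hf⟩, ⟨N₂, hN₂, hg⟩, hfi, hgi, he⟩ := h
  obtain ⟨h₀, -⟩ := hs.nf_dom _ _ _ _ hx
  have hM := hk.le_refl _ (hk.le_mem _ _ h₀).2
  have hM₀ := hk.le_refl _ (hk.le_mem _ _ h₀).1
  have hi₀ := hfi.mono (hk.le_sub _ _ h₀).carrier
  have h1 := hs.nf_iso f _ _ _ _ _ _ _ hf (.of_eqOn_id hi₀) (.of_eqOn_id hfi) hx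
  have hMN₁ := (hs.nf_dom _ _ _ _ h1).2.1
  have hMN₂ : s.le M N₂ := hk.iso_le g _ _ _ _ hg (.of_eqOn_id hgi) y.le
  have h2 := (hs.monotonicity M₀ M₀ M M N₁ N N₂ (f x.a) hM₀ h₀ hM hMN₁ hN₁ hN₂
    (hk.le_sub _ _ hMN₂).carrier (he ▸ hg.mem y.mem) h1).2
  obtain ⟨j, hj, hjl, -⟩ := hg.exists_inv
  have hji : Set.EqOn j id M.carrier := fun m hm => by
    have := hjl ((hk.le_sub _ _ y.le).carrier hm)
    rwa [hgi hm] at this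
  have h3 := hs.nf_iso j _ _ _ _ _ _ _ hj
    (.of_eqOn_id (hji.mono (hk.le_sub _ _ h₀).carrier)) (.of_eqOn_id hji) h2
  rwa [he, hjl y.mem] at h3

theorem IsGood.nf_of_dnf (hs : s.IsGood lam mu) {M₀ M N : Model s.voc} {p : s.OrbType M}
    {a : ZFSet.{u}} (h : Dnf M₀ p) (hp : IsOrtp a M N p) : s.nf M₀ M a N := by
  obtain ⟨b, N', ⟨h1, h2, rfl⟩, hb⟩ := h
  obtain ⟨h3, h4, he⟩ := hp
  exact hs.nf_of_atRel ((quot_mk_eq_iff hs.hasAmalgamation hs.isoClosed).1 he) hb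

theorem IsGood.le_of_dnf (hs : s.IsGood lam mu) {M₀ M : Model s.voc} {p : s.OrbType M}
    (h : Dnf M₀ p) : s.le M₀ M := by
  obtain ⟨a, N, -, h⟩ := h
  exact (hs.nf_dom _ _ _ _ h).1

theorem IsGood.bs_of_dnf (hs : s.IsGood lam mu) {M₀ M : Model s.voc} {p : s.OrbType M}
    (h : Dnf M₀ p) : p ∈ s.bs M := by
  obtain ⟨a, N, hp, h⟩ := h
  exact (hs.nf_dom _ _ _ _ h).2.2.2.bs hp

theorem IsGood.restr_bs (hs : s.IsGood lam mu) {M₀ M : Model s.voc} {p : s.OrbType M}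
    (h : Dnf M₀ p) (hle : s.le M₀ M) : restr hs.isoClosed hle p ∈ s.bs M₀ := by
  obtain ⟨a, N, hp, h⟩ := h
  exact (hs.nf_dom _ _ _ _ h).2.2.1.bs (hp.restr _ hle)

theorem IsGood.dnf_self (hs : s.IsGood lam mu) {M : Model s.voc} {p : s.OrbType M}
    (hp : p ∈ s.bs M) : Dnf M p := by
  obtain ⟨a, N, h⟩ := exists_isOrtp p
  exact ⟨a, N, h, (hs.nf_refl _ _ _).2 (hs.isBasicTriple hp h)⟩

theorem IsGood.dnf_restr (hs : s.IsGood lam mu) {M₀ M N : Model s.voc} {p : s.OrbType N}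
    (h : Dnf M₀ p) (h₀ : s.le M₀ M) (h₁ : s.le M N) : Dnf M₀ (restr hs.isoClosed h₁ p) := by
  obtain ⟨a, P, hp, h⟩ := h
  have hk := hs.isoClosed
  have hM₀ := hk.le_refl _ (hk.le_mem _ _ h₀).1
  have hP := hk.le_refl _ (hk.le_mem _ _ hp.le).2
  exact ⟨a, P, hp.restr _ h₁, (hs.monotonicity _ _ _ _ _ _ _ _ hM₀ h₀ h₁ hp.le hP hP
    (hk.le_sub _ _ hp.le).carrier hp.mem h).1⟩

theorem IsGood.dnf_trans (hs : s.IsGood lam mu) {M₀ M N : Model s.voc} {p : s.OrbType N}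
    (h₁ : s.le M N) (h : Dnf M₀ (restr hs.isoClosed h₁ p)) (h' : Dnf M p) : Dnf M₀ p := by
  obtain ⟨a, P, hp, h'⟩ := h'
  exact ⟨a, P, hp, hs.transitivity _ _ _ _ _ (hs.nf_of_dnf h (hp.restr _ h₁)) h'⟩

theorem IsGood.isNfExt_restr (hs : s.IsGood lam mu) {M N : Model s.voc} {p : s.OrbType N}
    (h : Dnf M p) (hle : s.le M N) : IsNfExt (restr hs.isoClosed hle p) p :=
  ⟨hs.bs_of_dnf h, (isRestr_iff hs.isoClosed hle).2 rfl, h⟩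

theorem IsNfExt.le {M N : Model s.voc} {p : s.OrbType M} {q : s.OrbType N} (h : IsNfExt p q) :
    s.le M N := h.2.1.1

theorem IsNfExt.eq_restr (hs : s.IsGood lam mu) {M N : Model s.voc} {p : s.OrbType M}
    {q : s.OrbType N} (h : IsNfExt p q) : p = restr hs.isoClosed h.le q :=
  (isRestr_iff hs.isoClosed h.le).1 h.2.1

theorem IsNfExt.bs_left (hs : s.IsGood lam mu) {M N : Model s.voc} {p : s.OrbType M}
    {q : s.OrbType N} (h : IsNfExt p q) : p ∈ s.bs M :=
  h.eq_restr hs ▸ hs.restr_bs h.2.2 h.le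

theorem IsNfExt.unique (hs : s.IsGood lam mu) {M N : Model s.voc} {p : s.OrbType M}
    {q q' : s.OrbType N} (h : IsNfExt p q) (h' : IsNfExt p q') : q = q' :=
  hs.uniqueness _ _ _ _ _ h.1 h'.1 h.2.2 h'.2.2 h.2.1 h'.2.1

theorem IsNfExt.unique_left (hs : s.IsGood lam mu) {M N : Model s.voc} {p p' : s.OrbType M}
    {q : s.OrbType N} (h : IsNfExt p q) (h' : IsNfExt p' q) : p = p' :=
  (h.eq_restr hs).trans (h'.eq_restr hs).symm

theorem restr_restr {k : AECData.{u}} (hk : k.IsIsoClosed) {M₀ M N : Model k.voc}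
    (h₀ : k.le M₀ M) (h₁ : k.le M N) (p : k.OrbType N) :
    restr hk h₀ (restr hk h₁ p) = restr hk (hk.le_trans _ _ _ h₀ h₁) p := by
  obtain ⟨a, P, hp⟩ := exists_isOrtp p
  exact ((hp.restr hk h₁).restr hk h₀).unique (hp.restr hk _)

theorem IsNfExt.trans (hs : s.IsGood lam mu) {M₀ M N : Model s.voc} {p : s.OrbType M₀}
    {q : s.OrbType M} {r : s.OrbType N} (h : IsNfExt p q) (h' : IsNfExt q r) : IsNfExt p r := by
  have hk := hs.isoClosed
  refine ⟨h'.1, ?_, ?_⟩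
  · rw [isRestr_iff hk (hk.le_trans _ _ _ h.le h'.le), ← restr_restr hk h.le h'.le,
      ← h'.eq_restr hs, ← h.eq_restr hs]
  · exact hs.dnf_trans h'.le (h'.eq_restr hs ▸ h.2.2) h'.2.2

theorem Dnf.transports (hs : s.IsGood lam mu) {M₀ M N₀ N : Model s.voc} {p : s.OrbType M}
    {q : s.OrbType N} (h : Dnf M₀ p) (ht : Transports f p q) (hf : IsIso f M₀ N₀) : Dnf N₀ q := by
  have hle := hs.le_of_dnf h
  obtain ⟨hi, a, P, Q, g, hp, hq, hg, hgf⟩ := ht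
  refine ⟨g a, Q, hq, hs.nf_iso g _ _ _ _ _ _ _ hg (hf.congr fun x hx => ?_) (hi.congr hgf.symm)
    (hs.nf_of_dnf h hp)⟩
  exact (hgf ((hs.isoClosed.le_sub _ _ hle).carrier hx)).symm

/-- Isomorphisms preserve non-forking extensions. -/
theorem IsNfExt.transports (hs : s.IsGood lam mu) {M N M' N' : Model s.voc} {p : s.OrbType M}
    {q : s.OrbType N} {p' : s.OrbType M'} {q' : s.OrbType N'} (h : IsNfExt p q)
    (hq : Transports f q q') (hp : Transports f p p') : IsNfExt p' q' := by
  have hk := hs.isoClosed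
  have hle : s.le M' N' := hk.iso_le _ _ _ _ _ hq.1 hp.1 h.le
  refine ⟨hs.bs_iso _ _ _ _ _ hq h.1, (isRestr_iff hk hle).2 ?_, h.2.2.transports hs hq hp.1⟩
  have := hq.restr hk hp.1 h.le hle
  rw [← h.eq_restr hs] at this
  exact hp.unique hs.hasAmalgamation hk this

end FrameData

/-! ## Resolutions by smaller models -/

namespace AECData

open Model

variable {k : AECData.{u}} {lam : Cardinal.{u}} {mu : Cardinal.{u + 1}}

/-- A model of cardinality above `lam` is the union of an increasing continuous chain of models of
smaller cardinality. -/
theorem IsEssAEC.exists_resolution (hk : k.IsEssAEC lam mu) {M : Model k.voc} (hM : k.K M)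
    (hlt : Cardinal.lift.{u + 1} lam < M.card) :
    ∃ δ Ms, Order.IsSuccLimit δ ∧ k.IncreasingCont δ Ms ∧ Ms δ = M ∧
      ∀ i < δ, (Ms i).card < M.card := by
  -- Since `mu` is at most `Cardinal.univ`, the cardinality of `M` comes from the lower universe, so
  -- `M` can be listed along an ordinal `χ.ord` there.
  obtain ⟨χ, hχ⟩ := Cardinal.lt_univ.1 ((hk.card_mem M hM).2.trans_le hk.mu_le)
  have hlamχ : lam < χ := by rwa [hχ, Cardinal.lift_lt] at hlt
  have hχ0 : ℵ₀ ≤ χ := hk.aleph0_le.trans hlamχ.le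
  have hne : M.carrier.Nonempty := by
    rw [Set.nonempty_iff_ne_empty]
    intro h
    rw [Model.card, h, Cardinal.mk_eq_zero] at hlt
    exact not_lt_zero hlt
  obtain ⟨e⟩ : Nonempty (M.carrier ≃ ULift.{u + 1} χ.ord.ToType) := by
    rw [← Cardinal.eq, Cardinal.mk_uLift, Cardinal.mk_ord_toType]
    exact hχ
  obtain ⟨m, hm, hms⟩ : ∃ m : Ordinal.{u} → ZFSet.{u}, (∀ i, m i ∈ M.carrier) ∧
      ∀ x ∈ M.carrier, ∃ i < χ.ord, m i = x := by
    classical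
    refine ⟨fun i => if h : i ∈ Set.Iio χ.ord then (e.symm ⟨ToType.mk ⟨i, h⟩⟩).1 else hne.some,
      fun i => ?_, fun x hx => ?_⟩
    · dsimp only
      split_ifs
      exacts [Subtype.prop _, hne.some_mem]
    · refine ⟨(ToType.mk.symm (e ⟨x, hx⟩).down).1, (ToType.mk.symm (e ⟨x, hx⟩).down).2, ?_⟩
      have h := (ToType.mk.symm (e ⟨x, hx⟩).down).2
      simp only [dif_pos h]
      simp [ULift.up_down]
  have : Nonempty (Model k.voc) := ⟨M⟩
  choose! H hH using fun A hA => hk.lowenheim M A hM hA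
  -- Here `H` is a Löwenheim hull inside `M`. Successor steps absorb the next element `m i`, and
  -- limit steps are unions.
  let A : Ordinal.{u} → Set ZFSet.{u} := fun i => limitRecOn i (H ∅).carrier
    (fun j A => (H (insert (m j) A)).carrier) (fun i _ A => ⋃ j, ⋃ h : j < i, A j h)
  have hA0 : A 0 = (H ∅).carrier := limitRecOn_zero _ _ _
  have hAs : ∀ i, A (i + 1) = (H (insert (m i) (A i))).carrier := fun i =>
    limitRecOn_add_one _ _ _ _
  have hAl : ∀ i, Order.IsSuccLimit i → A i = ⋃ j ∈ Set.Iio i, A j := fun i hi =>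
    limitRecOn_limit _ _ _ _ hi
  have key : ∀ i, (∃ N, k.le N M ∧ N.carrier = A i) ∧ (∀ j ≤ i, A j ⊆ A i) ∧
      #(A i) ≤ Cardinal.lift.{u + 1} (lam + i.card) := by
    intro i
    induction i using limitRecOn with
    | zero =>
      have h := hH ∅ (Set.empty_subset _)
      refine ⟨⟨_, h.2.1, hA0.symm⟩, fun j hj => ?_, ?_⟩
      · rw [nonpos_iff_eq_zero.1 hj]
      · rw [hA0]
        simpa [Model.card] using h.2.2
    | add_one i ih =>
      obtain ⟨⟨N, hN, hNA⟩, hmon, hcard⟩ := ih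
      have h := hH (insert (m i) (A i)) (Set.insert_subset (hm i)
        (hNA ▸ (hk.le_sub _ _ hN).carrier))
      have hsub : A i ⊆ A (i + 1) := hAs i ▸ (Set.subset_insert _ _).trans h.1
      refine ⟨⟨_, h.2.1, (hAs i).symm⟩, fun j hj => ?_, ?_⟩
      · rcases hj.lt_or_eq with hj | rfl
        · exact (hmon j (Order.lt_succ_iff.1 hj)).trans hsub
        · exact subset_rfl
      · rw [hAs]
        refine h.2.2.trans ((add_le_add le_rfl (Cardinal.mk_insert_le.trans
          (add_le_add hcard le_rfl))).trans ?_)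
        rw [card_add, card_one, Cardinal.lift_add, Cardinal.lift_add, Cardinal.lift_add,
          Cardinal.lift_one, ← add_assoc, ← add_assoc, ← add_assoc]
        rw [Cardinal.add_eq_self (by simpa using hk.aleph0_le)]
    | limit i hi ih =>
      have hmon : ∀ j ≤ i, A j ⊆ A i := fun j hj => by
        rcases hj.lt_or_eq with hj | rfl
        · rw [hAl i hi]
          exact Set.subset_biUnion_of_mem (u := A) (show j ∈ Set.Iio i from hj)
        · exact subset_rfl
      refine ⟨?_, hmon, ?_⟩
      · choose! N hN hNA using fun j (hj : j < i) => (ih j hj).1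
        -- All stages are below `M`, so coherence turns inclusion into `k.le`; the union axioms then
        -- put the limit stage below `M` again.
        have hle : ∀ j l, j ≤ l → l < i → k.le (N j) (N l) := fun j l hjl hl => by
          have hj := hN j (hjl.trans_lt hl)
          refine hk.coherence _ _ _ ((hk.le_sub _ _ hj).of_subset (hk.le_sub _ _ (hN l hl)) ?_)
            hj (hN l hl)
          rw [hNA j (hjl.trans_lt hl), hNA l hl]
          exact (ih l hl).2.1 j hjl
        have hU : (⋃ j ∈ Set.Iio i, (N j).carrier) = A i := by
          rw [hAl i hi]
          exact Set.iUnion₂_congr fun j hj => hNA j hj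
        have hinc : k.Increasing i N := ⟨fun j hj => (hk.le_mem _ _ (hN j hj)).1, hle⟩
        have hUM : (⋃ j ∈ Set.Iio i, (N j).carrier) ⊆ M.carrier :=
          Set.iUnion₂_subset fun j hj => (hk.le_sub _ _ (hN j hj)).carrier
        obtain ⟨P, ⟨hP, hPc, hPle⟩, -⟩ := hk.union i N hi hinc
          ((Cardinal.mk_le_mk_of_subset hUM).trans_lt (hk.card_mem M hM).2)
        exact ⟨P, hk.union_le i N P M hi hinc hP hPc hPle hN, hPc.trans hU⟩
      · rw [hAl i hi]
        refine (Cardinal.mk_biUnion_le _ _).trans ?_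
        rw [Cardinal.mk_Iio_ordinal]
        refine (mul_le_mul' (Cardinal.lift_le.2 (self_le_add_left _ lam))
          (ciSup_le' fun j : Set.Iio i => (ih j.1 j.2).2.2.trans
            (Cardinal.lift_le.2 (add_le_add le_rfl (Ordinal.card_le_card j.2.le))))).trans ?_
        rw [← Cardinal.lift_mul, Cardinal.mul_eq_self (hk.aleph0_le.trans (self_le_add_right _ _))]
  choose Ms hMs hMsA using fun i => (key i).1
  have hle : ∀ i j, i ≤ j → k.le (Ms i) (Ms j) := fun i j hij => by
    refine hk.coherence _ _ _ ((hk.le_sub _ _ (hMs i)).of_subset (hk.le_sub _ _ (hMs j)) ?_)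
      (hMs i) (hMs j)
    rw [hMsA i, hMsA j]
    exact (key j).2.1 i hij
  have hδ := Cardinal.isSuccLimit_ord hχ0
  refine ⟨χ.ord, Ms, hδ, ⟨fun i _ => (hk.le_mem _ _ (hMs i)).1, fun i j hij _ => hle i j hij,
    fun i _ hi => ?_⟩, ?_, fun i hi => ?_⟩
  · rw [hMsA, hAl i hi]
    simp only [hMsA]
  · refine (hk.le_sub _ _ (hMs _)).eq_of_carrier (.refl M)
      ((hk.le_sub _ _ (hMs _)).carrier.antisymm fun x hx => ?_)
    obtain ⟨i, hi, rfl⟩ := hms x hx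
    rw [hMsA]
    refine (key _).2.1 (i + 1) (hδ.succ_lt hi).le ?_
    rw [hAs]
    refine (hH _ (Set.insert_subset (hm i) ?_)).1 (Set.mem_insert _ _)
    rw [← hMsA]
    exact (hk.le_sub _ _ (hMs i)).carrier
  · have h : (Ms i).card = #(A i) := by rw [Model.card, hMsA]
    rw [h, hχ]
    refine (key i).2.2.trans_lt (Cardinal.lift_lt.2 (Cardinal.add_lt_of_lt hχ0 hlamχ ?_))
    exact Cardinal.lt_ord.1 hi

end AECData

/-! ### Non-forking over models of cardinality `lam` -/

namespace FrameData

open AECData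

variable {s : FrameData.{u}} {lam : Cardinal.{u}} {mu : Cardinal.{u + 1}}

theorem IsGood.exists_dnf_of_isSuccLimit (hs : s.IsGood lam mu) {δ : Ordinal.{u}}
    {Ms : Ordinal.{u} → Model s.voc} (hδ : Order.IsSuccLimit δ) (hM : s.IncreasingCont δ Ms)
    {p : s.OrbType (Ms δ)} (hp : p ∈ s.bs (Ms δ)) : ∃ i < δ, Dnf (Ms i) p := by
  obtain ⟨a, N, ha⟩ := exists_isOrtp p
  obtain ⟨i, hi, h⟩ := hs.local_character δ Ms N a hδ hM (hs.isBasicTriple hp ha)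
  exact ⟨i, hi, a, N, ha, h⟩

/-- A basic type does not fork over some model of cardinality `lam`. -/
theorem IsGood.exists_dnf_card_eq (hs : s.IsGood lam mu) {M : Model s.voc} {p : s.OrbType M}
    (hp : p ∈ s.bs M) : ∃ M₀, s.le M₀ M ∧ M₀.card = Cardinal.lift.{u + 1} lam ∧ Dnf M₀ p := by
  -- A model of least cardinality over which `p` does not fork. Were it larger than `lam`, local
  -- character along a resolution of it, with transitivity, would give a smaller one.
  obtain ⟨M₀, hd, hmin⟩ := WellFounded.has_min
    (InvImage.wf (fun N : Model s.voc => N.card) Cardinal.lt_wf) {N | Dnf N p} ⟨M, hs.dnf_self hp⟩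
  have hle := hs.le_of_dnf hd
  have hK := (hs.isoClosed.le_mem _ _ hle).1
  refine ⟨M₀, hle, ?_, hd⟩
  by_contra hne
  obtain ⟨δ, Ms, hδ, hMs, rfl, hlt⟩ :=
    hs.aec.exists_resolution hK (lt_of_le_of_ne (hs.aec.card_mem _ hK).1 (Ne.symm hne))
  obtain ⟨i, hi, hdi⟩ := hs.exists_dnf_of_isSuccLimit hδ hMs (hs.restr_bs hd hle)
  exact hmin (Ms i) (hs.dnf_trans hle hdi hd) (hlt i hi)

end FrameData

/-! ## Isomorphism invariant choices -/

section SingletonFiber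

variable {ι α β : Type*} [Nonempty ι]

/-- The index of the unique singleton fibre of `a`, if there is one. -/
noncomputable def singletonFiber (a : ι → α) : ι :=
  Classical.epsilon fun i => ∀ j, (∀ j', a j' = a j → j' = j) ↔ j = i

/-- The index is read off from the pattern of equalities in the sequence, and an injective map
preserves that pattern. Thus a listing can carry an index without any reference to the structure of
the model. -/
theorem singletonFiber_comp {g : α → β} {a : ι → α} {A : Set α} (hg : Set.InjOn g A)
    (ha : ∀ i, a i ∈ A) : singletonFiber (g ∘ a) = singletonFiber a := by
  have h : ∀ j j', (g ∘ a) j' = (g ∘ a) j ↔ a j' = a j :=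
    fun j j' => ⟨fun h => hg (ha j') (ha j) h, fun h => congrArg g h⟩
  simp only [singletonFiber, h]

/-- Collapse the indices other than `i` two-to-one onto themselves, fix `i`, and compose with a
bijection onto `S`: only the fibre of `i` is a singleton. -/
theorem exists_singletonFiber_eq {ι : Type u} {α : Type (u + 1)} [Infinite ι] (S : Set α)
    (hS : #S = Cardinal.lift.{u + 1} #ι) (i : ι) :
    ∃ a : ι → α, Set.range a = S ∧ singletonFiber a = i := by
  classical
  obtain ⟨e⟩ : Nonempty (ι ≃ S) := by
    rw [← Cardinal.lift_mk_eq', hS, Cardinal.lift_lift]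
  have : Infinite {j // j ≠ i} := Set.Infinite.to_subtype (Set.finite_singleton i).infinite_compl
  obtain ⟨φ⟩ : Nonempty ({j // j ≠ i} ≃ {j // j ≠ i} × Bool) := by
    rw [← Cardinal.eq, Cardinal.mk_prod, Cardinal.lift_uzero, Cardinal.mk_bool, Cardinal.lift_ofNat]
    exact (Cardinal.mul_eq_left (Cardinal.aleph0_le_mk _)
      ((Cardinal.natCast_lt_aleph0 (n := 2)).le.trans (Cardinal.aleph0_le_mk _)) two_ne_zero).symm
  set c : ι → ι := fun j => if h : j ≠ i then (φ ⟨j, h⟩).1.1 else i with hc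
  have hci : c i = i := dif_neg (not_not.2 rfl)
  have hcj : ∀ j (h : j ≠ i), c j = (φ ⟨j, h⟩).1.1 := fun j h => dif_pos h
  have hcs : Function.Surjective c := fun l => by
    by_cases hl : l = i
    · exact ⟨i, hl ▸ hci⟩
    · refine ⟨(φ.symm (⟨l, hl⟩, true)).1, ?_⟩
      rw [hcj _ (φ.symm (⟨l, hl⟩, true)).2]
      simp
  have hfib : ∀ j, (∀ j', c j' = c j → j' = j) ↔ j = i := by
    refine fun j => ⟨fun h => by_contra fun hj => ?_, ?_⟩
    · have h1 := h (φ.symm ((φ ⟨j, hj⟩).1, !(φ ⟨j, hj⟩).2)).1 (by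
        rw [hcj j hj, hcj _ (φ.symm ((φ ⟨j, hj⟩).1, !(φ ⟨j, hj⟩).2)).2]
        simp)
      have h2 : φ.symm ((φ ⟨j, hj⟩).1, !(φ ⟨j, hj⟩).2) = ⟨j, hj⟩ := Subtype.ext h1
      have h3 := congrArg (fun x => (φ x).2) h2
      simp at h3
    · rintro rfl j' hj'
      by_contra hne
      rw [hci, hcj _ hne] at hj'
      exact (φ ⟨j', hne⟩).1.2 hj'
  refine ⟨fun j => e (c j), ?_, ?_⟩
  · rw [show (fun j => (e (c j)).1) = Subtype.val ∘ e ∘ c from rfl, Set.range_comp,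
      (e.surjective.comp hcs).range_eq, Set.image_univ, Subtype.range_val]
  · have h := singletonFiber_comp (g := fun j => (e j).1) (a := c) (A := Set.univ)
      (fun x _ y _ h => e.injective (Subtype.ext h)) fun _ => Set.mem_univ _
    refine h.trans ?_
    have h2 := Classical.epsilon_spec (p := fun l => ∀ j, (∀ j', c j' = c j → j' = j) ↔ j = l)
      ⟨i, hfib⟩
    exact ((h2 i).1 ((hfib i).2 rfl)).symm

end SingletonFiber

namespace Model

variable {τ : Vocab.{u}} {lam : Cardinal.{u}} {f g : ZFSet.{u} → ZFSet.{u}}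

instance : Nonempty (Model τ) :=
  ⟨{ carrier := {∅}
     rel := fun _ => ∅
     fn := fun _ _ => ∅
     rel_sub := fun _ _ h => h.elim
     fn_mem := fun _ _ _ => rfl
     fn_junk := fun _ _ _ => rfl }⟩

/-- A representative of the isomorphism type of `M`. -/
noncomputable def rep (M : Model τ) : Model τ := Classical.epsilon fun M₁ => Isomorphic M₁ M

theorem isomorphic_rep (M : Model τ) : Isomorphic M.rep M :=
  Classical.epsilon_spec (p := fun M₁ => Isomorphic M₁ M) ⟨M, id, .refl M⟩

/-- Isomorphic models satisfy the same defining predicate, so the choice operator returns literally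
the same model. An arbitrary enumeration attached to the representative is therefore shared by the
whole isomorphism type. -/
theorem IsIso.rep_eq {M N : Model τ} (h : IsIso f M N) : M.rep = N.rep := by
  obtain ⟨g, hg, -⟩ := h.exists_inv
  refine congrArg Classical.epsilon (funext fun M₁ => propext ⟨?_, ?_⟩)
  · rintro ⟨j, hj⟩
    exact ⟨_, h.comp hj⟩
  · rintro ⟨j, hj⟩
    exact ⟨_, hg.comp hj⟩

/-- `f` is an isomorphism from `M.rep` onto `M` that maps `b` to `a`. -/
def IsRepIso (f : ZFSet.{u} → ZFSet.{u}) (M : Model τ) (b a : LSeq lam) : Prop :=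
  IsIso f M.rep M ∧ (∀ i, b i ∈ M.rep.carrier) ∧ f ∘ b = a

/-- A sequence in `M.rep` that represents the isomorphism type of `(M, a)`. -/
noncomputable def repSeq (M : Model τ) (a : LSeq lam) : LSeq lam :=
  Classical.epsilon fun b => ∃ f, IsRepIso f M b a

theorem exists_isRepIso {M : Model τ} {a : LSeq lam} (ha : ∀ i, a i ∈ M.carrier) :
    ∃ f, IsRepIso f M (M.repSeq a) a := by
  obtain ⟨f, hf⟩ := isomorphic_rep M
  obtain ⟨b, hb, hba⟩ := hf.exists_preimage ha
  exact Classical.epsilon_spec (p := fun b => ∃ f, IsRepIso f M b a) ⟨b, f, hf, hb, hba⟩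

theorem IsIso.repSeq_eq {M N : Model τ} (h : IsIso f M N) {a : LSeq lam}
    (ha : ∀ i, a i ∈ M.carrier) : M.repSeq a = N.repSeq (f ∘ a) := by
  obtain ⟨g, hg, hgl, -⟩ := h.exists_inv
  have hga : g ∘ f ∘ a = a := funext fun i => hgl (ha i)
  refine congrArg Classical.epsilon (funext fun b => propext ⟨?_, ?_⟩)
  · rintro ⟨j, hj, hb, rfl⟩
    exact ⟨f ∘ j, h.rep_eq ▸ h.comp hj, h.rep_eq ▸ hb, rfl⟩
  · rintro ⟨j, hj, hb, hjb⟩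
    refine ⟨g ∘ j, h.rep_eq ▸ hg.comp hj, h.rep_eq ▸ hb, ?_⟩
    rw [Function.comp_assoc, hjb, hga]

/-- As `a` lists all of `M`, every element of the representative is some `b i`, where the value must
be `a i`. Transport along the isomorphism thus does not depend on its choice. -/
theorem IsRepIso.eqOn {M : Model τ} {b a : LSeq lam} (ha : M.carrier = Set.range a)
    (hf : IsRepIso f M b a) (hg : IsRepIso g M b a) : Set.EqOn f g M.rep.carrier := by
  obtain ⟨hf, hb, hfb⟩ := hf
  intro x hx
  obtain ⟨i, hi⟩ : f x ∈ Set.range a := ha ▸ hf.mem hx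
  have hxi : x = b i := hf.bij.injOn hx (hb i) (by rw [← hi, ← hfb]; rfl)
  have h := congrFun (hfb.trans hg.2.2.symm) i
  rw [hxi]
  exact h

end Model

/-! ## Functions from sequences to basic types -/

namespace AECData

open Model

variable {k : AECData.{u}} {lam : Cardinal.{u}} {mu : Cardinal.{u + 1}}

theorem IsEssAEC.infinite (hk : k.IsEssAEC lam mu) : Infinite lam.ord.ToType := by
  rw [Cardinal.infinite_iff, Cardinal.mk_ord_toType]
  exact hk.aleph0_le

theorem IsEssAEC.card_eq (hk : k.IsEssAEC lam mu) {M : Model k.voc} (hM : k.K M) {a : LSeq lam}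
    (ha : M.carrier = Set.range a) : M.card = Cardinal.lift.{u + 1} lam := by
  refine le_antisymm ?_ (hk.card_mem M hM).1
  have h := Cardinal.mk_range_le_lift (f := a)
  rw [Cardinal.mk_ord_toType, ← ha] at h
  rwa [Cardinal.lift_id'.{u, u + 1}] at h

theorem exists_listing {M : Model k.voc} (h : M.card = Cardinal.lift.{u + 1} lam) :
    ∃ a : LSeq lam, M.carrier = Set.range a := by
  obtain ⟨e⟩ : Nonempty (lam.ord.ToType ≃ M.carrier) := by
    rw [← Cardinal.lift_mk_eq', Cardinal.mk_ord_toType, ← Model.card, h, Cardinal.lift_lift]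
  refine ⟨fun i => e i, ?_⟩
  rw [show (fun i => (e i).1) = Subtype.val ∘ e from rfl, Set.range_comp, e.surjective.range_eq,
    Set.image_univ, Subtype.range_val]

theorem mem_of_mem_seq (hk : k.IsIsoClosed) {M : Model k.voc} {a : LSeq lam}
    (ha : a ∈ k.seq lam M) (i) : a i ∈ M.carrier := by
  obtain ⟨M₀, hle, h⟩ := ha
  exact (hk.le_sub _ _ hle).carrier (h ▸ Set.mem_range_self i)

theorem seq_iso (hk : k.IsIsoClosed) {M N : Model k.voc} {f : ZFSet.{u} → ZFSet.{u}}
    (h : IsIso f M N) {a : LSeq lam} (ha : a ∈ k.seq lam M) : f ∘ a ∈ k.seq lam N := by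
  obtain ⟨M₀, hle, h₀⟩ := ha
  refine ⟨M₀.map f, hk.iso_le f _ _ _ _ h (h.isIso_map (hk.le_sub _ _ hle)) hle, ?_⟩
  rw [Set.range_comp, ← h₀]
  rfl

theorem le_of_mem_seq (hk : k.IsIsoClosed) {M N M₀ : Model k.voc} (h : k.le M N) {a : LSeq lam}
    (ha : a ∈ k.seq lam M) (hle : k.le M₀ N) (h₀ : M₀.carrier = Set.range a) : k.le M₀ M := by
  obtain ⟨M₁, hM₁, h₁⟩ := ha
  have he := (hk.le_sub _ _ (hk.le_trans _ _ _ hM₁ h)).eq_of_carrier (hk.le_sub _ _ hle)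
    (h₁.trans h₀.symm)
  exact he ▸ hM₁

theorem IsEssAEC.mem_seq_of_range_subset (hk : k.IsEssAEC lam mu) {M N : Model k.voc}
    (h : k.le M N) {a : LSeq lam} (ha : a ∈ k.seq lam N) (hr : ∀ i, a i ∈ M.carrier) :
    a ∈ k.seq lam M := by
  obtain ⟨M₀, hM₀, h₀⟩ := ha
  refine ⟨M₀, hk.coherence _ _ _ ((hk.le_sub _ _ hM₀).of_subset (hk.le_sub _ _ h) ?_) hM₀ h, h₀⟩
  rw [h₀]
  rintro _ ⟨i, rfl⟩
  exact hr i

end AECData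

/-! ### Invariant indexing of types by listings -/

namespace FrameData

open AECData Model

variable {s : FrameData.{u}} {lam : Cardinal.{u}} {mu : Cardinal.{u + 1}}
  {f g : ZFSet.{u} → ZFSet.{u}} {B : ∀ M : Model s.voc, Set (s.OrbType M)}

/-- A family of sets of basic types that is invariant under isomorphisms and, over models of
cardinality `lam`, under parallelism. -/
structure IsCopyFamily (lam : Cardinal.{u}) (B : ∀ M : Model s.voc, Set (s.OrbType M)) :
    Prop where
  sub : ∀ M, B M ⊆ s.bs M
  iso : ∀ f M N (p : s.OrbType M) (q : s.OrbType N), Transports f p q → p ∈ B M → q ∈ B N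
  parallel : ∀ M₀ M₁ N (p₀ : s.OrbType M₀) (p₁ : s.OrbType M₁) (p : s.OrbType N),
    M₀.card = Cardinal.lift.{u + 1} lam → M₁.card = Cardinal.lift.{u + 1} lam →
    IsNfExt p₀ p → IsNfExt p₁ p → p₀ ∈ B M₀ → p₁ ∈ B M₁

/-- The types in `B M` can be indexed, with repetitions, by the sequences listing `M`, in a way
that is invariant under isomorphisms. -/
theorem IsGood.exists_listing_types (hs : s.IsGood lam mu) (hB : IsCopyFamily lam B) :
    ∃ T : ∀ M : Model s.voc, LSeq lam → s.OrbType M → Prop,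
      (∀ M a p, T M a p → M.carrier = Set.range a ∧ p ∈ B M) ∧
      (∀ M a p q, T M a p → T M a q → p = q) ∧
      (∀ M a, s.K M → M.carrier = Set.range a → (B M).Nonempty → ∃ p, T M a p) ∧
      (∀ f M N a p q, T M a p → Transports f p q → T N (f ∘ a) q) ∧
      ∀ M, s.K M → M.card = Cardinal.lift.{u + 1} lam → ∀ p ∈ B M, ∃ a, T M a p := by
  have hk := hs.isoClosed
  have ham := hs.hasAmalgamation
  have := hs.aec.infinite
  -- Stability bounds the number of types by `lam`. The enumeration is used only at representatives,
  -- so it need not be invariant; `none` is a default where there is nothing to enumerate.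
  have he : ∀ M : Model s.voc, ∃ e : lam.ord.ToType → Option (s.OrbType M),
      (∀ i p, e i = some p → p ∈ B M) ∧
      (s.K M → M.card = Cardinal.lift.{u + 1} lam → (B M).Nonempty →
        (∀ i, ∃ p, e i = some p) ∧ ∀ p ∈ B M, ∃ i, e i = some p) := by
    intro M
    by_cases h : s.K M ∧ M.card = Cardinal.lift.{u + 1} lam ∧ (B M).Nonempty
    · obtain ⟨hM, hc, hne⟩ := h
      have hne' := hne.to_subtype
      have hle : Cardinal.lift.{u} #(B M) ≤ Cardinal.lift.{u + 1} #lam.ord.ToType := by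
        rw [Cardinal.mk_ord_toType, ← hc, Cardinal.lift_id'.{u, u + 1}]
        exact (Cardinal.mk_le_mk_of_subset (hB.sub M)).trans (hs.stability M hM)
      obtain ⟨j⟩ := Cardinal.lift_mk_le'.{u + 1, u}.1 hle
      have hsurj := Function.invFun_surjective j.injective
      refine ⟨fun i => some (Function.invFun j i).1, fun i p h => ?_, fun _ _ _ =>
        ⟨fun i => ⟨_, rfl⟩, fun p hp => ?_⟩⟩
      · exact Option.some.inj h ▸ (Function.invFun j i).2
      · obtain ⟨i, hi⟩ := hsurj ⟨p, hp⟩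
        exact ⟨i, congrArg (fun x => some x.1) hi⟩
    · exact ⟨fun _ => none, by simp, fun h1 h2 h3 => absurd ⟨h1, h2, h3⟩ h⟩
  choose e heB he using he
  -- The singleton fibre of `a` selects a type over the representative, which is carried to `M` by
  -- the isomorphism sending `repSeq` to `a`.
  refine ⟨fun M a p => M.carrier = Set.range a ∧ ∃ f p₁, IsRepIso f M (M.repSeq a) a ∧
    e M.rep (singletonFiber a) = some p₁ ∧ Transports f p₁ p, ?_, ?_, ?_, ?_, ?_⟩
  · rintro M a p ⟨ha, f, p₁, hf, h₁, ht⟩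
    exact ⟨ha, hB.iso _ _ _ _ _ ht (heB _ _ _ h₁)⟩
  · rintro M a p q ⟨ha, f, p₁, hf, h₁, ht⟩ ⟨-, f', p₁', hf', h₁', ht'⟩
    cases Option.some.inj (h₁.symm.trans h₁')
    exact (ht.congr (hf.eqOn ha hf')).unique ham hk ht'
  · intro M a hM ha hne
    obtain ⟨f, hf⟩ := exists_isRepIso (M := M) (a := a) (fun i => ha ▸ Set.mem_range_self i)
    obtain ⟨j, hj, -⟩ := hf.1.exists_inv
    obtain ⟨p, hp⟩ := hne
    obtain ⟨p', hp'⟩ := exists_transports hk hj p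
    obtain ⟨p₁, h₁⟩ := (he M.rep (hk.iso_mem _ _ _ hj hM)
      (hj.card_eq.symm.trans (hs.aec.card_eq hM ha))
      ⟨p', hB.iso _ _ _ _ _ hp' hp⟩).1 (singletonFiber a)
    obtain ⟨q, hq⟩ := exists_transports hk hf.1 p₁
    exact ⟨q, ha, f, p₁, hf, h₁, hq⟩
  · rintro f M N a p q ⟨ha, g, p₁, hg, h₁, ht⟩ hq
    have haM : ∀ i, a i ∈ M.carrier := fun i => ha ▸ Set.mem_range_self i
    have hrep := hq.1.rep_eq
    have hsf : singletonFiber (f ∘ a) = singletonFiber a :=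
      singletonFiber_comp hq.1.bij.injOn haM
    have hcomp := ht.comp ham hk hq
    refine ⟨by rw [Set.range_comp, ← ha, hq.1.image_eq], ?_⟩
    rw [hsf, ← hq.1.repSeq_eq haM]
    unfold IsRepIso at hg ⊢
    obtain ⟨hg, hb, hgb⟩ := hg
    clear ht
    -- The type `p₁` lives over `M.rep`, so it has to be generalized before `M.rep` can be replaced
    -- by the equal model `N.rep`.
    revert p₁ hg hb
    rw [hrep]
    intro p₁ h₁ hcomp hg hb
    exact ⟨f ∘ g, p₁, ⟨hq.1.comp hg, hb, by rw [Function.comp_assoc, hgb]⟩, h₁, hcomp⟩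
  · intro M hM hc p hp
    obtain ⟨f, hf⟩ := isomorphic_rep M
    obtain ⟨j, hj, hjl, hjr⟩ := hf.exists_inv
    obtain ⟨p', hp'⟩ := exists_transports hk hj p
    have hp'f := hp'.inv hk hjr
    have hp'B := hB.iso _ _ _ _ _ hp' hp
    obtain ⟨i, hi⟩ := (he M.rep (hk.iso_mem _ _ _ hj hM) (hj.card_eq.symm.trans hc)
      ⟨p', hp'B⟩).2 p' hp'B
    obtain ⟨a, ha, hai⟩ := exists_singletonFiber_eq (ι := lam.ord.ToType) M.carrier
      (by rw [Cardinal.mk_ord_toType]; exact hc) i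
    have haM : ∀ i, a i ∈ M.carrier := fun i => ha ▸ Set.mem_range_self i
    obtain ⟨g, hg⟩ := exists_isRepIso haM
    obtain ⟨g', hg', hgl, hgr⟩ := hg.1.exists_inv
    have hσ := hf.comp hg'
    -- The isomorphism `g` belonging to `a` need not be `f`. Moving `a` by the automorphism `f ∘ g'`
    -- of `M` keeps its index and its representing sequence, and makes `f` the isomorphism that
    -- belongs to it.
    refine ⟨(f ∘ g') ∘ a, ?_, f, p', ⟨hf, ?_⟩, ?_, hp'f⟩
    · rw [Set.range_comp, ha, hσ.image_eq]
    · rw [← hσ.repSeq_eq haM]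
      refine ⟨hg.2.1, ?_⟩
      conv_rhs => rw [← hg.2.2]
      exact funext fun i => congrArg f (hgl (hg.2.1 i)).symm
    · rw [singletonFiber_comp hσ.bij.injOn haM, hai, hi]

end FrameData

/-! ### Naming types over arbitrary models by non-forking extension -/

namespace FrameData

open AECData Model

variable {s : FrameData.{u}} {lam : Cardinal.{u}} {mu : Cardinal.{u + 1}}
  {f g : ZFSet.{u} → ZFSet.{u}} {B : ∀ M : Model s.voc, Set (s.OrbType M)}
  {F : s.TypeFun lam}

/-- `F` names the types whose restrictions to models of cardinality `lam` belong to `B`. -/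
structure Names (F : s.TypeFun lam) (B : ∀ M : Model s.voc, Set (s.OrbType M)) : Prop where
  of_eq : ∀ N a p, F N a = some p → ∃ (M₀ : Model s.voc) (p₀ : s.OrbType M₀),
    M₀.carrier = Set.range a ∧ p₀ ∈ B M₀ ∧ IsNfExt p₀ p
  exists_eq : ∀ M₀ N a, s.le M₀ N → M₀.carrier = Set.range a → (B M₀).Nonempty →
    ∃ p, F N a = some p
  surj : ∀ (M₀ N : Model s.voc) (p₀ : s.OrbType M₀) (p : s.OrbType N),
    M₀.card = Cardinal.lift.{u + 1} lam → p₀ ∈ B M₀ → IsNfExt p₀ p →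
    ∃ a, M₀.carrier = Set.range a ∧ F N a = some p
  nfCompatible : F.NfCompatible
  isoCompatible : F.IsoCompatible

/-- The name `a` stands for the non-forking extension of the type that the listing indexes over its
own range. The value is unique because a submodel of `N` is determined by its universe and
non-forking extensions are unique. -/
theorem IsGood.exists_names (hs : s.IsGood lam mu) (hB : IsCopyFamily lam B) :
    ∃ F : s.TypeFun lam, Names F B := by
  classical
  have hk := hs.isoClosed
  obtain ⟨T, hTB, hTf, hTe, hTi, hTs⟩ := hs.exists_listing_types hB
  let R : ∀ N : Model s.voc, LSeq lam → s.OrbType N → Prop := fun N a p =>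
    ∃ (M₀ : Model s.voc) (p₀ : s.OrbType M₀), T M₀ a p₀ ∧ IsNfExt p₀ p
  have hRf : ∀ N a p q, R N a p → R N a q → p = q := by
    rintro N a p q ⟨M₀, p₀, h₀, hp⟩ ⟨M₁, p₁, h₁, hq⟩
    have he := (hk.le_sub _ _ hp.le).eq_of_carrier (hk.le_sub _ _ hq.le)
      ((hTB _ _ _ h₀).1.trans (hTB _ _ _ h₁).1.symm)
    subst he
    cases hTf _ _ _ _ h₀ h₁
    exact hp.unique hs hq
  let F : s.TypeFun lam := fun N a => if h : ∃ p, R N a p then some h.choose else none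
  have hF : ∀ N a p, F N a = some p ↔ R N a p := by
    intro N a p
    by_cases h : ∃ p, R N a p
    · have hc : F N a = some h.choose := dif_pos h
      rw [hc, Option.some.injEq]
      exact ⟨fun e => e ▸ h.choose_spec, fun hp => hRf _ _ _ _ h.choose_spec hp⟩
    · have hc : F N a = none := dif_neg h
      rw [hc]
      exact ⟨fun e => (Option.some_ne_none _ e.symm).elim, fun hp => absurd ⟨p, hp⟩ h⟩
  refine ⟨F, ?_, ?_, ?_, ?_, ?_⟩
  · intro N a p hp
    obtain ⟨M₀, p₀, h₀, h⟩ := (hF _ _ _).1 hp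
    exact ⟨M₀, p₀, (hTB _ _ _ h₀).1, (hTB _ _ _ h₀).2, h⟩
  · intro M₀ N a hle ha hne
    obtain ⟨p₀, h₀⟩ := hTe M₀ a (hk.le_mem _ _ hle).1 ha hne
    obtain ⟨p, hp⟩ := hs.extension _ _ hle p₀ (hB.sub _ (hTB _ _ _ h₀).2)
    exact ⟨p, (hF _ _ _).2 ⟨M₀, p₀, h₀, hp⟩⟩
  · intro M₀ N p₀ p hc h₀ hp
    obtain ⟨a, ha⟩ := hTs M₀ (hk.le_mem _ _ hp.le).1 hc p₀ h₀
    exact ⟨a, (hTB _ _ _ ha).1, (hF _ _ _).2 ⟨M₀, p₀, ha, hp⟩⟩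
  · intro M N a p hle _ hp
    obtain ⟨M₀, p₀, h₀, h⟩ := (hF _ _ _).1 hp
    obtain ⟨q, hq⟩ := hs.extension _ _ hle p h.1
    exact ⟨q, (hF _ _ _).2 ⟨M₀, p₀, h₀, h.trans hs hq⟩, hq⟩
  · intro f N₁ N₂ a p hf hp
    obtain ⟨M₀, p₀, h₀, h⟩ := (hF _ _ _).1 hp
    obtain ⟨q, hq⟩ := exists_transports hk hf p
    obtain ⟨q₀, hq₀⟩ := exists_transports hk (hf.isIso_map (hk.le_sub _ _ h.le)) p₀
    exact ⟨q, (hF _ _ _).2 ⟨_, q₀, hTi _ _ _ _ _ _ h₀ hq₀, h.transports hs hq hq₀⟩, hq⟩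

/-- The relation of having the same name. -/
def TypeFun.Ker (F : s.TypeFun lam) : s.RelFam lam := fun N a b =>
  ∃ p, F N a = some p ∧ F N b = some p

theorem TypeFun.ker_self_iff {N : Model s.voc} {a : LSeq lam} :
    F.Ker N a a ↔ ∃ p, F N a = some p := by
  simp [TypeFun.Ker]

theorem Names.mem_seq (hF : Names F B) {N : Model s.voc} {a : LSeq lam} {p : s.OrbType N}
    (h : F N a = some p) : a ∈ s.seq lam N := by
  obtain ⟨M₀, p₀, ha, -, hp⟩ := hF.of_eq _ _ _ h
  exact ⟨M₀, hp.le, ha⟩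

theorem Names.bs (hF : Names F B) {N : Model s.voc} {a : LSeq lam} {p : s.OrbType N}
    (h : F N a = some p) : p ∈ s.bs N := by
  obtain ⟨M₀, p₀, -, -, hp⟩ := hF.of_eq _ _ _ h
  exact hp.1

theorem Names.mem (hs : s.IsGood lam mu) (hF : Names F B) {N : Model s.voc} {a : LSeq lam}
    {p : s.OrbType N} (h : F N a = some p) : s.K N := by
  obtain ⟨M₀, p₀, -, -, hp⟩ := hF.of_eq _ _ _ h
  exact (hs.isoClosed.le_mem _ _ hp.le).2

/-- Over a smaller model that contains the sequence, the name is defined as well. -/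
theorem Names.exists_restr (hs : s.IsGood lam mu) (hF : Names F B) {M N : Model s.voc}
    {a : LSeq lam} {q : s.OrbType N} (hle : s.le M N) (ha : a ∈ s.seq lam M)
    (h : F N a = some q) : ∃ p, F M a = some p ∧ IsNfExt p q := by
  obtain ⟨M₀, p₀, h₀, hB₀, hq⟩ := hF.of_eq _ _ _ h
  obtain ⟨p, hp⟩ := hF.exists_eq M₀ M a (le_of_mem_seq hs.isoClosed hle ha hq.le h₀) h₀ ⟨_, hB₀⟩
  obtain ⟨q', hq', he⟩ := hF.nfCompatible _ _ _ _ hle ha hp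
  cases Option.some.inj (h.symm.trans hq')
  exact ⟨p, hp, he⟩

theorem Names.ker_iso (hs : s.IsGood lam mu) (hF : Names F B) {N₁ N₂ : Model s.voc}
    {a b : LSeq lam} (hf : IsIso f N₁ N₂) (h : F.Ker N₁ a b) : F.Ker N₂ (f ∘ a) (f ∘ b) := by
  obtain ⟨p, ha, hb⟩ := h
  obtain ⟨q, hq, ht⟩ := hF.isoCompatible _ _ _ _ _ hf ha
  obtain ⟨q', hq', ht'⟩ := hF.isoCompatible _ _ _ _ _ hf hb
  cases ht.unique hs.hasAmalgamation hs.isoClosed ht'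
  exact ⟨q, hq, hq'⟩

theorem Names.isSmooth (hs : s.IsGood lam mu) (hB : IsCopyFamily lam B) (hF : Names F B) :
    IsSmooth F.Ker where
  dom := fun M a b _ ⟨p, ha, hb⟩ => ⟨hF.mem_seq ha, hF.mem_seq hb⟩
  symm := fun M a b _ ⟨p, ha, hb⟩ => ⟨p, hb, ha⟩
  trans := fun M a b c _ ⟨p, ha, hb⟩ ⟨q, hb', hc⟩ =>
    ⟨p, ha, hc.trans (hb'.symm.trans hb)⟩
  ext := by
    refine fun M₁ M₂ a b hle ha hb => ⟨?_, ?_⟩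
    · rintro ⟨q, hqa, hqb⟩
      obtain ⟨p, hp, h⟩ := hF.exists_restr hs hle ha hqa
      obtain ⟨p', hp', h'⟩ := hF.exists_restr hs hle hb hqb
      cases h.unique_left hs h'
      exact ⟨p, hp, hp'⟩
    · rintro ⟨p, hpa, hpb⟩
      obtain ⟨q, hq, h⟩ := hF.nfCompatible _ _ _ _ hle ha hpa
      obtain ⟨q', hq', h'⟩ := hF.nfCompatible _ _ _ _ hle hb hpb
      cases h.unique hs h'
      exact ⟨q, hq, hq'⟩
  iso := by
    refine fun f M₁ M₂ a b _ hf ha hb => ⟨hF.ker_iso hs hf, fun h => ?_⟩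
    obtain ⟨j, hj, hjl, -⟩ := hf.exists_inv
    have hj' : ∀ c ∈ s.seq lam M₁, j ∘ f ∘ c = c := fun c hc =>
      funext fun i => hjl (mem_of_mem_seq hs.isoClosed hc i)
    have := hF.ker_iso hs hj h
    rwa [hj' a ha, hj' b hb] at this
  cont := by
    rintro δ M hδ hM a ⟨p, hp, -⟩
    -- The named type does not fork over some `M i`, hence not over some `M₁` of cardinality `lam`
    -- below `M i`. Its restriction to `M₁` is parallel to the one that `a` indexes, so it belongs
    -- to `B`, and a listing of `M₁` names the same type.
    obtain ⟨i, hi, hd⟩ := hs.exists_dnf_of_isSuccLimit hδ hM (hF.bs hp)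
    have hle := hs.le_of_dnf hd
    have hr := hs.isNfExt_restr hd hle
    obtain ⟨M₁, hM₁, hc, hd₁⟩ := hs.exists_dnf_card_eq (hr.bs_left hs)
    have hr₁ := hs.isNfExt_restr hd₁ hM₁
    obtain ⟨M₀, p₀, h₀, hB₀, hp₀⟩ := hF.of_eq _ _ _ hp
    obtain ⟨b, hb, hbF⟩ := hF.surj M₁ (M i) _ _ hc (hB.parallel _ _ _ _ _ _
      (hs.aec.card_eq (hs.isoClosed.le_mem _ _ hp₀.le).1 h₀) hc hp₀ (hr₁.trans hs hr) hB₀) hr₁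
    have hbs : b ∈ s.seq lam (M i) := ⟨M₁, hM₁, hb⟩
    obtain ⟨q, hq, he⟩ := hF.nfCompatible _ _ _ _ hle hbs hbF
    cases he.unique hs hr
    exact ⟨i, hi, b, hbs, p, hp, hq⟩

/-- Sending a class to its named type is injective, and stability bounds the basic types. -/
theorem Names.isSmall (hs : s.IsGood lam mu) (hF : Names F B) : IsSmall F.Ker := by
  intro M hM
  refine le_trans ?_ (hs.stability M hM)
  choose a ha hc using fun c : classes F.Ker M => c.2
  choose p hp using fun c => TypeFun.ker_self_iff.1 (ha c)
  refine Cardinal.mk_le_of_injective (f := fun c => (⟨p c, hF.bs (hp c)⟩ : s.bs M)) ?_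
  intro c d hcd
  have he : p c = p d := congrArg Subtype.val hcd
  refine Subtype.ext ?_
  rw [hc, hc]
  ext b
  simp only [TypeFun.Ker, Set.mem_ofPred_eq, hp, he]

/-! ### All basic types -/

theorem IsGood.isCopyFamily_bs (hs : s.IsGood lam mu) : IsCopyFamily lam s.bs where
  sub _ := subset_rfl
  iso f M N p q h hp := hs.bs_iso f M N p q h hp
  parallel _ _ _ _ _ _ _ _ _ h _ := h.bs_left hs

/-- This makes names of basic types defined on all of `seq N`: every listed submodel has a type to
be indexed. -/
theorem IsGood.bs_nonempty (hs : s.IsGood lam mu) {M : Model s.voc} (hM : s.K M) :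
    (s.bs M).Nonempty := by
  obtain ⟨N, hle, hne⟩ := hs.no_maximal M hM
  obtain ⟨a, -, p, hp, -⟩ := hs.density M N hle hne
  exact ⟨p, hp⟩

theorem IsGood.exists_isImaginarySystem (hs : s.IsGood lam mu) :
    ∃ (E : s.RelFam lam) (F : s.TypeFun lam), IsImaginarySystem E F := by
  have hB := hs.isCopyFamily_bs
  obtain ⟨F, hF⟩ := hs.exists_names hB
  refine ⟨F.Ker, F, hF.isSmooth hs hB, hF.isSmall hs, fun N a => ⟨fun h => ?_, ?_⟩,
    fun N a p h => hF.bs h, fun N hN p hp => ?_, hF.nfCompatible, ?_, hF.isoCompatible⟩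
  · obtain ⟨p, hp⟩ := Option.isSome_iff_exists.1 h
    exact ⟨hF.mem hs hp, hF.mem_seq hp⟩
  · rintro ⟨-, M₀, hle, h₀⟩
    exact Option.isSome_iff_exists.2
      (hF.exists_eq _ _ _ hle h₀ (hs.bs_nonempty (hs.isoClosed.le_mem _ _ hle).1))
  · obtain ⟨M₀, hle, hc, hd, heq⟩ : ∃ M₀, s.le M₀ N ∧ M₀.card = Cardinal.lift.{u + 1} lam ∧
        Dnf M₀ p ∧ (N.card = Cardinal.lift.{u + 1} lam → M₀ = N) := by
      by_cases h : N.card = Cardinal.lift.{u + 1} lam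
      · exact ⟨N, hs.isoClosed.le_refl _ hN, h, hs.dnf_self hp, fun _ => rfl⟩
      · obtain ⟨M₀, h1, h2, h3⟩ := hs.exists_dnf_card_eq hp
        exact ⟨M₀, h1, h2, h3, fun h' => absurd h' h⟩
    have hr := hs.isNfExt_restr hd hle
    obtain ⟨a, ha, hFa⟩ := hF.surj _ _ _ _ hc (hr.bs_left hs) hr
    exact ⟨a, ⟨M₀, hle, ha⟩, hFa, fun h => by rw [← ha, heq h]⟩
  · intro N a₁ a₂ p₁ p₂ _ _ h₁ h₂
    simp [TypeFun.Ker, h₁, h₂, eq_comm]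

/-! ### The copies of one basic type -/

section CopyClass

variable {Mst : Model s.voc} {pst : s.OrbType Mst}

theorem DnfSeq.transports (hs : s.IsGood lam mu) {M N : Model s.voc} {p : s.OrbType M}
    {q : s.OrbType N} {a : LSeq lam} (h : DnfSeq p a) (ht : Transports f p q) :
    DnfSeq q (f ∘ a) := by
  obtain ⟨M₀, hle, h₀, hd⟩ := h
  have hi := ht.1.isIso_map (hs.isoClosed.le_sub _ _ hle)
  refine ⟨M₀.map f, hs.isoClosed.iso_le _ _ _ _ _ ht.1 hi hle, ?_, hd.transports hs ht hi⟩
  rw [← hi.image_eq, h₀, Set.range_comp]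

theorem DnfSeq.mem_seq {N : Model s.voc} {p : s.OrbType N} {a : LSeq lam} (h : DnfSeq p a) :
    a ∈ s.seq lam N := by
  obtain ⟨M₀, hle, h₀, -⟩ := h
  exact ⟨M₀, hle, h₀⟩

/-- Each generating rule preserves non-forking over the listed submodel; for `down` this is
monotonicity. Some side conditions of the rules therefore come for free. -/
theorem CopyClass.dnfSeq (hs : s.IsGood lam mu) {N : Model s.voc} {a : LSeq lam}
    {p : s.OrbType N} (h : CopyClass s lam Mst pst N a p) : DnfSeq p a := by
  induction h with
  | base a ha h => exact h
  | iso f N₁ N₂ a p₁ p₂ ht _ ih => exact ih.transports hs ht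
  | up N₁ N₂ a p₁ p₂ ha hp h hr _ ih => exact h
  | down N₁ N₂ a p₁ p₂ ha hp h hr _ ih =>
    obtain ⟨M₀, hle, h₀, hd⟩ := h
    have hle₀ := le_of_mem_seq hs.isoClosed hr.1 ha hle h₀
    rw [(isRestr_iff hs.isoClosed hr.1).1 hr]
    exact ⟨M₀, hle₀, h₀, hs.dnf_restr hd hle₀ hr.1⟩
  | swap N a₁ a₂ p _ _ _ _ h _ _ => exact h

theorem DnfSeq.bs (hs : s.IsGood lam mu) {N : Model s.voc} {p : s.OrbType N} {a : LSeq lam}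
    (h : DnfSeq p a) : p ∈ s.bs N := by
  obtain ⟨M₀, -, -, hd⟩ := h
  exact hs.bs_of_dnf hd

theorem DnfSeq.of_isNfExt (hs : s.IsGood lam mu) {M N : Model s.voc} {p : s.OrbType M}
    {q : s.OrbType N} {a : LSeq lam} (h : DnfSeq p a) (hq : IsNfExt p q) : DnfSeq q a := by
  obtain ⟨M₀, hle, h₀, hd⟩ := h
  exact ⟨M₀, hs.isoClosed.le_trans _ _ _ hle hq.le, h₀,
    hs.dnf_trans hq.le (hq.eq_restr hs ▸ hd) hq.2.2⟩

theorem CopyClass.of_isNfExt (hs : s.IsGood lam mu) {M N : Model s.voc} {a : LSeq lam}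
    {p : s.OrbType M} {q : s.OrbType N} (h : CopyClass s lam Mst pst M a p) (hq : IsNfExt p q) :
    CopyClass s lam Mst pst N a q :=
  .up _ _ _ _ _ (h.dnfSeq hs).mem_seq hq.1 ((h.dnfSeq hs).of_isNfExt hs hq) hq.2.1 h

theorem CopyClass.swap' (hs : s.IsGood lam mu) {N : Model s.voc} {a b : LSeq lam}
    {p : s.OrbType N} (h : CopyClass s lam Mst pst N a p) (hb : DnfSeq p b) :
    CopyClass s lam Mst pst N b p :=
  .swap _ _ _ _ (h.dnfSeq hs).mem_seq hb.mem_seq (hb.bs hs) (h.dnfSeq hs) hb h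

theorem IsGood.dnfSeq_self (hs : s.IsGood lam mu) {M : Model s.voc} {p : s.OrbType M}
    {a : LSeq lam} (hp : p ∈ s.bs M) (ha : M.carrier = Set.range a) : DnfSeq p a := by
  have hd := hs.dnf_self hp
  exact ⟨M, hs.le_of_dnf hd, ha, hd⟩

/-- The rule `down` requires a sequence inside the smaller model, so `a` is first exchanged for `b`
over `N`. -/
theorem CopyClass.of_restr (hs : s.IsGood lam mu) {M N : Model s.voc} {a b : LSeq lam}
    {p : s.OrbType M} {q : s.OrbType N} (h : CopyClass s lam Mst pst N a q) (hq : IsNfExt p q)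
    (hb : DnfSeq p b) : CopyClass s lam Mst pst M b p :=
  .down _ _ _ _ _ hb.mem_seq hq.1 (hb.of_isNfExt hs hq) hq.2.1
    (h.swap' hs (hb.of_isNfExt hs hq))

/-- Passing between parallel types is one step up to the common extension and one step down to a
listing of the other model. -/
theorem IsGood.isCopyFamily_copyClass (hs : s.IsGood lam mu) :
    IsCopyFamily lam fun M => {p | ∃ a, CopyClass s lam Mst pst M a p} where
  sub := fun M p ⟨a, h⟩ => (h.dnfSeq hs).bs hs
  iso := fun f M N p q ht ⟨a, h⟩ => ⟨f ∘ a, .iso _ _ _ _ _ _ ht h⟩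
  parallel := fun M₀ M₁ N p₀ p₁ p _ hc hp₀ hp₁ ⟨a, h⟩ => by
    obtain ⟨b, hb⟩ := exists_listing hc
    exact ⟨b, (h.of_isNfExt hs hp₀).of_restr hs hp₁ (hs.dnfSeq_self (hp₁.bs_left hs) hb)⟩

theorem IsGood.exists_isLocalImaginarySystem (hs : s.IsGood lam mu) (Mst : Model s.voc)
    (pst : s.OrbType Mst) :
    ∃ (E : s.RelFam lam) (F : s.TypeFun lam), IsLocalImaginarySystem Mst pst E F := by
  have hB := hs.isCopyFamily_copyClass (Mst := Mst) (pst := pst)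
  obtain ⟨F, hF⟩ := hs.exists_names hB
  have hcopy : ∀ N a p, F N a = some p → CopyClass s lam Mst pst N a p := by
    intro N a p h
    obtain ⟨M₀, p₀, h₀, ⟨b, hb⟩, hp⟩ := hF.of_eq _ _ _ h
    exact (hb.swap' hs (hs.dnfSeq_self (hp.bs_left hs) h₀)).of_isNfExt hs hp
  have hsurj : ∀ N a p, CopyClass s lam Mst pst N a p → ∃ (M₀ : Model s.voc)
      (p₀ : s.OrbType M₀), IsNfExt p₀ p ∧ M₀.carrier = Set.range a ∧
      ∃ a, CopyClass s lam Mst pst M₀ a p₀ := by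
    intro N a p h
    obtain ⟨M₀, hle, h₀, hd⟩ := h.dnfSeq hs
    have hr := hs.isNfExt_restr hd hle
    exact ⟨M₀, _, hr, h₀, a, h.of_restr hs hr (hs.dnfSeq_self (hr.bs_left hs) h₀)⟩
  refine ⟨F.Ker, F, hF.isSmooth hs hB, hF.isSmall hs, fun N a => ?_, fun N a p h => hF.bs h,
    fun N a => ?_, hcopy, fun N a p h => ?_, ?_, hF.nfCompatible, hF.isoCompatible⟩
  · rw [TypeFun.ker_self_iff, Option.isSome_iff_exists]
    exact ⟨fun ⟨p, h⟩ => ⟨hF.mem hs h, p, h⟩, fun h => h.2⟩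
  · rw [Option.isSome_iff_exists]
    refine ⟨fun ⟨p, h⟩ => ⟨p, hcopy _ _ _ h⟩, fun ⟨p, h⟩ => ?_⟩
    obtain ⟨M₀, p₀, hp, h₀, hB₀⟩ := hsurj _ _ _ h
    exact hF.exists_eq _ _ _ hp.le h₀ ⟨p₀, hB₀⟩
  · obtain ⟨M₀, p₀, hp, h₀, hB₀⟩ := hsurj _ _ _ h
    obtain ⟨b, hb, hFb⟩ :=
      hF.surj _ _ _ _ (hs.aec.card_eq (hs.isoClosed.le_mem _ _ hp.le).1 h₀) hB₀ hp
    exact ⟨b, hb.symm.trans h₀, hFb⟩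
  · intro N a₁ a₂ p₁ p₂ h₁ h₂
    simp [TypeFun.Ker, h₁, h₂, eq_comm]

end CopyClass

end FrameData

/-! ## Uniqueness of the imaginary system -/

namespace FrameData

open AECData Model

variable {s : FrameData.{u}} {lam : Cardinal.{u}} {mu : Cardinal.{u + 1}}
  {E E' : s.RelFam lam} {F F' : s.TypeFun lam} {M N : Model s.voc}

namespace IsImaginarySystem

theorem mem_seq (h : IsImaginarySystem E F) {a : LSeq lam} {p : s.OrbType N}
    (ha : F N a = some p) : a ∈ s.seq lam N :=
  ((h.dom N a).1 (ha ▸ rfl)).2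

theorem exists_eq (h : IsImaginarySystem E F) (hN : s.K N) {a : LSeq lam}
    (ha : a ∈ s.seq lam N) : ∃ p, F N a = some p :=
  Option.isSome_iff_exists.1 ((h.dom N a).2 ⟨hN, ha⟩)

theorem rel_iff (h : IsImaginarySystem E F) (hN : s.K N) {a b : LSeq lam} :
    E N a b ↔ ∃ p, F N a = some p ∧ F N b = some p := by
  constructor
  · intro hab
    obtain ⟨ha, hb⟩ := h.smooth.dom _ _ _ hN hab
    obtain ⟨p, hp⟩ := h.exists_eq hN ha
    obtain ⟨q, hq⟩ := h.exists_eq hN hb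
    cases (h.eq_iff _ _ _ _ _ ha hb hp hq).1 hab
    exact ⟨p, hp, hq⟩
  · rintro ⟨p, hp, hq⟩
    exact (h.eq_iff _ _ _ _ _ (h.mem_seq hp) (h.mem_seq hq) hp hq).2 rfl

theorem rel_unique (h : IsImaginarySystem E F) (h' : IsImaginarySystem E' F) (hN : s.K N) :
    E N = E' N :=
  funext fun _ => funext fun _ => propext ((h.rel_iff hN).trans (h'.rel_iff hN).symm)

/-- The class named by a basic type. -/
def classOf (h : IsImaginarySystem E F) (hN : s.K N) (p : s.bs N) : classes E N :=
  ⟨{a | F N a = some p.1}, by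
    obtain ⟨a, -, ha, -⟩ := h.surj N hN p p.2
    refine ⟨a, (h.rel_iff hN).2 ⟨_, ha, ha⟩, Set.ext fun b => ?_⟩
    simp [h.rel_iff hN, ha]⟩

theorem classOf_bijective (h : IsImaginarySystem E F) (hN : s.K N) :
    Function.Bijective (h.classOf hN) := by
  constructor
  · intro p q hpq
    obtain ⟨a, -, ha, -⟩ := h.surj N hN p p.2
    have hm : a ∈ (h.classOf hN q).1 := hpq ▸ ha
    exact Subtype.ext (Option.some.inj (ha.symm.trans hm))
  · rintro ⟨c, a, ha, rfl⟩
    obtain ⟨p, hp, -⟩ := (h.rel_iff hN).1 ha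
    refine ⟨⟨p, h.bs _ _ _ hp⟩, Subtype.ext (Set.ext fun b => ?_)⟩
    simp [classOf, h.rel_iff hN, hp]

/-- The bijection between basic types and classes. -/
noncomputable def classEquiv (h : IsImaginarySystem E F) (hN : s.K N) : s.bs N ≃ classes E N :=
  Equiv.ofBijective _ (h.classOf_bijective hN)

theorem mem_classEquiv (h : IsImaginarySystem E F) (hN : s.K N) {p : s.bs N} {a : LSeq lam} :
    a ∈ (h.classEquiv hN p).1 ↔ F N a = some p.1 := Iff.rfl

/-- On both sides classes correspond to basic types over `N`, and the bijection is the composite of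
the two correspondences. Matching the types already forces it; compatibility with extensions and
isomorphisms follows from uniqueness of non-forking extensions and of transported types. -/
theorem existsUnique_isCanonicalIso (hs : s.IsGood lam mu) (h : IsImaginarySystem E F)
    (h' : IsImaginarySystem E' F') :
    ∃! e : ∀ N : {N : Model s.voc // s.K N}, classes E N.1 ≃ classes E' N.1,
      IsCanonicalIso E F E' F' e := by
  refine ⟨fun N => (h.classEquiv N.2).symm.trans (h'.classEquiv N.2), ⟨?_, ?_, ?_⟩, ?_⟩
  · intro N c a ha b hb
    obtain ⟨p, rfl⟩ := (h.classEquiv N.2).surjective c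
    simp only [Equiv.trans_apply, Equiv.symm_apply_apply, mem_classEquiv] at ha hb
    rw [ha, hb]
  · intro M N hle c d hcd b hb
    obtain ⟨p, rfl⟩ := (h.classEquiv M.2).surjective c
    obtain ⟨q, rfl⟩ := (h.classEquiv N.2).surjective d
    obtain ⟨a, has, ha, -⟩ := h.surj M.1 M.2 p p.2
    have haq := (h.mem_classEquiv N.2).1 (hcd ((h.mem_classEquiv M.2).2 ha))
    simp only [Equiv.trans_apply, Equiv.symm_apply_apply, mem_classEquiv] at hb ⊢
    obtain ⟨q₁, hq₁, hn₁⟩ := h.nfCompatible _ _ _ _ hle has ha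
    obtain ⟨q₂, hq₂, hn₂⟩ := h'.nfCompatible _ _ _ _ hle (h'.mem_seq hb) hb
    rw [hq₂, ← haq, hq₁, hn₁.unique hs hn₂]
  · intro f M N hf c d hcd
    obtain ⟨p, rfl⟩ := (h.classEquiv M.2).surjective c
    obtain ⟨q, rfl⟩ := (h.classEquiv N.2).surjective d
    obtain ⟨a, -, ha, -⟩ := h.surj M.1 M.2 p p.2
    have haq : F N.1 (f ∘ a) = some q.1 := (h.mem_classEquiv N.2).1
      (hcd ▸ Set.mem_image_of_mem _ ((h.mem_classEquiv M.2).2 ha))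
    obtain ⟨q', hq', ht⟩ := h.isoCompatible _ _ _ _ _ hf ha
    cases Option.some.inj (haq.symm.trans hq')
    obtain ⟨j, hj, hjl, hjr⟩ := hf.exists_inv
    refine Set.ext fun b => ?_
    simp only [Equiv.trans_apply, Equiv.symm_apply_apply, mem_classEquiv, Set.mem_image]
    constructor
    · rintro ⟨b, hb, rfl⟩
      obtain ⟨r, hr, ht'⟩ := h'.isoCompatible _ _ _ _ _ hf hb
      rw [hr, ht.unique hs.hasAmalgamation hs.isoClosed ht']
    · intro hb
      obtain ⟨r, hr, ht'⟩ := h'.isoCompatible _ _ _ _ _ hj hb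
      refine ⟨j ∘ b, ?_, funext fun i => hjr (mem_of_mem_seq hs.isoClosed (h'.mem_seq hb) i)⟩
      rw [hr, ht'.unique hs.hasAmalgamation hs.isoClosed (ht.inv hs.isoClosed hjl)]
  · intro e he
    funext N
    refine Equiv.ext fun c => ?_
    obtain ⟨p, rfl⟩ := (h.classEquiv N.2).surjective c
    obtain ⟨q, hq⟩ := (h'.classEquiv N.2).surjective (e N (h.classEquiv N.2 p))
    obtain ⟨a, -, ha, -⟩ := h.surj N.1 N.2 p p.2
    obtain ⟨b, -, hb, -⟩ := h'.surj N.1 N.2 q q.2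
    have hab := he.types N _ a ((h.mem_classEquiv N.2).2 ha) b
      (hq ▸ (h'.mem_classEquiv N.2).2 hb)
    rw [ha, hb] at hab
    rw [← hq, Equiv.trans_apply, Equiv.symm_apply_apply]
    exact congrArg _ (Subtype.ext (Option.some.inj hab).symm)

end IsImaginarySystem

end FrameData

/-! ## The expanded class -/

namespace Model

variable {τ : Vocab.{u}} {lam : Cardinal.{u}} {Ms Ns : Model (τ.expand lam)}
  {f : ZFSet.{u} → ZFSet.{u}}

theorem cstar_mem (Ms : Model (τ.expand lam)) : Ms.cstar ∈ Ms.carrier :=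
  Ms.fn_mem .c PEmpty.elim fun i => i.elim

theorem fn_c_eq (Ms : Model (τ.expand lam)) (x : PEmpty → ZFSet.{u}) : Ms.fn .c x = Ms.cstar :=
  congrArg (Ms.fn .c) (funext fun i => i.elim)

theorem IsSub.cstar_eq (h : Ms.IsSub Ns) : Ms.cstar = Ns.cstar :=
  h.fn .c PEmpty.elim fun i => i.elim

theorem IsSub.Fstar_eq (h : Ms.IsSub Ns) {a : LSeq lam} (ha : ∀ i, a i ∈ Ms.carrier) :
    Ms.Fstar a = Ns.Fstar a :=
  h.fn .F a ha

theorem IsIso.cstar_eq (h : IsIso f Ms Ns) : f Ms.cstar = Ns.cstar :=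
  (h.fn .c PEmpty.elim fun i => i.elim).trans (Ns.fn_c_eq _)

theorem IsIso.Fstar_eq (h : IsIso f Ms Ns) {a : LSeq lam} (ha : ∀ i, a i ∈ Ms.carrier) :
    f (Ms.Fstar a) = Ns.Fstar (f ∘ a) :=
  h.fn .F a ha

end Model

namespace AECData

open Model

variable {k : AECData.{u}} {lam : Cardinal.{u}} {mu : Cardinal.{u + 1}} {E : k.RelFam lam}
  {f : ZFSet.{u} → ZFSet.{u}} {M N : Model k.voc} {Ms Ns : Model (k.voc.expand lam)}

namespace IsWitness

theorem mem_iff (h : IsWitness E M Ms) {x : ZFSet.{u}} :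
    x ∈ M.carrier ↔ (fun _ => x) ∈ Ms.rel .P := by
  rw [h.P]
  exact Iff.rfl

theorem carrier_subset (h : IsWitness E M Ms) : M.carrier ⊆ Ms.carrier := fun _ hx =>
  Ms.rel_sub .P _ (h.mem_iff.1 hx) PUnit.unit

/-- The new predicate recovers the universe, and the fixed value of functions outside it turns
agreement into equality of models. -/
theorem unique {M' : Model k.voc} (h : IsWitness E M Ms) (h' : IsWitness E M' Ms) : M = M' := by
  have hc : M.carrier = M'.carrier := Set.ext fun x => h.mem_iff.trans h'.mem_iff.symm
  refine Model.ext hc (funext fun R => (h.rel R).symm.trans (h'.rel R))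
    (funext fun G => funext fun x => ?_)
  by_cases hx : ∀ i, x i ∈ M.carrier
  · exact (h.fn_in G x hx).symm.trans (h'.fn_in G x (hc ▸ hx))
  · rw [M.fn_junk G x hx, M'.fn_junk G x (hc ▸ hx)]

theorem le (h : IsWitness E M Ms) (h' : IsWitness E N Ns) (hle : (k.expand E).le Ms Ns) :
    k.le M N := by
  obtain ⟨-, M', N', hM, hN, hle⟩ := hle
  rwa [h.unique hM, h'.unique hN]

theorem mem_iff_of_isSub (h : IsWitness E M Ms) (h' : IsWitness E N Ns) (hs : Ms.IsSub Ns)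
    {x : ZFSet.{u}} (hx : x ∈ Ms.carrier) : x ∈ M.carrier ↔ x ∈ N.carrier := by
  rw [h.mem_iff, h'.mem_iff]
  exact hs.rel .P _ fun _ => hx

theorem mem_iff_of_isIso (h : IsWitness E M Ms) (h' : IsWitness E N Ns) (hf : IsIso f Ms Ns)
    {x : ZFSet.{u}} (hx : x ∈ Ms.carrier) : x ∈ M.carrier ↔ f x ∈ N.carrier := by
  rw [h.mem_iff, h'.mem_iff]
  exact hf.rel .P _ fun _ => hx

theorem cases (h : IsWitness E M Ms) {x : ZFSet.{u}} (hx : x ∈ Ms.carrier) :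
    x ∈ M.carrier ∨ x = Ms.cstar ∨ ∃ a, E M a a ∧ Ms.Fstar a = x := by
  by_cases h1 : x ∈ M.carrier
  · exact .inl h1
  · by_cases h2 : x = Ms.cstar
    · exact .inr (.inl h2)
    · exact .inr (.inr (h.F_surj x hx h1 h2))

theorem mem_of_rel (hk : k.IsIsoClosed) (hE : IsSmooth E) (h : IsWitness E M Ms) {a : LSeq lam}
    (ha : E M a a) (i) : a i ∈ M.carrier :=
  mem_of_mem_seq hk (hE.dom _ _ _ h.mem ha).1 i

theorem isIso (h : IsWitness E M Ms) (h' : IsWitness E N Ns) (hf : IsIso f Ms Ns) :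
    IsIso f M N := by
  have hm : ∀ x ∈ M.carrier, f x ∈ N.carrier := fun x hx =>
    (h.mem_iff_of_isIso h' hf (h.carrier_subset hx)).1 hx
  refine ⟨⟨hm, hf.bij.injOn.mono h.carrier_subset, fun y hy => ?_⟩, fun R x hx => ?_,
    fun G x hx => ?_⟩
  · obtain ⟨x, hx, rfl⟩ := hf.bij.surjOn (h'.carrier_subset hy)
    exact ⟨x, (h.mem_iff_of_isIso h' hf hx).2 hy, rfl⟩
  · rw [← h.rel, ← h'.rel]
    exact hf.rel (.old R) x fun i => h.carrier_subset (hx i)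
  · rw [← h.fn_in G x hx, ← h'.fn_in G (f ∘ x) fun i => hm _ (hx i)]
    exact hf.fn (.old G) x fun i => h.carrier_subset (hx i)

end IsWitness

theorem IsSmooth.exists_preimage (hk : k.IsIsoClosed) (hE : IsSmooth E) (hM : k.K M)
    (hf : IsIso f M N) {b : LSeq lam} (hb : E N b b) : ∃ a, E M a a ∧ f ∘ a = b := by
  obtain ⟨j, hj, -, hjr⟩ := hf.exists_inv
  have hbs := (hE.dom _ _ _ (hk.iso_mem _ _ _ hf hM) hb).1
  have hfj : f ∘ j ∘ b = b := funext fun i => hjr (mem_of_mem_seq hk hbs i)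
  refine ⟨j ∘ b, ?_, hfj⟩
  rwa [hE.iso f M N _ _ hM hf (seq_iso hk hj hbs) (seq_iso hk hj hbs), hfj]

theorem IsSmooth.iso_iff (hE : IsSmooth E) (hM : k.K M)
    (hf : IsIso f M N) {a b : LSeq lam} (ha : E M a a) (hb : E M b b) :
    E M a b ↔ E N (f ∘ a) (f ∘ b) :=
  hE.iso f M N a b hM hf (hE.dom _ _ _ hM ha).1 (hE.dom _ _ _ hM hb).1

theorem IsWitness.map (hk : k.IsIsoClosed) (hE : IsSmooth E) (h : IsWitness E M Ms)
    (hf : IsIso f Ms Ns) : IsWitness E (M.map f) Ns := by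
  have hi : IsIso f M (M.map f) := isIso_map (hf.bij.injOn.mono h.carrier_subset)
  have hc : (M.map f).carrier ⊆ Ns.carrier := by
    rw [← hi.image_eq, ← hf.image_eq]
    exact Set.image_mono h.carrier_subset
  have hmem : ∀ x ∈ Ms.carrier, (f x ∈ (M.map f).carrier ↔ x ∈ M.carrier) := by
    refine fun x hx => ⟨fun hfx => ?_, hi.mem⟩
    obtain ⟨y, hy, hxy⟩ := hi.bij.surjOn hfx
    exact hf.bij.injOn (h.carrier_subset hy) hx hxy ▸ hy
  have hne : ∀ x ∈ Ms.carrier, (f x = Ns.cstar ↔ x = Ms.cstar) := by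
    intro x hx
    rw [← hf.cstar_eq]
    exact ⟨hf.bij.injOn hx Ms.cstar_mem, fun h => h ▸ rfl⟩
  have hmF : ∀ a, E M a a → f (Ms.Fstar a) = Ns.Fstar (f ∘ a) := fun a ha =>
    hf.Fstar_eq fun i => h.carrier_subset (h.mem_of_rel hk hE ha i)
  refine ⟨hk.iso_mem _ _ _ hi h.mem, Set.ext fun y => ?_, fun R => Set.ext fun y => ?_,
    fun G y hy => ?_, fun G y hy hy' => ?_, fun b hb => ?_, fun b b' hb hb' => ?_,
    fun b hb hb' => ?_, ?_, fun y hy hyM hyc => ?_⟩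
  · by_cases hy : ∀ i, y i ∈ Ns.carrier
    · obtain ⟨x, hx, rfl⟩ := hf.exists_preimage hy
      rw [← hf.rel .P x hx, h.P]
      exact (hmem _ (hx _)).symm
    · exact ⟨fun h => absurd (Ns.rel_sub _ _ h) hy, fun h => absurd (fun _ => hc h) hy⟩
  · by_cases hy : ∀ i, y i ∈ Ns.carrier
    · obtain ⟨x, hx, rfl⟩ := hf.exists_preimage hy
      have h1 := hf.rel (.old R) x hx
      rw [h.rel] at h1
      refine h1.symm.trans ⟨fun hxR => ⟨x, hxR, rfl⟩, ?_⟩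
      rintro ⟨x', hx', he⟩
      rwa [← hf.comp_right_injective (fun i => h.carrier_subset (M.rel_sub R x' hx' i)) hx he]
    · exact ⟨fun h => absurd (Ns.rel_sub (.old R) _ h) hy,
        fun h => absurd (fun i => hc ((M.map f).rel_sub R _ h i)) hy⟩
  · obtain ⟨x, hx, rfl⟩ := hi.exists_preimage hy
    rw [← hi.fn G x hx, ← h.fn_in G x hx]
    exact (hf.fn (.old G) x fun i => h.carrier_subset (hx i)).symm
  · obtain ⟨x, hx, rfl⟩ := hf.exists_preimage (ι := k.voc.funArity G) hy
    rw [← hf.cstar_eq, ← h.fn_out G x hx fun hx' => hy' fun i => hi.mem (hx' i)]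
    exact (hf.fn (.old G) x hx).symm
  · obtain ⟨a, ha, rfl⟩ := hE.exists_preimage hk h.mem hi hb
    obtain ⟨h1, h2, h3⟩ := h.F_mem a ha
    rw [← hmF a ha]
    exact ⟨hf.mem h1, fun h => h2 ((hmem _ h1).1 h), fun h => h3 ((hne _ h1).1 h)⟩
  · obtain ⟨a, ha, rfl⟩ := hE.exists_preimage hk h.mem hi hb
    obtain ⟨a', ha', rfl⟩ := hE.exists_preimage hk h.mem hi hb'
    rw [← hmF a ha, ← hmF a' ha', ← hE.iso_iff h.mem hi ha ha', ← h.F_eq a a' ha ha']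
    exact ⟨hf.bij.injOn (h.F_mem a ha).1 (h.F_mem a' ha').1, fun h => congrArg f h⟩
  · obtain ⟨a, ha, rfl⟩ := hf.exists_preimage hb
    rw [← hf.Fstar_eq ha, h.F_out a ha, hf.cstar_eq]
    intro haE
    exact hb' ((hE.iso_iff h.mem hi haE haE).1 haE)
  · rw [← hf.cstar_eq, hmem _ Ms.cstar_mem]
    exact h.c_notMem
  · obtain ⟨x, hx, rfl⟩ := hf.bij.surjOn hy
    obtain ⟨a, ha, rfl⟩ := h.F_surj x hx (fun h => hyM ((hmem _ hx).2 h))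
      fun h => hyc ((hne _ hx).2 h)
    exact ⟨f ∘ a, (hE.iso_iff h.mem hi ha ha).1 ha, (hmF a ha).symm⟩

/-- Smallness of `E` ensures that the new elements form a set, which is needed to choose fresh
elements outside `Ms`. -/
theorem IsWitness.small (hk : k.IsIsoClosed) (hE' : IsSmall E) (h : IsWitness E M Ms) :
    Small.{u} Ms.carrier := by
  have hM := hk.small M h.mem
  have hcl : Small.{u} (classes E M) := by
    rw [Cardinal.small_iff_lift_mk_lt_univ, Cardinal.lift_id] at hM ⊢
    exact (hE' M h.mem).trans_lt hM
  choose a ha using fun c : classes E M => c.2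
  have hU : Small.{u} ↑(M.carrier ∪ ({Ms.cstar} ∪ Set.range fun c => Ms.Fstar (a c))) :=
    inferInstance
  suffices h' : Ms.carrier ⊆ M.carrier ∪ ({Ms.cstar} ∪ Set.range fun c => Ms.Fstar (a c)) from
    small_subset h'
  intro x hx
  rcases h.cases hx with hx | rfl | ⟨b, hb, rfl⟩
  · exact .inl hx
  · exact .inr (.inl rfl)
  · refine .inr (.inr ⟨⟨_, b, hb, rfl⟩, ?_⟩)
    have hm := (Set.ext_iff.1 (ha ⟨{c | E M b c}, b, hb, rfl⟩).2 b).1 hb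
    exact (h.F_eq _ _ (ha _).1 hb).2 hm

/-- This much of the axioms lets restriction and transport of types be used in the expanded class,
without amalgamation or unions of chains there. -/
theorem IsIsoClosed.expand (hk : k.IsIsoClosed) (hE : IsSmooth E) (hE' : IsSmall E) :
    (k.expand E).IsIsoClosed where
  le_mem := fun _ _ ⟨_, _, _, hM, hN, _⟩ => ⟨⟨_, hM⟩, _, hN⟩
  le_sub := fun _ _ h => h.1
  iso_mem := fun f _ _ hf ⟨M, hM⟩ => ⟨M.map f, hM.map hk hE hf⟩
  iso_le := fun f _ _ _ _ hN hM ⟨h, _, _, hWM, hWN, hle⟩ =>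
    have hWM' := hWM.map hk hE hM
    have hWN' := hWN.map hk hE hN
    ⟨hN.isSub hM h, _, _, hWM', hWN',
      hk.iso_le f _ _ _ _ (hWN.isIso hWN' hN) (hWM.isIso hWM' hM) hle⟩
  le_refl := fun Ms ⟨M, hM⟩ => ⟨.refl Ms, M, M, hM, hM, hk.le_refl _ hM.mem⟩
  le_trans := fun _ _ _ ⟨h, _, _, hM, hN, hle⟩ ⟨h', _, _, hN', hP, hle'⟩ =>
    ⟨h.trans h', _, _, hM, hP, hk.le_trans _ _ _ hle (hN.unique hN' ▸ hle')⟩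
  small := fun _ ⟨_, hM⟩ => hM.small hk hE'

/-! ### Constructing members of the expanded class -/

open Classical in
/-- The expansion of `N` in which `nm a` is the name of the class of `a`. -/
noncomputable def named (E : k.RelFam lam) (N : Model k.voc) (c : ZFSet.{u})
    (nm : LSeq lam → ZFSet.{u}) (hseq : ∀ a, E N a a → ∀ i, a i ∈ N.carrier) :
    Model (k.voc.expand lam) where
  carrier := N.carrier ∪ ({c} ∪ {x | ∃ a, E N a a ∧ nm a = x})
  rel
    | .old R => N.rel R
    | .P => {x | x PUnit.unit ∈ N.carrier}
  fn
    | .old G => fun x => if ∀ i, x i ∈ N.carrier then N.fn G x else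
        if ∀ i, x i ∈ N.carrier ∪ ({c} ∪ {x | ∃ a, E N a a ∧ nm a = x}) then c else ∅
    | .F => fun a => if E N a a then nm a else
        if ∀ i, a i ∈ N.carrier ∪ ({c} ∪ {x | ∃ a, E N a a ∧ nm a = x}) then c else ∅
    | .c => fun _ => c
  rel_sub
    | .old R => fun x hx i => .inl (N.rel_sub R x hx i)
    | .P => fun _ hx _ => .inl hx
  fn_mem
    | .old G => fun x hx => by
      dsimp only
      split_ifs with h
      · exact .inl (N.fn_mem G x h)
      · exact .inr (.inl rfl)
    | .F => fun a ha => by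
      dsimp only
      split_ifs with h
      · exact .inr (.inr ⟨a, h, rfl⟩)
      · exact .inr (.inl rfl)
    | .c => fun _ _ => .inr (.inl rfl)
  fn_junk
    | .old G => fun x hx => by
      dsimp only
      rw [if_neg fun h => hx fun i => .inl (h i), if_neg hx]
    | .F => fun a ha => by
      dsimp only
      rw [if_neg fun h => ha fun i => .inl (hseq a h i), if_neg ha]
    | .c => fun _ hx => absurd (fun i => i.elim) hx

theorem isWitness_named (hN : k.K N) {c : ZFSet.{u}} {nm : LSeq lam → ZFSet.{u}}
    (hseq : ∀ a, E N a a → ∀ i, a i ∈ N.carrier) (hc : c ∉ N.carrier)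
    (hnm : ∀ a, E N a a → nm a ∉ N.carrier ∧ nm a ≠ c)
    (hnm' : ∀ a b, E N a a → E N b b → (nm a = nm b ↔ E N a b)) :
    IsWitness E N (named E N c nm hseq) where
  mem := hN
  P := rfl
  rel _ := rfl
  fn_in G x hx := if_pos hx
  fn_out G x hx hx' := (if_neg hx').trans (if_pos hx)
  F_mem a ha := by
    have h : (named E N c nm hseq).Fstar a = nm a := if_pos ha
    rw [h]
    exact ⟨.inr (.inr ⟨a, ha, rfl⟩), hnm a ha⟩
  F_eq a b ha hb := by
    have h : (named E N c nm hseq).Fstar a = nm a := if_pos ha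
    have h' : (named E N c nm hseq).Fstar b = nm b := if_pos hb
    rw [h, h', hnm' a b ha hb]
  F_out a ha ha' := (if_neg ha').trans (if_pos ha)
  c_notMem := hc
  F_surj b hb hbN hbc := by
    rcases hb with hb | hb | ⟨a, ha, rfl⟩
    · exact absurd hb hbN
    · exact absurd hb hbc
    · exact ⟨a, ha, if_pos ha⟩

theorem IsWitness.expand_le (hk : k.IsEssAEC lam mu) (hE : IsSmooth E) (hM : IsWitness E M Ms)
    (hN : IsWitness E N Ns) (hle : k.le M N) (hsub : Ms.carrier ⊆ Ns.carrier)
    (hdisj : ∀ x ∈ Ms.carrier, x ∈ N.carrier → x ∈ M.carrier) (hc : Ms.cstar = Ns.cstar)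
    (hF : ∀ a, E M a a → Ms.Fstar a = Ns.Fstar a) : (k.expand E).le Ms Ns := by
  have hs := hk.le_sub _ _ hle
  refine ⟨⟨hsub, ?_, ?_⟩, M, N, hM, hN, hle⟩
  · rintro (R | _) x hx
    · have h1 := hM.rel R
      have h2 := hN.rel R
      by_cases hxM : ∀ i, x i ∈ M.carrier
      · have := hs.rel R x hxM
        rwa [← h1, ← h2] at this
      · refine ⟨fun h => absurd (M.rel_sub R x (h1 ▸ h)) hxM, fun h => absurd (fun i => ?_) hxM⟩
        exact hdisj _ (hx i) (N.rel_sub R x (h2 ▸ h) i)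
    · have h1 := hM.P
      have h2 := hN.P
      have h3 : x PUnit.unit ∈ M.carrier ↔ x PUnit.unit ∈ N.carrier :=
        ⟨fun h => hs.carrier h, hdisj _ (hx _)⟩
      rw [h1, h2]
      exact h3
  · rintro (G | _ | _) x hx
    · by_cases hxM : ∀ i, x i ∈ M.carrier
      · exact (hM.fn_in G x hxM).trans ((hs.fn G x hxM).trans
          (hN.fn_in G x fun i => hs.carrier (hxM i)).symm)
      · exact (hM.fn_out G x hx hxM).trans (hc.trans (hN.fn_out G x (fun i => hsub (hx i))
          fun h => hxM fun i => hdisj _ (hx i) (h i)).symm)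
    · by_cases hxE : E M x x
      · exact hF x hxE
      · refine (hM.F_out x hx hxE).trans (hc.trans (hN.F_out x (fun i => hsub (hx i))
          fun h => hxE ?_).symm)
        -- A sequence from `Ms` in the domain over `N` has all its terms in `M` by `hdisj`.
        -- Coherence then puts it in `seq M`, so it was already in the domain over `M`.
        have hseq := (hE.dom _ _ _ hN.mem h).1
        have hseq' := hk.mem_seq_of_range_subset hle hseq fun i =>
          hdisj _ (hx i) (mem_of_mem_seq hk.isIsoClosed hseq i)
        exact (hE.ext _ _ _ _ hle hseq' hseq').1 h
    · exact (Ms.fn_c_eq x).trans (hc.trans (Ns.fn_c_eq x).symm)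

/-- A submodel of the witness gives a submodel in the expanded class. -/
theorem IsWitness.exists_restrict (hk : k.IsEssAEC lam mu) (hE : IsSmooth E)
    (hN : IsWitness E N Ns) (hle : k.le M N) :
    ∃ Ms, IsWitness E M Ms ∧ (k.expand E).le Ms Ns := by
  have hK := (hk.le_mem _ _ hle).1
  have hs := hk.le_sub _ _ hle
  have hseq : ∀ a, E M a a → a ∈ k.seq lam M := fun a ha => (hE.dom _ _ _ hK ha).1
  have hEN : ∀ a, E M a a → E N a a := fun a ha =>
    (hE.ext _ _ _ _ hle (hseq a ha) (hseq a ha)).2 ha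
  have hw := isWitness_named (E := E) (c := Ns.cstar) (nm := Ns.Fstar) hK
    (fun a ha => mem_of_mem_seq hk.isIsoClosed (hseq a ha)) (fun h => hN.c_notMem (hs.carrier h))
    (fun a ha => ⟨fun h => (hN.F_mem a (hEN a ha)).2.1 (hs.carrier h),
      (hN.F_mem a (hEN a ha)).2.2⟩)
    (fun a b ha hb => (hN.F_eq a b (hEN a ha) (hEN b hb)).trans
      (hE.ext _ _ _ _ hle (hseq a ha) (hseq b hb)))
  refine ⟨_, hw, hw.expand_le hk hE hN hle ?_ ?_ rfl fun a ha => if_pos ha⟩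
  · rintro x (hx | rfl | ⟨a, ha, rfl⟩)
    exacts [hN.carrier_subset (hs.carrier hx), Ns.cstar_mem, (hN.F_mem a (hEN a ha)).1]
  · rintro x (hx | rfl | ⟨a, ha, rfl⟩) hxN
    exacts [hx, absurd hxN hN.c_notMem, absurd hxN (hN.F_mem a (hEN a ha)).2.1]

/-- An extension of the witness, if it is disjoint from the new elements, gives an extension in the
expanded class. -/
theorem IsWitness.exists_expand_le (hk : k.IsEssAEC lam mu) (hE : IsSmooth E) (hE' : IsSmall E)
    (hM : IsWitness E M Ms) (hle : k.le M N)
    (hdisj : ∀ x ∈ Ms.carrier, x ∈ N.carrier → x ∈ M.carrier) :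
    ∃ Ns, IsWitness E N Ns ∧ (k.expand E).le Ms Ns := by
  classical
  have hk' := hk.isIsoClosed
  have hK := (hk.le_mem _ _ hle).2
  have hs := hk.le_sub _ _ hle
  have hsmM := hM.small hk' hE'
  have hsmN := hk'.small _ hK
  obtain ⟨z, hz⟩ := ZFSet.exists_pair_notMem (Ms.carrier ∪ N.carrier)
  obtain ⟨code⟩ : Nonempty (classes E N ↪ N.carrier) := Cardinal.le_def _ _ |>.1 (hE' N hK)
  have hseqM : ∀ a, E M a a → a ∈ k.seq lam M := fun a ha => (hE.dom _ _ _ hM.mem ha).1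
  have hEN : ∀ a b, E M a a → E M b b → (E N a b ↔ E M a b) := fun a b ha hb =>
    hE.ext _ _ _ _ hle (hseqM a ha) (hseqM b hb)
  let cl : ∀ a, E N a a → classes E N := fun a ha => ⟨_, a, ha, rfl⟩
  have hcl : ∀ a b ha hb, cl a ha = cl b hb ↔ E N a b := by
    intro a b ha hb
    rw [Subtype.ext_iff]
    refine ⟨fun h => ?_, fun h => Set.ext fun x => ?_⟩
    · have h1 : b ∈ {x | E N b x} := hb
      exact (Set.ext_iff.1 h b).2 h1
    · exact ⟨fun hx => hE.trans _ _ _ _ hK (hE.symm _ _ _ hK h) hx,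
        fun hx => hE.trans _ _ _ _ hK h hx⟩
  -- A class with a member from the domain over `M` keeps its name in `Ms`. The other classes, of
  -- which there are few by smallness, get fresh pairs with first coordinate `z`.
  let nm : LSeq lam → ZFSet.{u} := fun a =>
    if h : ∃ b, E M b b ∧ E N a b then Ms.Fstar h.choose
    else if ha : E N a a then ZFSet.pair z (code (cl a ha)) else ∅
  have hnm₁ : ∀ a b, E M b b → E N a b → nm a = Ms.Fstar b := by
    intro a b hb hab
    have h : ∃ b, E M b b ∧ E N a b := ⟨b, hb, hab⟩
    have h1 : nm a = Ms.Fstar h.choose := dif_pos h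
    rw [h1, hM.F_eq _ _ h.choose_spec.1 hb, ← hEN _ _ h.choose_spec.1 hb]
    exact hE.trans _ _ _ _ hK (hE.symm _ _ _ hK h.choose_spec.2) hab
  have hnm₂ : ∀ a (ha : E N a a), (¬ ∃ b, E M b b ∧ E N a b) →
      nm a = ZFSet.pair z (code (cl a ha)) := fun a ha h => (dif_neg h).trans (dif_pos ha)
  have hcN : Ms.cstar ∉ N.carrier := fun h => hM.c_notMem (hdisj _ Ms.cstar_mem h)
  have hw := isWitness_named (E := E) (c := Ms.cstar) (nm := nm) hK
    (fun a ha => mem_of_mem_seq hk' (hE.dom _ _ _ hK ha).1) hcN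
    (fun a ha => by
      by_cases h : ∃ b, E M b b ∧ E N a b
      · obtain ⟨b, hb, hab⟩ := h
        rw [hnm₁ a b hb hab]
        obtain ⟨h1, h2, h3⟩ := hM.F_mem b hb
        exact ⟨fun h => h2 (hdisj _ h1 h), h3⟩
      · rw [hnm₂ a ha h]
        exact ⟨fun h => hz _ (.inr h), fun h => hz _ (.inl (h ▸ Ms.cstar_mem))⟩)
    (fun a b ha hb => by
      refine ⟨fun h => ?_, fun h => ?_⟩
      · by_cases h1 : ∃ a', E M a' a' ∧ E N a a' <;> by_cases h2 : ∃ b', E M b' b' ∧ E N b b'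
        · obtain ⟨a', ha', haa⟩ := h1
          obtain ⟨b', hb', hbb⟩ := h2
          rw [hnm₁ a a' ha' haa, hnm₁ b b' hb' hbb, hM.F_eq _ _ ha' hb', ← hEN _ _ ha' hb'] at h
          exact hE.trans _ _ _ _ hK (hE.trans _ _ _ _ hK haa h) (hE.symm _ _ _ hK hbb)
        · obtain ⟨a', ha', haa⟩ := h1
          rw [hnm₁ a a' ha' haa, hnm₂ b hb h2] at h
          exact absurd (.inl (h ▸ (hM.F_mem a' ha').1)) (hz _)
        · obtain ⟨b', hb', hbb⟩ := h2
          rw [hnm₂ a ha h1, hnm₁ b b' hb' hbb] at h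
          exact absurd (.inl (h ▸ (hM.F_mem b' hb').1)) (hz _)
        · rw [hnm₂ a ha h1, hnm₂ b hb h2] at h
          exact (hcl a b ha hb).1 (code.injective (Subtype.ext (ZFSet.pair_injective h).2))
      · by_cases h1 : ∃ a', E M a' a' ∧ E N a a'
        · obtain ⟨a', ha', haa⟩ := h1
          rw [hnm₁ a a' ha' haa, hnm₁ b a' ha'
            (hE.trans _ _ _ _ hK (hE.symm _ _ _ hK h) haa)]
        · have h2 : ¬ ∃ b', E M b' b' ∧ E N b b' := fun ⟨b', hb', hbb⟩ =>
            h1 ⟨b', hb', hE.trans _ _ _ _ hK h hbb⟩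
          rw [hnm₂ a ha h1, hnm₂ b hb h2, (hcl a b ha hb).2 h])
  have hnmM : ∀ a, E M a a → nm a = Ms.Fstar a := fun a ha => hnm₁ a a ha ((hEN a a ha ha).2 ha)
  refine ⟨_, hw, hM.expand_le hk hE hw hle ?_ hdisj rfl fun a ha => ?_⟩
  · intro x hx
    rcases hM.cases hx with hx | rfl | ⟨a, ha, rfl⟩
    · exact .inl (hs.carrier hx)
    · exact .inr (.inl rfl)
    · exact .inr (.inr ⟨a, (hEN a a ha ha).2 ha, hnmM a ha⟩)
  · exact ((if_pos ((hEN a a ha ha).2 ha)).trans (hnmM a ha)).symm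

/-! ### Isomorphisms of witnesses -/

/-- On new elements the map is dictated by the names, consistently since isomorphisms preserve `E`.
Bijectivity is obtained afterwards by treating the inverse isomorphism in the same way. -/
theorem IsWitness.exists_extension (hE : IsSmooth E)
    (hM : IsWitness E M Ms) (hN : IsWitness E N Ns) (hf : IsIso f M N) :
    ∃ g : ZFSet.{u} → ZFSet.{u}, Set.MapsTo g Ms.carrier Ns.carrier ∧
      Set.EqOn g f M.carrier ∧ g Ms.cstar = Ns.cstar ∧
      ∀ a, E M a a → g (Ms.Fstar a) = Ns.Fstar (f ∘ a) := by
  classical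
  let g : ZFSet.{u} → ZFSet.{u} := fun x => if x ∈ M.carrier then f x else
    if h : ∃ a, E M a a ∧ Ms.Fstar a = x then Ns.Fstar (f ∘ h.choose) else Ns.cstar
  have h1 : Set.EqOn g f M.carrier := fun x hx => if_pos hx
  have h2 : g Ms.cstar = Ns.cstar := by
    refine (if_neg hM.c_notMem).trans (dif_neg ?_)
    rintro ⟨a, ha, h⟩
    exact (hM.F_mem a ha).2.2 h
  have hiff : ∀ a b, E M a a → E M b b → (E M a b ↔ E N (f ∘ a) (f ∘ b)) := fun a b ha hb =>
    hE.iso_iff hM.mem hf ha hb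
  have h3 : ∀ a, E M a a → g (Ms.Fstar a) = Ns.Fstar (f ∘ a) := by
    intro a ha
    have h : ∃ b, E M b b ∧ Ms.Fstar b = Ms.Fstar a := ⟨a, ha, rfl⟩
    refine ((if_neg (hM.F_mem a ha).2.1).trans (dif_pos h)).trans ?_
    obtain ⟨hb, hba⟩ := h.choose_spec
    rw [hN.F_eq _ _ ((hiff _ _ hb hb).1 hb) ((hiff _ _ ha ha).1 ha), ← hiff _ _ hb ha,
      ← hM.F_eq _ _ hb ha, hba]
  refine ⟨g, fun x hx => ?_, h1, h2, h3⟩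
  rcases hM.cases hx with hx | rfl | ⟨a, ha, rfl⟩
  · rw [h1 hx]
    exact hN.carrier_subset (hf.mem hx)
  · rw [h2]
    exact Ns.cstar_mem
  · rw [h3 a ha]
    exact (hN.F_mem _ ((hiff a a ha ha).1 ha)).1

/-- An isomorphism of witnesses extends to the expanded models. -/
theorem IsWitness.exists_isIso (hk : k.IsIsoClosed) (hE : IsSmooth E)
    (hM : IsWitness E M Ms) (hN : IsWitness E N Ns) (hf : IsIso f M N) :
    ∃ g, IsIso g Ms Ns ∧ Set.EqOn g f M.carrier := by
  obtain ⟨j, hj, hjl, hjr⟩ := hf.exists_inv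
  obtain ⟨g, hg, hgf, hgc, hgF⟩ := hM.exists_extension hE hN hf
  obtain ⟨g', hg', hgf', hgc', hgF'⟩ := hN.exists_extension hE hM hj
  have hiff : ∀ a, E M a a → E N (f ∘ a) (f ∘ a) := fun a ha =>
    (hE.iso_iff hM.mem hf ha ha).1 ha
  have hiff' : ∀ a, E N a a → E M (j ∘ a) (j ∘ a) := fun a ha =>
    (hE.iso_iff hN.mem hj ha ha).1 ha
  have hl : Set.LeftInvOn g' g Ms.carrier := by
    intro x hx
    rcases hM.cases hx with hx | rfl | ⟨a, ha, rfl⟩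
    · rw [hgf hx, hgf' (hf.mem hx), hjl hx]
    · rw [hgc, hgc']
    · rw [hgF a ha, hgF' _ (hiff a ha)]
      exact congrArg _ (funext fun i => hjl (hM.mem_of_rel hk hE ha i))
  have hr : Set.LeftInvOn g g' Ns.carrier := by
    intro x hx
    rcases hN.cases hx with hx | rfl | ⟨a, ha, rfl⟩
    · rw [hgf' hx, hgf (hj.mem hx), hjr hx]
    · rw [hgc', hgc]
    · rw [hgF' a ha, hgF _ (hiff' a ha)]
      exact congrArg _ (funext fun i => hjr (hN.mem_of_rel hk hE ha i))
  have hmem : ∀ x ∈ Ms.carrier, g x ∈ N.carrier → x ∈ M.carrier := by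
    intro x hx hgx
    rcases hM.cases hx with hx | rfl | ⟨a, ha, rfl⟩
    · exact hx
    · exact absurd (hgc ▸ hgx) hN.c_notMem
    · exact absurd (hgF a ha ▸ hgx) (hN.F_mem _ (hiff a ha)).2.1
  have hmem' : ∀ x ∈ M.carrier, g x ∈ N.carrier := fun x hx => hgf hx ▸ hf.mem hx
  have hcomp : ∀ {ι : Type u} {x : ι → ZFSet.{u}}, (∀ i, x i ∈ M.carrier) → g ∘ x = f ∘ x :=
    fun hx => comp_eq_of_eqOn hgf hx
  refine ⟨g, ⟨Set.InvOn.bijOn ⟨hl, hr⟩ hg hg', ?_, ?_⟩, hgf⟩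
  · rintro (R | _) x hx
    · have h1 := hM.rel R
      have h2 := hN.rel R
      rw [h1, h2]
      by_cases hxM : ∀ i, x i ∈ M.carrier
      · exact (hf.rel R x hxM).trans (Iff.of_eq (congrArg (· ∈ N.rel R) (hcomp hxM).symm))
      · exact ⟨fun h => absurd (M.rel_sub R x h) hxM,
          fun h => absurd (fun i => hmem _ (hx i) (N.rel_sub R _ h i)) hxM⟩
    · have h1 := hM.P
      have h2 := hN.P
      rw [h1, h2]
      exact ⟨hmem' _, hmem _ (hx _)⟩
  · rintro (G | _ | _) x hx
    · by_cases hxM : ∀ i, x i ∈ M.carrier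
      · have h1 := hM.fn_in G x hxM
        have h2 := hN.fn_in G (g ∘ x) fun i => hmem' _ (hxM i)
        have h3 := hf.fn G x hxM
        rw [h1, hgf (M.fn_mem G x hxM), h3]
        exact (h2.trans (congrArg (N.fn G) (hcomp hxM))).symm
      · have h1 := hM.fn_out G x hx hxM
        have h2 := hN.fn_out G (g ∘ x) (fun i => hg (hx i))
          fun h => hxM fun i => hmem _ (hx i) (h i)
        rw [h1, hgc]
        exact h2.symm
    · by_cases hxE : E M x x
      · refine (hgF x hxE).trans ?_
        rw [← hcomp (hM.mem_of_rel hk hE hxE)]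
        rfl
      · have h1 := hM.F_out x hx hxE
        have h2 := hN.F_out (g ∘ x) (fun i => hg (hx i)) fun h => hxE (by
          obtain ⟨a, ha, hax⟩ := hE.exists_preimage hk hM.mem hf h
          have hxM : ∀ i, x i ∈ M.carrier := fun i =>
            hmem _ (hx i) (hN.mem_of_rel hk hE h i)
          have hax' : f ∘ a = f ∘ x := hax.trans (hcomp hxM)
          exact hf.comp_right_injective (hM.mem_of_rel hk hE ha) hxM hax' ▸ ha)
        exact (congrArg g h1).trans (hgc.trans h2.symm)
    · exact (congrArg g (Ms.fn_c_eq x)).trans (hgc.trans (Ns.fn_c_eq _).symm)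

end AECData

/-! ## Orbital types in the expanded class -/

namespace AECData

open Model

variable {k : AECData.{u}} {lam : Cardinal.{u}} {mu : Cardinal.{u + 1}} {E : k.RelFam lam}
  {f : ZFSet.{u} → ZFSet.{u}} {M N N' : Model k.voc} {Ms Ns Ns' : Model (k.voc.expand lam)}

theorem IsWitness.isEmb (hN : IsWitness E N Ns) (hN' : IsWitness E N' Ns')
    (hf : (k.expand E).IsEmb f Ns Ns') : k.IsEmb f N N' := by
  obtain ⟨P, hP, hf⟩ := hf
  obtain ⟨-, P₀, -, hP₀, -, -⟩ := id hP
  exact ⟨P₀, hP₀.le hN' hP, hN.isIso hP₀ hf⟩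

theorem IsWitness.mem_iff_of_isEmb (hN : IsWitness E N Ns) (hN' : IsWitness E N' Ns')
    (hf : (k.expand E).IsEmb f Ns Ns') {x : ZFSet.{u}} (hx : x ∈ Ns.carrier) :
    x ∈ N.carrier ↔ f x ∈ N'.carrier := by
  obtain ⟨P, hP, hf⟩ := hf
  obtain ⟨hsub, P₀, -, hP₀, -, -⟩ := id hP
  rw [hN.mem_iff_of_isIso hP₀ hf hx]
  exact hP₀.mem_iff_of_isSub hN' hsub (hf.mem hx)

/-- An embedding of witnesses extends to the expanded models. -/
theorem IsWitness.exists_isEmb (hk : k.IsEssAEC lam mu) (hE : IsSmooth E)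
    (hN : IsWitness E N Ns) (hN' : IsWitness E N' Ns') (hf : k.IsEmb f N N') :
    ∃ g, (k.expand E).IsEmb g Ns Ns' ∧ Set.EqOn g f N.carrier := by
  obtain ⟨P₀, hP₀, hf⟩ := hf
  obtain ⟨P, hP, hle⟩ := hN'.exists_restrict hk hE hP₀
  obtain ⟨g, hg, hgf⟩ := hN.exists_isIso hk.isIsoClosed hE hP hf
  exact ⟨g, ⟨P, hle, hg⟩, hgf⟩

/-- An embedding that is the identity on a witness is the identity on the expanded model. -/
theorem IsWitness.eqOn_id (hk : k.IsIsoClosed) (hE : IsSmooth E) (hM : IsWitness E M Ms)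
    (h : Ms.IsSub Ns) (h' : Ms.IsSub Ns') (hf : (k.expand E).IsEmb f Ns Ns')
    (hid : Set.EqOn f id M.carrier) : Set.EqOn f id Ms.carrier := by
  obtain ⟨P, ⟨hP, -⟩, hf⟩ := hf
  intro x hx
  rcases hM.cases hx with hx | rfl | ⟨a, ha, rfl⟩
  · exact hid hx
  · rw [h.cstar_eq, hf.cstar_eq, hP.cstar_eq, ← h'.cstar_eq, h.cstar_eq]
    rfl
  · have haM : ∀ i, a i ∈ Ms.carrier := fun i => hM.carrier_subset (hM.mem_of_rel hk hE ha i)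
    have haN : ∀ i, a i ∈ Ns.carrier := fun i => h.carrier (haM i)
    have hfa : f ∘ a = a := funext fun i => hid (hM.mem_of_rel hk hE ha i)
    have haP : ∀ i, a i ∈ P.carrier := fun i => congrFun hfa i ▸ hf.mem (haN i)
    rw [id, h.Fstar_eq haM, hf.Fstar_eq haN, hfa, hP.Fstar_eq haP, ← h'.Fstar_eq haM,
      h.Fstar_eq haM]

theorem IsWitness.isOrtp_of_atRel (hM : IsWitness E M Ms) {x y : (k.expand E).TypeRep Ms} (hx : IsWitness E N x.N)
    (hy : IsWitness E N' y.N) (h : (k.expand E).AtRel Ms x y) {p : k.OrbType M}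
    (hp : IsOrtp x.a M N p) : IsOrtp y.a M N' p := by
  obtain ⟨Q, f, g, hf, hg, hfi, hgi, he⟩ := h
  obtain ⟨Q₀, hQ⟩ : ∃ Q₀, IsWitness E Q₀ Q := by
    obtain ⟨P, ⟨-, -, Q₀, -, hQ₀, -⟩, -⟩ := hf
    exact ⟨Q₀, hQ₀⟩
  obtain ⟨h1, h2, rfl⟩ := hp
  have hya : y.a ∈ N'.carrier := by
    rw [hy.mem_iff_of_isEmb hQ hg y.mem, ← he]
    exact (hx.mem_iff_of_isEmb hQ hf x.mem).1 h2
  refine ⟨hM.le hy y.le, hya, Quot.sound ⟨Q₀, f, g, hx.isEmb hQ hf, hy.isEmb hQ hg,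
    hfi.mono hM.carrier_subset, hgi.mono hM.carrier_subset, he⟩⟩

/-- Equality of types in the expanded class implies equality of the types over the witness. -/
theorem IsWitness.isOrtp_of_isOrtp (hM : IsWitness E M Ms)
    (hN : IsWitness E N Ns) (hN' : IsWitness E N' Ns') {a a' : ZFSet.{u}}
    {ps : (k.expand E).OrbType Ms} (h : IsOrtp (k := k.expand E) a Ms Ns ps)
    (h' : IsOrtp (k := k.expand E) a' Ms Ns' ps)
    {p : k.OrbType M} (hp : IsOrtp a M N p) : IsOrtp a' M N' p := by
  obtain ⟨h1, h2, h3⟩ := h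
  obtain ⟨h1', h2', h3'⟩ := h'
  -- Amalgamation in the expanded class is not assumed, so equality of types only provides a chain
  -- of `AtRel` steps, along which the projection is followed.
  have key : ∀ x y : (k.expand E).TypeRep Ms, Relation.EqvGen ((k.expand E).AtRel Ms) x y →
      ∀ N N', IsWitness E N x.N → IsWitness E N' y.N →
      (IsOrtp x.a M N p ↔ IsOrtp y.a M N' p) := by
    intro x y hxy
    induction hxy with
    | rel x y h =>
      exact fun N N' hx hy => ⟨hM.isOrtp_of_atRel hx hy h, hM.isOrtp_of_atRel hy hx h.symm⟩
    | refl x => exact fun N N' hx hy => by rw [hx.unique hy]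
    | symm x y _ ih => exact fun N N' hx hy => (ih N' N hy hx).symm
    | trans x y z _ _ ih₁ ih₂ =>
      intro N N' hx hz
      obtain ⟨-, -, P, -, hP, -⟩ := y.le
      exact (ih₁ N P hx hP).trans (ih₂ P N' hP hz)
  exact (key _ _ (Quot.eqvGen_exact (h3.symm.trans h3')) N N' hN hN').1 hp

/-- A model of the expanded class has extensions whose witnesses extend a given extension of its
witness, up to isomorphism. -/
theorem IsWitness.exists_le (hk : k.IsEssAEC lam mu) (hE : IsSmooth E) (hE' : IsSmall E)
    (hM : IsWitness E M Ms) (hle : k.le M N) :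
    ∃ N' h Ns, IsIso h N N' ∧ Set.EqOn h id M.carrier ∧ IsWitness E N' Ns ∧
      (k.expand E).le Ms Ns := by
  have hk' := hk.isIsoClosed
  have hsm := hM.small hk' hE'
  -- The given extension might contain names or the constant of `Ms`, so it is replaced by a copy
  -- over `M` whose new elements avoid `Ms`.
  obtain ⟨N', h, hle', hh, hid, hA⟩ := hk'.exists_extension (.refl M) hle Ms.carrier
  obtain ⟨Ns, hNs, hMN⟩ := hM.exists_expand_le hk hE hE' hle' fun x hx hxN => by
    obtain ⟨y, hy, rfl⟩ := hh.bij.surjOn hxN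
    by_cases hyM : y ∈ M.carrier
    · rw [hid hyM]
      exact hyM
    · exact absurd hx (hA y hy hyM)
  exact ⟨N', h, Ns, hh, hid, hNs, hMN⟩

/-- Equality of the types over the witness implies equality of types in the expanded class. -/
theorem IsWitness.eq_of_isOrtp (hk : k.IsEssAEC lam mu) (ham : k.HasAmalgamation)
    (hE : IsSmooth E) (hE' : IsSmall E) (hM : IsWitness E M Ms)
    (hN : IsWitness E N Ns) (hN' : IsWitness E N' Ns') {a a' : ZFSet.{u}}
    {ps ps' : (k.expand E).OrbType Ms} (h : IsOrtp (k := k.expand E) a Ms Ns ps)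
    (h' : IsOrtp (k := k.expand E) a' Ms Ns' ps')
    {p : k.OrbType M} (hp : IsOrtp a M N p) (hp' : IsOrtp a' M N' p) : ps = ps' := by
  have hk' := hk.isIsoClosed
  obtain ⟨hMN, ha, rfl⟩ := hp
  obtain ⟨hMN', ha', he⟩ := hp'
  obtain ⟨Q, f, g, hf, hg, hfi, hgi, he⟩ := (quot_mk_eq_iff ham hk').1 he
  dsimp only at hf hg he
  have hMQ := hf.le hk' hMN hfi
  -- The amalgam over the witness is lifted to a model above `Ms`, and the two embeddings are lifted
  -- into it; as they fix `M`, they fix all of `Ms`.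
  obtain ⟨R, j, Rs, hj, hji, hR, hMR⟩ := hM.exists_le hk hE hE' hMQ
  have hjE := IsEmb.of_isIso hk' hj (hk'.le_mem _ _ hMQ).2
  obtain ⟨f', hf', hff⟩ := hN.exists_isEmb hk hE hR (hjE.comp hk' hf)
  obtain ⟨g', hg', hgg⟩ := hN'.exists_isEmb hk hE hR (hjE.comp hk' hg)
  obtain ⟨hle, hm, rfl⟩ := h
  obtain ⟨hle', hm', rfl⟩ := h'
  refine Quot.sound ⟨Rs, f', g', hf', hg', hM.eqOn_id hk' hE hle.1 hMR.1 hf' fun x hx => ?_,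
    hM.eqOn_id hk' hE hle'.1 hMR.1 hg' fun x hx => ?_, ?_⟩
  · rw [hff ((hk'.le_sub _ _ hMN).carrier hx), Function.comp_apply, hfi hx]
    exact hji hx
  · rw [hgg ((hk'.le_sub _ _ hMN').carrier hx), Function.comp_apply, hgi hx]
    exact hji hx
  · rw [hff ha, hgg ha', Function.comp_apply, Function.comp_apply, he]

end AECData

/-! ## The expanded frame -/

namespace FrameData

open AECData Model

variable {s : FrameData.{u}} {lam : Cardinal.{u}} {mu : Cardinal.{u + 1}} {E : s.RelFam lam}
  {F : s.TypeFun lam} {f : ZFSet.{u} → ZFSet.{u}} {M N : Model s.voc}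
  {Ms Ns : Model (s.expand E).voc}

/-- A type is declared basic through one realization; since its projection does not depend on the
realization, any other one serves as well. -/
theorem IsGood.mem_expand_bs_iff (hs : s.IsGood lam mu) (hM : IsWitness E M Ms)
    (hN : IsWitness E N Ns) {a : ZFSet.{u}} {ps : (s.expand E).OrbType Ms}
    (h : IsOrtp a Ms Ns ps) : ps ∈ (s.expand E).bs Ms ↔ s.IsBasicTriple M N a := by
  constructor
  · rintro ⟨Ns', a', M', N', h', hM', hN', -, p, hp, hp'⟩
    cases hM.unique hM'
    have hpa := hM.isOrtp_of_isOrtp hN' hN h' h hp'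
    exact hs.isBasicTriple hp hpa
  · exact fun hb => ⟨Ns, a, M, N, h, hM, hN, hb⟩

theorem IsGood.isBasicTriple_of_expand (hs : s.IsGood lam mu) (hM : IsWitness E M Ms)
    (hN : IsWitness E N Ns) {a : ZFSet.{u}} (h : (s.expand E).IsBasicTriple Ms Ns a) :
    s.IsBasicTriple M N a := by
  obtain ⟨-, ps, hps, h⟩ := h
  exact (hs.mem_expand_bs_iff hM hN h).1 hps

theorem IsGood.projectsTo (hs : s.IsGood lam mu) (hM : IsWitness E M Ms)
    (hN : IsWitness E N Ns) {a : ZFSet.{u}} {ps : (s.expand E).OrbType Ms} {p : s.OrbType M}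
    (h : IsOrtp a Ms Ns ps) (hp : IsOrtp a M N p) (hb : p ∈ s.bs M) : ProjectsTo E M ps p :=
  ⟨(hs.mem_expand_bs_iff hM hN h).2 (hs.isBasicTriple hb hp), hb, fun _ _ _ hN' h' =>
    hM.isOrtp_of_isOrtp hN hN' h h' hp⟩

theorem exists_witness_isOrtp (ps : (s.expand E).OrbType Ms) :
    ∃ a Ns N, IsWitness E N Ns ∧ IsOrtp a Ms Ns ps := by
  obtain ⟨a, Ns, h⟩ := exists_isOrtp ps
  obtain ⟨-, -, N, -, hN, -⟩ := h.le
  exact ⟨a, Ns, N, hN, h⟩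

theorem IsGood.exists_projectsTo (hs : s.IsGood lam mu) (hM : IsWitness E M Ms)
    {ps : (s.expand E).OrbType Ms} (hps : ps ∈ (s.expand E).bs Ms) :
    ∃ p : s.OrbType M, ProjectsTo E M ps p := by
  obtain ⟨a, Ns, N, hN, h⟩ := exists_witness_isOrtp ps
  obtain ⟨-, p, hp, hpa⟩ := (hs.mem_expand_bs_iff hM hN h).1 hps
  exact ⟨p, hs.projectsTo hM hN h hpa hp⟩

theorem ProjectsTo.unique {ps : (s.expand E).OrbType Ms} {p q : s.OrbType M}
    (h : ProjectsTo E M ps p) (h' : ProjectsTo E M ps q) : p = q := by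
  obtain ⟨a, Ns, N, hN, ha⟩ := exists_witness_isOrtp ps
  exact (h.2.2 _ _ _ hN ha).unique (h'.2.2 _ _ _ hN ha)

theorem ProjectsTo.injective (hs : s.IsGood lam mu) (hE : IsSmooth E) (hE' : IsSmall E)
    (hM : IsWitness E M Ms) {ps qs : (s.expand E).OrbType Ms} {p : s.OrbType M}
    (h : ProjectsTo E M ps p) (h' : ProjectsTo E M qs p) : ps = qs := by
  obtain ⟨a, Ns, N, hN, ha⟩ := exists_witness_isOrtp ps
  obtain ⟨b, Ns', N', hN', hb⟩ := exists_witness_isOrtp qs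
  exact hM.eq_of_isOrtp hs.aec hs.hasAmalgamation hE hE' hN hN' ha hb (h.2.2 _ _ _ hN ha)
    (h'.2.2 _ _ _ hN' hb)

theorem IsGood.exists_lift (hs : s.IsGood lam mu) (hE : IsSmooth E) (hE' : IsSmall E)
    (hM : IsWitness E M Ms) {p : s.OrbType M} (hp : p ∈ s.bs M) :
    ∃ ps : (s.expand E).OrbType Ms, ProjectsTo E M ps p := by
  obtain ⟨a, N, ha⟩ := exists_isOrtp p
  obtain ⟨N', h, Ns, hh, hid, hN', hle⟩ := hM.exists_le hs.aec hE hE' ha.le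
  have ha' := ha.of_isEmb hs.isoClosed (.of_isIso hs.isoClosed hh
    (hs.isoClosed.le_mem _ _ ha.le).2) hid
  exact ⟨_, hs.projectsTo hM hN' (isOrtp_mk hle (hN'.carrier_subset ha'.mem)) ha' hp⟩

/-- Non-forking extensions in the expanded frame project to non-forking extensions. -/
theorem IsNfExt.exists_projectsTo (hs : s.IsGood lam mu) (hM : IsWitness E M Ms)
    (hN : IsWitness E N Ns) {ps : (s.expand E).OrbType Ms} {qs : (s.expand E).OrbType Ns}
    (h : IsNfExt ps qs) :
    ∃ (p : s.OrbType M) (q : s.OrbType N), ProjectsTo E M ps p ∧ ProjectsTo E N qs q ∧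
      IsNfExt p q := by
  obtain ⟨hqs, ⟨hle, c, Ps, hcq, hcp⟩, b, Qs, hb, -, -, M', N', Q, hM', hN', hQ, hnf⟩ := h
  cases hM.unique hM'
  cases hN.unique hN'
  obtain ⟨q, hq⟩ := hs.exists_projectsTo hN hqs
  obtain ⟨-, -, P, -, hP, -⟩ := id hcq.le
  have hd : Dnf M q := ⟨b, Q, hq.2.2 _ _ _ hQ hb, hnf⟩
  have hq' := hq.2.2 _ _ _ hP hcq
  have hbt := (hs.nf_dom _ _ _ _ (hs.nf_of_dnf hd hq')).2.2.1
  obtain ⟨p, hp⟩ := hs.exists_projectsTo hM ((hs.mem_expand_bs_iff hM hP hcp).2 hbt)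
  exact ⟨p, q, hp, hq, hq.2.1, ⟨hM.le hN hle, c, P, hq', hp.2.2 _ _ _ hP hcp⟩, hd⟩

/-- A basic type of the expanded frame does not fork over a smaller model if its projection does
not fork over the witness. -/
theorem ProjectsTo.dnf (hs : s.IsGood lam mu) (hM : IsWitness E M Ms)
    (hN : IsWitness E N Ns) (hle : (s.expand E).le Ms Ns) {qs : (s.expand E).OrbType Ns}
    {q : s.OrbType N} (hq : ProjectsTo E N qs q) (h : Dnf M q) : Dnf Ms qs := by
  obtain ⟨c, Ps, P, hP, hc⟩ := exists_witness_isOrtp qs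
  exact ⟨c, Ps, hc, hle, hc.le, M, N, P, hM, hN, hP, hs.nf_of_dnf h (hq.2.2 _ _ _ hP hc)⟩

theorem ProjectsTo.isNfExt (hs : s.IsGood lam mu) (hE : IsSmooth E) (hE' : IsSmall E)
    (hM : IsWitness E M Ms) (hN : IsWitness E N Ns) (hle : (s.expand E).le Ms Ns)
    {ps : (s.expand E).OrbType Ms} {qs : (s.expand E).OrbType Ns} {p : s.OrbType M}
    {q : s.OrbType N} (hp : ProjectsTo E M ps p) (hq : ProjectsTo E N qs q) (h : IsNfExt p q) :
    IsNfExt ps qs := by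
  have hk := hs.isoClosed.expand hE hE'
  obtain ⟨c, Ps, P, hP, hc⟩ := exists_witness_isOrtp qs
  have hcq := hq.2.2 _ _ _ hP hc
  have hcM := hc.restr hk hle
  have hcp := hcq.restr hs.isoClosed h.le
  rw [← h.eq_restr hs] at hcp
  have hpr := hs.projectsTo hM hP hcM hcp hp.2.1
  rw [← hp.injective hs hE hE' hM hpr] at hcM
  exact ⟨hq.1, ⟨hle, c, Ps, hc, hcM⟩, hq.dnf hs hM hN hle h.2.2⟩

/-- The name of the projection of a basic type of the expanded frame. -/
noncomputable def base (E : s.RelFam lam) (F : s.TypeFun lam) (Ms : Model (s.expand E).voc)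
    (ps : (s.expand E).OrbType Ms) : ZFSet.{u} :=
  Classical.epsilon fun b => ∀ M (p : s.OrbType M) a, IsWitness E M Ms → ProjectsTo E M ps p →
    F M a = some p → b = Model.Fstar Ms a

namespace IsImaginarySystem

theorem Fstar_eq_iff (h : IsImaginarySystem E F) (hM : IsWitness E M Ms) {a b : LSeq lam}
    {p q : s.OrbType M} (ha : F M a = some p) (hb : F M b = some q) :
    Model.Fstar Ms a = Model.Fstar Ms b ↔ p = q := by
  rw [hM.F_eq a b ((h.rel_iff hM.mem).2 ⟨p, ha, ha⟩) ((h.rel_iff hM.mem).2 ⟨q, hb, hb⟩)]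
  exact h.eq_iff _ _ _ _ _ (h.mem_seq ha) (h.mem_seq hb) ha hb

/-- Witness and projection are unique, and all sequences naming the same type have the same value
under `Fstar`, so the condition in the definition of `base` is satisfiable. -/
theorem base_eq (h : IsImaginarySystem E F) (hM : IsWitness E M Ms)
    {ps : (s.expand E).OrbType Ms} {p : s.OrbType M} (hp : ProjectsTo E M ps p) {a : LSeq lam}
    (ha : F M a = some p) : base E F Ms ps = Model.Fstar Ms a := by
  refine Classical.epsilon_spec (p := fun b => ∀ M (p : s.OrbType M) a, IsWitness E M Ms →
    ProjectsTo E M ps p → F M a = some p → b = Model.Fstar Ms a)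
    ⟨Model.Fstar Ms a, ?_⟩ M p a hM hp ha
  intro M' p' a' hM' hp' ha'
  cases hM.unique hM'
  exact (h.Fstar_eq_iff hM ha ha').2 (hp.unique hp')

theorem exists_base_eq (hs : s.IsGood lam mu) (h : IsImaginarySystem E F)
    (hM : IsWitness E M Ms) {ps : (s.expand E).OrbType Ms} (hps : ps ∈ (s.expand E).bs Ms) :
    ∃ (p : s.OrbType M) (a : LSeq lam), ProjectsTo E M ps p ∧ a ∈ s.seq lam M ∧
      F M a = some p ∧ base E F Ms ps = Model.Fstar Ms a := by
  obtain ⟨p, hp⟩ := hs.exists_projectsTo hM hps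
  obtain ⟨a, has, ha, -⟩ := h.surj M hM.mem p hp.2.1
  exact ⟨p, a, hp, has, ha, h.base_eq hM hp ha⟩

theorem Fstar_mem (h : IsImaginarySystem E F) (hM : IsWitness E M Ms) {a : LSeq lam}
    {p : s.OrbType M} (ha : F M a = some p) : Model.Fstar Ms a ∈ Ms.carrier :=
  (hM.F_mem a ((h.rel_iff hM.mem).2 ⟨p, ha, ha⟩)).1

theorem Fstar_eq_of_le (hs : s.IsGood lam mu) (h : IsImaginarySystem E F)
    (hM : IsWitness E M Ms) (hle : (s.expand E).le Ms Ns) {a : LSeq lam} {p : s.OrbType M}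
    (ha : F M a = some p) : Model.Fstar Ms a = Model.Fstar Ns a :=
  hle.1.Fstar_eq fun i => hM.carrier_subset (mem_of_mem_seq hs.isoClosed (h.mem_seq ha) i)

/-- Types with the same name are equal. -/
theorem base_injective (hs : s.IsGood lam mu) (h : IsImaginarySystem E F)
    {ps qs : (s.expand E).OrbType Ms} (hps : ps ∈ (s.expand E).bs Ms)
    (hqs : qs ∈ (s.expand E).bs Ms) (he : base E F Ms ps = base E F Ms qs) : ps = qs := by
  obtain ⟨-, -, M, -, -, hM, -⟩ := id hps
  obtain ⟨p, a, hp, -, ha, hpa⟩ := h.exists_base_eq hs hM hps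
  obtain ⟨q, b, hq, -, hb, hqb⟩ := h.exists_base_eq hs hM hqs
  rw [hpa, hqb, h.Fstar_eq_iff hM ha hb] at he
  exact hp.injective hs h.smooth h.small hM (he ▸ hq)

/-- One sequence names both the projection and its non-forking extension, and `Fstar` takes the same
value on it in both models. -/
theorem base_eq_of_isNfExt (hs : s.IsGood lam mu) (h : IsImaginarySystem E F)
    {ps : (s.expand E).OrbType Ms} {qs : (s.expand E).OrbType Ns} (hn : IsNfExt ps qs) :
    ps ∈ (s.expand E).bs Ms ∧ base E F Ms ps = base E F Ns qs := by
  obtain ⟨-, M, N, hM, hN, hle⟩ := hn.le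
  obtain ⟨p, q, hp, hq, hpq⟩ := hn.exists_projectsTo hs hM hN
  obtain ⟨a, has, ha, -⟩ := h.surj M hM.mem p hp.2.1
  obtain ⟨q', hq', hpq'⟩ := h.nfCompatible _ _ _ _ hle has ha
  cases hpq.unique hs hpq'
  refine ⟨hp.1, ?_⟩
  rw [h.base_eq hM hp ha, h.base_eq hN hq hq', h.Fstar_eq_of_le hs hM hn.le ha]

/-- Both `F` and the interpretation of the new function symbol commute with isomorphisms. -/
theorem base_eq_of_transports (hs : s.IsGood lam mu) (h : IsImaginarySystem E F)
    {ps : (s.expand E).OrbType Ms} {qs : (s.expand E).OrbType Ns} (ht : Transports f ps qs)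
    (hps : ps ∈ (s.expand E).bs Ms) :
    qs ∈ (s.expand E).bs Ns ∧ base E F Ns qs = f (base E F Ms ps) := by
  have hk := hs.isoClosed
  obtain ⟨hf, a, Ps, Qs, g, ha, hga, hg, hgf⟩ := ht
  obtain ⟨-, M, P, hM, hP, -⟩ := id ha.le
  obtain ⟨-, N, Q, hN, hQ, -⟩ := id hga.le
  obtain ⟨p, x, hp, hxs, hx, hpx⟩ := h.exists_base_eq hs hM hps
  have hap := hp.2.2 _ _ _ hP ha
  have hf' := hM.isIso hN hf
  have hg' := hP.isIso hQ hg
  obtain ⟨q, hq, ht⟩ := h.isoCompatible _ _ _ _ _ hf' hx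
  have haq := ht.isOrtp hs.hasAmalgamation hk hap hg' (hgf.mono hM.carrier_subset)
  have hpr := hs.projectsTo hN hQ hga haq (hs.bs_iso _ _ _ _ _ ht hp.2.1)
  refine ⟨hpr.1, ?_⟩
  rw [h.base_eq hN hpr hq, hpx]
  exact (hf.Fstar_eq fun i => hM.carrier_subset (mem_of_mem_seq hk hxs i)).symm

theorem base_mem (hs : s.IsGood lam mu) (h : IsImaginarySystem E F)
    {ps : (s.expand E).OrbType Ms} (hps : ps ∈ (s.expand E).bs Ms) :
    base E F Ms ps ∈ Ms.carrier := by
  obtain ⟨-, -, M, -, -, hM, -⟩ := id hps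
  obtain ⟨p, a, -, -, ha, hpa⟩ := h.exists_base_eq hs hM hps
  rw [hpa]
  exact h.Fstar_mem hM ha

theorem parallel_iff (hs : s.IsGood lam mu) (h : IsImaginarySystem E F)
    {Ms₁ Ms₂ : Model (s.expand E).voc} {ps₁ : (s.expand E).OrbType Ms₁}
    {ps₂ : (s.expand E).OrbType Ms₂} (hle₁ : (s.expand E).le Ms₁ Ms)
    (hle₂ : (s.expand E).le Ms₂ Ms) (hps₁ : ps₁ ∈ (s.expand E).bs Ms₁)
    (hps₂ : ps₂ ∈ (s.expand E).bs Ms₂) :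
    Parallel ps₁ ps₂ ↔ base E F Ms₁ ps₁ = base E F Ms₂ ps₂ := by
  constructor
  · rintro ⟨Ns, qs, h₁, h₂⟩
    rw [(h.base_eq_of_isNfExt hs h₁).2, (h.base_eq_of_isNfExt hs h₂).2]
  · intro he
    obtain ⟨-, M₁, M, hM₁, hM, hMM₁⟩ := id hle₁
    obtain ⟨-, M₂, -, hM₂, -, -⟩ := id hle₂
    have hMM₂ := hM₂.le hM hle₂
    obtain ⟨p₁, a₁, hp₁, has₁, ha₁, hpa₁⟩ := h.exists_base_eq hs hM₁ hps₁
    obtain ⟨p₂, a₂, hp₂, has₂, ha₂, hpa₂⟩ := h.exists_base_eq hs hM₂ hps₂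
    -- Both projections extend to types over the common upper bound under their old names. Equal
    -- bases mean equal names there, hence one common extension, which lifts to the expanded frame.
    obtain ⟨q₁, hq₁, hn₁⟩ := h.nfCompatible _ _ _ _ hMM₁ has₁ ha₁
    obtain ⟨q₂, hq₂, hn₂⟩ := h.nfCompatible _ _ _ _ hMM₂ has₂ ha₂
    rw [hpa₁, hpa₂, h.Fstar_eq_of_le hs hM₁ hle₁ ha₁, h.Fstar_eq_of_le hs hM₂ hle₂ ha₂,
      h.Fstar_eq_iff hM hq₁ hq₂] at he
    cases he
    obtain ⟨qs, hqs⟩ := hs.exists_lift h.smooth h.small hM hn₁.1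
    exact ⟨Ms, qs, hp₁.isNfExt hs h.smooth h.small hM₁ hM hle₁ hqs hn₁,
      hp₂.isNfExt hs h.smooth h.small hM₂ hM hle₂ hqs hn₂⟩

/-- The invariant class consists of the basic types in the place whose base is that of `ps`. Over
`Ms` only `ps` has this base. Over an extension, the name of `ps` belongs to its non-forking
extension, so a member with that base does not fork over `Ms`. -/
theorem doesNotSplit (hs : s.IsGood lam mu) (h : IsImaginarySystem E F)
    {ps : (s.expand E).OrbType Ms} (hps : ps ∈ (s.expand E).bs Ms) :
    DoesNotSplit ps {base E F Ms ps} := by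
  have hk := hs.isoClosed.expand h.smooth h.small
  have hsub : {base E F Ms ps} ⊆ Ms.carrier := Set.singleton_subset_iff.2 (h.base_mem hs hps)
  -- Every model in the place contains the base, so an inverse of an isomorphism fixing the base
  -- fixes it too.
  have hmem : ∀ Ns, (s.expand E).InPlace Ms {base E F Ms ps} Ns →
      base E F Ms ps ∈ Ns.carrier := by
    rintro Ns ⟨hM, hg⟩
    have key : ∀ N₁ N₂ : Model (s.expand E).voc, Relation.EqvGen (fun N₁ N₂ =>
        {base E F Ms ps} ⊆ N₁.carrier ∧ {base E F Ms ps} ⊆ N₂.carrier ∧ (s.expand E).le N₁ N₂)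
        N₁ N₂ → ({base E F Ms ps} ⊆ N₁.carrier ↔ {base E F Ms ps} ⊆ N₂.carrier) := by
      intro N₁ N₂ h
      induction h with
      | rel _ _ h => exact ⟨fun _ => h.2.1, fun _ => h.1⟩
      | refl => exact Iff.rfl
      | symm _ _ _ ih => exact ih.symm
      | trans _ _ _ _ _ ih₁ ih₂ => exact ih₁.trans ih₂
    exact Set.singleton_subset_iff.1 ((key _ _ hg).1 hM)
  refine ⟨hps, hsub, fun Ns => {qs | (s.expand E).InPlace Ms {base E F Ms ps} Ns ∧
    qs ∈ (s.expand E).bs Ns ∧ base E F Ns qs = base E F Ms ps}, ⟨?_, ?_, ?_⟩, ?_, ?_⟩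
  · exact fun N p hp => ⟨hp.1, hp.2.1⟩
  · intro f N₁ N₂ p₁ p₂ hN₁ hN₂ hf ht
    have hfb : f (base E F Ms ps) = base E F Ms ps := hf rfl
    constructor
    · rintro ⟨-, hb, he⟩
      obtain ⟨hb', he'⟩ := h.base_eq_of_transports hs ht hb
      exact ⟨hN₂, hb', by rw [he', he, hfb]⟩
    · rintro ⟨-, hb, he⟩
      obtain ⟨j, -, hjl, -⟩ := ht.1.exists_inv
      obtain ⟨hb', he'⟩ := h.base_eq_of_transports hs (ht.inv hk hjl) hb
      refine ⟨hN₁, hb', ?_⟩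
      rw [he', he, ← hfb, hjl (hmem N₁ hN₁), hfb]
  · intro N₁ N₂ p₁ p₂ hN₁ hN₂ hn
    obtain ⟨hb, he⟩ := h.base_eq_of_isNfExt hs hn
    exact ⟨fun hp => ⟨hN₁, hb, he.trans hp.2.2⟩, fun hp => ⟨hN₂, hn.1, he.symm.trans hp.2.2⟩⟩
  · refine Set.ext fun qs => ⟨fun hq => h.base_injective hs hq.2.1 hps hq.2.2, ?_⟩
    rintro rfl
    exact ⟨⟨hsub, .refl _⟩, hps, rfl⟩
  · rintro Ns hle qs ⟨-, hqs, he⟩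
    obtain ⟨-, M, N, hM, hN, hMN⟩ := id hle
    obtain ⟨p, a, hp, has, ha, hpa⟩ := h.exists_base_eq hs hM hps
    obtain ⟨q, b, hq, hbs, hb, hqb⟩ := h.exists_base_eq hs hN hqs
    obtain ⟨q', hq', hn⟩ := h.nfCompatible _ _ _ _ hMN has ha
    rw [hqb, hpa, h.Fstar_eq_of_le hs hM hle ha, h.Fstar_eq_iff hN hb hq'] at he
    exact hq.dnf hs hM hN hle (he ▸ hn.2.2)

end IsImaginarySystem

end FrameData

theorem claimb56 (s : FrameData.{u}) (lam : Cardinal.{u}) (mu : Cardinal.{u + 1})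
    (hs : s.IsGood lam mu) :
    -- (1) the copies of one basic type
    (∀ (Mst : Model s.voc) (pst : s.OrbType Mst), s.K Mst → pst ∈ s.bs Mst →
      ∃ (E : s.RelFam lam) (F : s.TypeFun lam), FrameData.IsLocalImaginarySystem Mst pst E F) ∧
    -- (2) all basic types: existence, and uniqueness up to a unique canonical isomorphism
    (∃ (E : s.RelFam lam) (F : s.TypeFun lam), FrameData.IsImaginarySystem E F) ∧
    (∀ (E E' : s.RelFam lam) (F : s.TypeFun lam), FrameData.IsImaginarySystem E F →
      FrameData.IsImaginarySystem E' F → ∀ N, s.K N → E N = E' N) ∧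
    (∀ (E E' : s.RelFam lam) (F F' : s.TypeFun lam), FrameData.IsImaginarySystem E F →
      FrameData.IsImaginarySystem E' F' →
      ∃! h : ∀ N : {N : Model s.voc // s.K N}, AECData.classes E N.1 ≃ AECData.classes E' N.1,
        FrameData.IsCanonicalIso E F E' F' h) ∧
    -- (3) bases of basic types in the expanded frame
    (∀ (E : s.RelFam lam) (F : s.TypeFun lam), FrameData.IsImaginarySystem E F →
      (∀ M₁ M₂ Ms₁ Ms₂ a, AECData.IsWitness E M₁ Ms₁ → AECData.IsWitness E M₂ Ms₂ →
        (s.expand E).IsBasicTriple Ms₁ Ms₂ a → s.IsBasicTriple M₁ M₂ a) ∧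
      (∀ M (Ms : Model (s.expand E).voc) (ps : (s.expand E).OrbType Ms),
        AECData.IsWitness E M Ms → ps ∈ (s.expand E).bs Ms →
        ∃! p : s.OrbType M, FrameData.ProjectsTo E M ps p) ∧
      ∃ bas : ∀ Ms : Model (s.expand E).voc, (s.expand E).OrbType Ms → ZFSet.{u},
        (∀ M (Ms : Model (s.expand E).voc) (ps : (s.expand E).OrbType Ms) (p : s.OrbType M),
          AECData.IsWitness E M Ms → FrameData.ProjectsTo E M ps p →
          bas Ms ps ∈ Ms.carrier ∧ (∃ a ∈ s.seq lam M, F M a = some p) ∧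
          ∀ a ∈ s.seq lam M, F M a = some p → bas Ms ps = Model.Fstar Ms a) ∧
        (∀ (Ms₁ Ms₂ Ms : Model (s.expand E).voc)
          (ps₁ : (s.expand E).OrbType Ms₁) (ps₂ : (s.expand E).OrbType Ms₂),
          (s.expand E).le Ms₁ Ms → (s.expand E).le Ms₂ Ms →
          ps₁ ∈ (s.expand E).bs Ms₁ → ps₂ ∈ (s.expand E).bs Ms₂ →
          (FrameData.Parallel ps₁ ps₂ ↔ bas Ms₁ ps₁ = bas Ms₂ ps₂)) ∧
        (∀ (Ms : Model (s.expand E).voc) (ps : (s.expand E).OrbType Ms),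
          ps ∈ (s.expand E).bs Ms →
          FrameData.DoesNotSplit ps {bas Ms ps} ∧
          ∀ f, Model.IsIso f Ms Ms → f (bas Ms ps) = bas Ms ps →
            AECData.Transports f ps ps)) := by
  refine ⟨fun Mst pst _ _ => hs.exists_isLocalImaginarySystem Mst pst, hs.exists_isImaginarySystem,
    fun E E' F h h' N hN => h.rel_unique h' hN,
    fun E E' F F' h h' => h.existsUnique_isCanonicalIso hs h', fun E F h => ⟨?_, ?_,
      FrameData.base E F, ?_, ?_, ?_⟩⟩
  · exact fun M₁ M₂ Ms₁ Ms₂ a h₁ h₂ ha => hs.isBasicTriple_of_expand h₁ h₂ ha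
  · intro M Ms ps hM hps
    obtain ⟨p, hp⟩ := hs.exists_projectsTo hM hps
    exact ⟨p, hp, fun q hq => hq.unique hp⟩
  · intro M Ms ps p hM hp
    obtain ⟨a, has, ha, -⟩ := h.surj M hM.mem p hp.2.1
    exact ⟨h.base_mem hs hp.1, ⟨a, has, ha⟩, fun b _ hb => h.base_eq hM hp hb⟩
  · exact fun Ms₁ Ms₂ Ms ps₁ ps₂ h₁ h₂ hp₁ hp₂ => h.parallel_iff hs h₁ h₂ hp₁ hp₂
  · refine fun Ms ps hps => ⟨h.doesNotSplit hs hps, fun f hf hfb => ?_⟩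
    obtain ⟨qs, ht⟩ := AECData.exists_transports (hs.isoClosed.expand h.smooth h.small) hf ps
    obtain ⟨hqs, he⟩ := h.base_eq_of_transports hs ht hps
    -- The image of `ps` under `f` has base `f` of the base, which is the same element, so it is
    -- `ps` itself.
    rwa [h.base_injective hs hqs hps (he.trans hfb)] at ht
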